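/- **Setting.** Let $X$ be a complex manifold (Hausdorff, $\sigma$-compact, not necessarily compact) of dimension $d$, let $L\to X$ be a holomorphic line bundle with a smooth metric $|\cdot|$, and let $s$ be a holomorphic section of $L$ whose zero set $D=\{s=0\}$ is a hypersurface with normal crossings, i.e. around every $x\in X$ there are holomorphic coordinates $(z_1,\dots,z_d)$ centred at $x$ (*adapted coordinates*) in which $D=\{z_1\cdots z_k=0\}$ for some $0\le k\le d$. Let $\omega$ be a quasi-meromorphic form on $X$ with polar set contained in $D$: a complex-valued differential form of degree $n$ that is smooth on $X\setminus D$ and that around every point of $X$ can be written $\omega=\widetilde\omega/(f\bar g)$ with $\widetilde\omega$ a smooth form and $f,g$ holomorphic functions, $f,g\not\equiv 0$. For $x\in X$ and adapted coordinates around $x$, let $J,K$ be the minimal multi-indices (with $J_j=K_j=0$ for $j>k$) such that $z^J\bar z^K\omega$ is smooth near $x$, and write $s=z^Iu$ near $x$ in a local holomorphic frame of $L$, with $u$ holomorphic and non-vanishing. Put $$\kappa_x(\omega)=\#\{j: J_j\ne0\text{ and }K_j\neq0\},\qquad o_{\omega,x}(s)=\prod_{j:\,J_j\ne0,\ K_j\ne0}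 I_j ,$$ which do not depend on the choices, and $$\kappa(\omega)=\max_{x\in X}\kappa_x(\omega)\le d,\qquad o_\omega(s)=\max_{x\in X}o_{\omega,x}(s),$$ where it is assumed that the numbers $o_{\omega,x}(s)$, $x\in X$, are bounded (this is automatic if $X$ is compact). **Theorem.** Let $\xi$ be a test form (smooth with compact support) on $X$ of degree $2d-n$. Then there is a real number $R$ such that the integral $$F_\xi(\lambda)=o_\omega(s)\int_X|s|^{2\lambda}\,\omega\wedge\xi$$ converges absolutely and is a holomorphic function of $\lambda$ for $\operatorname{Re}\lambda>R$. Moreover (a) $F_\xi$ has a meromorphic extension to $\mathbb C$; (b) all poles of this extension are rational numbers; (c) the order of its pole at $0$ is at most $\kappa(\omega)$. -/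

import Mathlib

open scoped Manifold ContDiff Topology Bundle
open Set Filter MeasureTheory

namespace QuasiMero

/-- The local model `ℂ^d` of a complex manifold of dimension `d`. -/
abbrev CSpace (d : ℕ) : Type := Fin d → ℂ

/-- A complex manifold (with its given charts) is a smooth real manifold. -/
theorem isManifold_real (d : ℕ) (X : Type*) [TopologicalSpace X] [ChartedSpace (CSpace d) X]
    [IsManifold 𝓘(ℂ, CSpace d) ω X] : IsManifold 𝓘(ℝ, CSpace d) ∞ X := by
  refine isManifold_of_contDiffOn 𝓘(ℝ, CSpace d) ∞ X fun e e' he he' => ?_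
  have h := (contDiffGroupoid ω 𝓘(ℂ, CSpace d)).compatible he he'
  rw [contDiffGroupoid, mem_groupoid_of_pregroupoid] at h
  have h1 := h.1
  simp only [contDiffPregroupoid] at h1
  exact (h1.restrict_scalars ℝ).of_le le_top

section Forms

/-- Complex-valued differential `n`-forms on `X`, without any regularity: at each point an
`ℝ`-multilinear alternating `n`-form on the (real) tangent space with values in `ℂ`. -/
abbrev DForm (d n : ℕ) (X : Type*) [TopologicalSpace X] [ChartedSpace (CSpace d) X] : Type _ :=
  ∀ x : X, TangentSpace 𝓘(ℝ, CSpace d) x [⋀^Fin n]→ₗ[ℝ] ℂ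

variable {d : ℕ} {X : Type*} [TopologicalSpace X] [ChartedSpace (CSpace d) X]

/-- The expression of a form in the preferred chart at `x`: the pull-back `(φ⁻¹)^* η`
to `ℂ^d`, where `φ = chartAt x`. -/
noncomputable def localRep {n : ℕ} (η : DForm d n X) (x : X) (z : CSpace d) :
    CSpace d [⋀^Fin n]→ₗ[ℝ] ℂ :=
  (η ((chartAt (CSpace d) x).symm z)).compLinearMap
    (mfderiv 𝓘(ℝ, CSpace d) 𝓘(ℝ, CSpace d) (chartAt (CSpace d) x).symm z).toLinearMap

/-- `η` is a smooth form in a neighbourhood of `x`: all its coefficients in the chart at `x` are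
smooth (as functions of the real variables) near the image of `x`. -/
def SmoothNear {n : ℕ} (η : DForm d n X) (x : X) : Prop :=
  ∀ v : Fin n → CSpace d, ∀ᶠ z in 𝓝 (chartAt (CSpace d) x x),
    ContDiffAt ℝ ∞ (fun z => localRep η x z v) z

/-- Near `x`, the form `η`, considered off `D` only, extends to a smooth form. -/
def ExtendsSmoothly {n : ℕ} (D : Set X) (η : DForm d n X) (x : X) : Prop :=
  ∃ η' : DForm d n X, SmoothNear η' x ∧ ∀ᶠ y in 𝓝 x, y ∉ D → η' y = η y

/-- Test forms: smooth forms with compact support. -/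
def IsTestForm {n : ℕ} (ξ : DForm d n X) : Prop :=
  (∀ x, SmoothNear ξ x) ∧ ∃ K : Set X, IsCompact K ∧ ∀ x ∉ K, ξ x = 0

/-- The wedge product, `(η ∧ ξ)(v) = ∑ sign(σ) η(v_{σ(1)},…,v_{σ(n)}) ξ(v_{σ(n+1)},…,v_{σ(n+m)})`,
the sum being over the `(n, m)`-shuffles `σ`. -/
noncomputable def wedge {n m k : ℕ} (h : n + m = k) (η : DForm d n X) (ξ : DForm d m X) :
    DForm d k X := fun x =>
  ((LinearMap.mul' ℝ ℂ).compAlternatingMap ((η x).domCoprod (ξ x))).domDomCongr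
    (finSumFinEquiv.trans (finCongr h))

/-- `f` is holomorphic in a neighbourhood of `x`. -/
def HolomorphicNear (d : ℕ) {X : Type*} [TopologicalSpace X] [ChartedSpace (CSpace d) X]
    (f : X → ℂ) (x : X) : Prop :=
  ContMDiffAt 𝓘(ℂ, CSpace d) 𝓘(ℂ, ℂ) ω f x

/-- `θ` is a quasi-meromorphic form whose polar set is contained in `D`: it is smooth off `D`, and
around each point it is of the form `θ̃ / (f ḡ)` with `θ̃` smooth and `f`, `g` holomorphic and not
identically zero. The values of `θ` on `D` are irrelevant. -/
def IsQuasiMeromorphic {n : ℕ} (D : Set X) (θ : DForm d n X) : Prop :=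
  (∀ x ∉ D, SmoothNear θ x) ∧
  ∀ x, ∃ f g : X → ℂ, HolomorphicNear d f x ∧ HolomorphicNear d g x ∧
    (∃ᶠ y in 𝓝 x, f y ≠ 0) ∧ (∃ᶠ y in 𝓝 x, g y ≠ 0) ∧
    ExtendsSmoothly D (fun y => (f y * starRingEnd ℂ (g y)) • θ y) x

end Forms

section Integration

/-- The standard positively oriented real frame
`∂/∂x₁, ∂/∂y₁, …, ∂/∂x_d, ∂/∂y_d` of `ℂ^d`. -/
noncomputable def stdFrame (d : ℕ) (i : Fin (2 * d)) : CSpace d :=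
  Pi.single ⟨i.1 / 2, by have := i.2; omega⟩ (if i.1 % 2 = 0 then 1 else Complex.I)

variable {d : ℕ} {X : Type*} [TopologicalSpace X] [ChartedSpace (CSpace d) X]

/-- The coefficient `h` of `(φ⁻¹)^* η = h dx₁∧dy₁∧…∧dx_d∧dy_d`, `φ = chartAt x`. -/
noncomputable def density (η : DForm d (2 * d) X) (x : X) (z : CSpace d) : ℂ :=
  localRep η x z (stdFrame d)

variable [T2Space X] [SigmaCompactSpace X] [IsManifold 𝓘(ℂ, CSpace d) ω X]

variable (d X) in
/-- A smooth partition of unity subordinate to the cover of `X` by its preferred charts. -/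
noncomputable def chartPartition : SmoothPartitionOfUnity X 𝓘(ℝ, CSpace d) X univ :=
  haveI := isManifold_real d X
  (SmoothPartitionOfUnity.exists_isSubordinate_chartAt_source 𝓘(ℝ, CSpace d) X).choose

variable (d X) in
theorem chartPartition_isSubordinate :
    (chartPartition d X).IsSubordinate (fun x => (chartAt (CSpace d) x).source) :=
  haveI := isManifold_real d X
  (SmoothPartitionOfUnity.exists_isSubordinate_chartAt_source 𝓘(ℝ, CSpace d) X).choose_spec

/-- The part of (the density of) a top form `η` in the chart at `x` cut out by the partition
of unity. -/
noncomputable def localDensity (η : DForm d (2 * d) X) (x : X) (z : CSpace d) : ℂ :=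
  (chartPartition d X x ((chartAt (CSpace d) x).symm z) : ℂ) * density η x z

/-- Absolute convergence of `∫_X η`, for `η` a top form vanishing off a compact set. -/
def FormIntegrable (η : DForm d (2 * d) X) : Prop :=
  ∀ x : X, IntegrableOn (localDensity η x) (chartAt (CSpace d) x).target

/-- The integral `∫_X η` of a top form vanishing off a compact set, over the complex manifold `X`
with its natural orientation. -/
noncomputable def formIntegral (η : DForm d (2 * d) X) : ℂ :=
  ∑ᶠ x : X, ∫ z in (chartAt (CSpace d) x).target, localDensity η x z

end Integration

section NormalCrossings

variable {d : ℕ} {X : Type*} [TopologicalSpace X] [ChartedSpace (CSpace d) X]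

/-- `e` is a holomorphic chart centred at `x` in whose domain
`D = {∏_{j ∈ A} z_j = 0}`. -/
def IsAdaptedChart [IsManifold 𝓘(ℂ, CSpace d) ω X] (D : Set X) (x : X)
    (e : OpenPartialHomeomorph X (CSpace d)) (A : Finset (Fin d)) : Prop :=
  e ∈ IsManifold.maximalAtlas 𝓘(ℂ, CSpace d) ω X ∧ x ∈ e.source ∧ e x = 0 ∧
    ∀ y ∈ e.source, y ∈ D ↔ ∏ j ∈ A, e y j = 0

/-- `D` is a hypersurface with normal crossings. -/
def HasNormalCrossings (d : ℕ) {X : Type*} [TopologicalSpace X] [ChartedSpace (CSpace d) X]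
    [IsManifold 𝓘(ℂ, CSpace d) ω X] (D : Set X) : Prop :=
  ∀ x : X, ∃ (e : OpenPartialHomeomorph X (CSpace d)) (A : Finset (Fin d)),
    IsAdaptedChart D x e A

/-- The pairs of multi-indices `(J, K)`, supported on `A`, such that `z^J z̄^K θ` is smooth
near `x`, where `z = e` are the coordinates of a chart adapted to `D`. -/
def clearingExponents {n : ℕ} (D : Set X) (θ : DForm d n X) (x : X)
    (e : OpenPartialHomeomorph X (CSpace d)) (A : Finset (Fin d)) :
    Set ((Fin d → ℕ) × (Fin d → ℕ)) :=
  {P | (∀ j ∉ A, P.1 j = 0 ∧ P.2 j = 0) ∧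
    ExtendsSmoothly D
      (fun y => ((∏ j, e y j ^ P.1 j) * ∏ j, (starRingEnd ℂ) (e y j) ^ P.2 j) • θ y) x}

/-- `J` and `K` are the pole orders of `θ` at `x`: the minimal multi-indices such that
`z^J z̄^K θ` is smooth near `x`. -/
def IsPoleOrder {n : ℕ} (D : Set X) (θ : DForm d n X) (x : X)
    (e : OpenPartialHomeomorph X (CSpace d)) (A : Finset (Fin d)) (J K : Fin d → ℕ) : Prop :=
  Minimal (· ∈ clearingExponents D θ x e A) (J, K)

/-- The indices `j` such that `θ` has both a holomorphic and an anti-holomorphic pole along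
`{z_j = 0}`. -/
def mixedIndices {d : ℕ} (J K : Fin d → ℕ) : Finset (Fin d) :=
  Finset.univ.filter fun j => J j ≠ 0 ∧ K j ≠ 0

variable [IsManifold 𝓘(ℂ, CSpace d) ω X]

/-- `κ_x(θ) = #{j : J_j ≠ 0 and K_j ≠ 0}`, with `J`, `K` the pole orders at `x` in a chart adapted
to `D` (the set of which we take the supremum has exactly one element). -/
noncomputable def kappaAt {n : ℕ} (D : Set X) (θ : DForm d n X) (x : X) : ℕ :=
  sSup {k | ∃ (e : OpenPartialHomeomorph X (CSpace d)) (A : Finset (Fin d)) (J K : Fin d → ℕ),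
    IsAdaptedChart D x e A ∧ IsPoleOrder D θ x e A J K ∧ k = (mixedIndices J K).card}

/-- `κ(θ) = max_x κ_x(θ)`; note that `κ_x(θ) ≤ d`. -/
noncomputable def kappa {n : ℕ} (D : Set X) (θ : DForm d n X) : ℕ :=
  ⨆ x : X, kappaAt D θ x

end NormalCrossings

section LineBundle

variable {d : ℕ} {X : Type*} [TopologicalSpace X] [ChartedSpace (CSpace d) X]
variable (L : X → Type*) [TopologicalSpace (Bundle.TotalSpace ℂ L)]
  [∀ x, AddCommGroup (L x)] [∀ x, Module ℂ (L x)] [∀ x, TopologicalSpace (L x)]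
  [FiberBundle ℂ L] [VectorBundle ℂ ℂ L]

/-- A smooth (Hermitian) metric on the complex line bundle `L`, given by the norms on the fibres;
smoothness means that the norms of the local frames of `L` are smooth. -/
structure LineMetric (d : ℕ) {X : Type*} [TopologicalSpace X] [ChartedSpace (CSpace d) X]
    (L : X → Type*) [TopologicalSpace (Bundle.TotalSpace ℂ L)]
    [∀ x, AddCommGroup (L x)] [∀ x, Module ℂ (L x)] [∀ x, TopologicalSpace (L x)]
    [FiberBundle ℂ L] [VectorBundle ℂ ℂ L] where
  norm : ∀ x, L x → ℝ
  norm_smul : ∀ x (c : ℂ) (v : L x), norm x (c • v) = ‖c‖ * norm x v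
  norm_pos : ∀ x (v : L x), v ≠ 0 → 0 < norm x v
  smooth : ∀ x : X, ContMDiffOn 𝓘(ℝ, CSpace d) 𝓘(ℝ, ℝ) ∞
    (fun y => norm y ((trivializationAt ℂ L x).symm y 1)) (trivializationAt ℂ L x).baseSet

variable {L}

/-- `s` is a holomorphic section of `L`. -/
def IsHolomorphicSection (d : ℕ) {X : Type*} [TopologicalSpace X] [ChartedSpace (CSpace d) X]
    {L : X → Type*} [TopologicalSpace (Bundle.TotalSpace ℂ L)]
    [∀ x, AddCommGroup (L x)] [∀ x, Module ℂ (L x)] [∀ x, TopologicalSpace (L x)]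
    [FiberBundle ℂ L] [VectorBundle ℂ ℂ L] (s : ∀ x, L x) : Prop :=
  ContMDiff 𝓘(ℂ, CSpace d) (𝓘(ℂ, CSpace d).prod 𝓘(ℂ, ℂ)) ω
    (fun x => Bundle.TotalSpace.mk' ℂ x (s x))

/-- The zero set `{s = 0}`. -/
def zeroLocus {X : Type*} {L : X → Type*} [∀ x, AddCommGroup (L x)] (s : ∀ x, L x) : Set X :=
  {x | s x = 0}

/-- In a local holomorphic frame of `L` near `x`, `s = z^I u` with `u` holomorphic and
non-vanishing, where `z = e`. -/
def HasMonomialForm (s : ∀ x, L x) (x : X) (e : OpenPartialHomeomorph X (CSpace d))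
    (I : Fin d → ℕ) : Prop :=
  ∃ u : X → ℂ, HolomorphicNear d u x ∧ u x ≠ 0 ∧
    ∀ᶠ y in 𝓝 x, (trivializationAt ℂ L x ⟨y, s y⟩).2 = (∏ j, e y j ^ I j) * u y

variable [IsManifold 𝓘(ℂ, CSpace d) ω X]

/-- `o_{θ,x}(s) = ∏ I_j`, the product over the local components `{z_j = 0}` of `D = {s = 0}` along
which `θ` has both holomorphic and anti-holomorphic poles, of the vanishing orders of `s` there
(the set of which we take the supremum has exactly one element). -/
noncomputable def poleWeightAt {n : ℕ} (s : ∀ x, L x) (θ : DForm d n X) (x : X) : ℕ :=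
  sSup {k | ∃ (e : OpenPartialHomeomorph X (CSpace d)) (A : Finset (Fin d))
    (J K I : Fin d → ℕ), IsAdaptedChart (zeroLocus s) x e A ∧
    IsPoleOrder (zeroLocus s) θ x e A J K ∧ HasMonomialForm s x e I ∧
    k = ∏ j ∈ mixedIndices J K, I j}

/-- `o_θ(s) = max_x o_{θ,x}(s)` (meaningful when the `o_{θ,x}(s)` are bounded). -/
noncomputable def poleWeight {n : ℕ} (s : ∀ x, L x) (θ : DForm d n X) : ℕ :=
  ⨆ x : X, poleWeightAt s θ x

/-- The top form `|s|^{2l} θ ∧ ξ`. -/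
noncomputable def regularizedForm {n m : ℕ} (h : n + m = 2 * d) (s : ∀ x, L x)
    (μ : LineMetric d L) (θ : DForm d n X) (ξ : DForm d m X) (l : ℂ) : DForm d (2 * d) X :=
  fun x => ((μ.norm x (s x) : ℂ) ^ (2 * l)) • wedge h θ ξ x

/-- `F_ξ(l) = o_θ(s) ∫_X |s|^{2l} θ ∧ ξ`. -/
noncomputable def zetaFunction [T2Space X] [SigmaCompactSpace X] {n m : ℕ} (h : n + m = 2 * d)
    (s : ∀ x, L x) (μ : LineMetric d L) (θ : DForm d n X) (ξ : DForm d m X) (l : ℂ) : ℂ :=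
  (poleWeight s θ : ℂ) * formIntegral (regularizedForm h s μ θ ξ l)

end LineBundle

end QuasiMero

namespace QuasiMero

/-! ### Meromorphic continuation from half-planes -/

section Continuation

open Polynomial

/-! Partitions of unity turn `F_ξ` into a finite sum of integrals over `ℂ^d`. In adapted coordinates
`|s|² = |z^I|² e^ψ` with `ψ` smooth, and `z^J z̄^K θ` is smooth, so each summand is `Z(a,b) = ∫
|z^I|^{2l} z^a z̄^b e^{lψ} χ` with `a = -J`, `b = -K` and `χ` smooth of compact support. It
converges for large `re l`.

Where `I_j ≠ 0`, integration by parts with `∂/∂z_j` gives a functional equation of Bernstein-Sato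
type: `(I_j l + a_j + 1) Z(a,b)` is a combination of integrals in which `a_j` is raised by one
(`exists_raise_left`); `∂/∂z̄_j` does the same for `b_j`. After finitely many steps the integrals
converge for `re l > -n`. All divisors are linear with rational roots, so the poles are rational. A
divisor vanishes at `0` only when an exponent is raised from `-1` to `0`. If at most one of `a_j`,
`b_j` is negative, raising the other one avoids this; if both are negative, it happens once, after
which `j` is no longer mixed. Hence the order of the pole at `0` is at most the number of mixed
indices (`continuesTo_monomialIntegral`).

The other half is the existence of `J` and `K`. By definition only `f ḡ θ` is smooth, with `f`, `g`
arbitrary holomorphic germs; since `θ` is smooth off `D`, they can be replaced by monomials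
(`exists_monomial_mul_contDiffOn`). Split off the powers of the coordinates dividing `f` and `g`;
the remaining `f'`, `g'` vanish identically on no component of `D`. Small discs in a generic
direction meet `D` only outside the zeros of `f' g'`, so the cleared form is smooth along them, and
dividing there by `f'` and `ḡ'` costs derivatives but no boundedness, uniformly in the disc
(`bounded_of_holomorphic_smul`). The argument applies to all derivatives, so these are bounded off
the zeros of `f' g'`, and the cleared form extends smoothly across them
(`IsBoundedClass.contDiffOn_extendFrom`). The slicing also shows that `s` is `z^I` times a unit
(`ne_zero_of_zeros_on_coord`). -/

theorem halfPlane_subset {A B : ℝ} (h : A ≤ B) : {l : ℂ | B < l.re} ⊆ {l | A < l.re} := by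
  intro l hl
  rw [mem_ofPred_eq] at hl ⊢
  exact h.trans_lt hl

/-- Up to a factor `l ^ κ * q l`, where `q` is a polynomial with rational non-zero roots, the
function `F`, given for large `re l`, extends holomorphically to `re l > -n`. -/
def ContinuesTo (n κ : ℕ) (F : ℂ → ℂ) : Prop :=
  ∃ q : ℂ[X], q.eval 0 ≠ 0 ∧ (∀ x, q.eval x = 0 → ∃ r : ℚ, x = r) ∧
    ∃ H : ℂ → ℂ, DifferentiableOn ℂ H {l | -(n : ℝ) < l.re} ∧
      ∃ R : ℝ, ∀ l : ℂ, R < l.re → H l = l ^ κ * q.eval l * F l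

/-- `F` is holomorphic for large `re l` and has a meromorphic continuation to `ℂ` with rational
poles and order at least `-κ` at `0`. -/
def HasRationalContinuation (κ : ℕ) (F : ℂ → ℂ) : Prop :=
  (∃ R : ℝ, DifferentiableOn ℂ F {l | R < l.re}) ∧ ∀ n, ContinuesTo n κ F

namespace ContinuesTo

variable {n κ : ℕ} {F F' : ℂ → ℂ}

theorem congr (hF : ContinuesTo n κ F) {R : ℝ} (h : ∀ l : ℂ, R < l.re → F' l = F l) :
    ContinuesTo n κ F' := by
  obtain ⟨q, hq, hr, H, hH, R', hR⟩ := hF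
  refine ⟨q, hq, hr, H, hH, max R R', fun l hl => ?_⟩
  rw [hR l ((le_max_right _ _).trans_lt hl), h l ((le_max_left _ _).trans_lt hl)]

theorem add (hF : ContinuesTo n κ F) (hF' : ContinuesTo n κ F') :
    ContinuesTo n κ (fun l => F l + F' l) := by
  obtain ⟨q, hq, hr, H, hH, R, hR⟩ := hF
  obtain ⟨q', hq', hr', H', hH', R', hR'⟩ := hF'
  refine ⟨q * q', by simp [hq, hq'], ?_, fun l => H l * q'.eval l + H' l * q.eval l, ?_,
    max R R', fun l hl => ?_⟩
  · intro x hx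
    rw [eval_mul, mul_eq_zero] at hx
    exact hx.elim (hr x) (hr' x)
  · exact (hH.mul q'.differentiable.differentiableOn).add
      (hH'.mul q.differentiable.differentiableOn)
  · simp only [hR l ((le_max_left _ _).trans_lt hl), hR' l ((le_max_right _ _).trans_lt hl),
      eval_mul]
    ring

theorem mul_differentiable (hF : ContinuesTo n κ F) {c : ℂ → ℂ} (hc : Differentiable ℂ c) :
    ContinuesTo n κ (fun l => c l * F l) := by
  obtain ⟨q, hq, hr, H, hH, R, hR⟩ := hF
  refine ⟨q, hq, hr, fun l => c l * H l, hc.differentiableOn.mul hH, R, fun l hl => ?_⟩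
  simp only [hR l hl]
  ring

theorem mono (hF : ContinuesTo n κ F) {κ' : ℕ} (h : κ ≤ κ') : ContinuesTo n κ' F := by
  obtain ⟨q, hq, hr, H, hH, R, hR⟩ := hF
  refine ⟨q, hq, hr, fun l => l ^ (κ' - κ) * H l,
    (differentiable_id.pow _).differentiableOn.mul hH, R, fun l hl => ?_⟩
  simp only [hR l hl]
  rw [← mul_assoc, ← mul_assoc, ← pow_add, Nat.sub_add_cancel h]

theorem zero : ContinuesTo n κ (fun _ => 0) :=
  ⟨1, by simp, by simp, fun _ => 0, differentiableOn_const _, 0, by simp⟩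

theorem of_differentiableOn (h : DifferentiableOn ℂ F {l | -(n : ℝ) < l.re}) :
    ContinuesTo n 0 F :=
  ⟨1, by simp, by simp, F, h, 0, by simp⟩

/-- The new root `-e / c` is rational and nonzero, so the divisor is absorbed in `q` and nothing is
lost at `0`. -/
theorem of_linear_mul (hF : ContinuesTo n κ F) {c : ℕ} (hc : c ≠ 0) {e : ℤ} (he : e ≠ 0)
    {R : ℝ} (h : ∀ l : ℂ, R < l.re → (c * l + e) * F' l = F l) : ContinuesTo n κ F' := by
  obtain ⟨q, hq, hr, H, hH, R', hR⟩ := hF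
  refine ⟨q * (C (c : ℂ) * X + C (e : ℂ)), by simp [hq, he], fun x hx => ?_, H, hH, max R R',
    fun l hl => ?_⟩
  · rw [eval_mul, mul_eq_zero] at hx
    refine hx.elim (hr x) fun hx => ⟨-e / c, ?_⟩
    have hc' : (c : ℂ) ≠ 0 := by exact_mod_cast hc
    simp only [eval_add, eval_mul, eval_C, eval_X] at hx
    push_cast
    rw [eq_div_iff hc']
    linear_combination hx
  · rw [hR l ((le_max_right _ _).trans_lt hl), ← h l ((le_max_left _ _).trans_lt hl)]
    simp only [eval_add, eval_mul, eval_C, eval_X]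
    ring

/-- A divisor proportional to `l` is the only kind that costs an order at `0`. -/
theorem of_natCast_mul (hF : ContinuesTo n κ F) {c : ℕ} (hc : c ≠ 0)
    {R : ℝ} (h : ∀ l : ℂ, R < l.re → (c * l) * F' l = F l) : ContinuesTo n (κ + 1) F' := by
  obtain ⟨q, hq, hr, H, hH, R', hR⟩ := hF
  refine ⟨q, hq, hr, fun l => (c : ℂ)⁻¹ * H l, hH.const_mul _, max R R', fun l hl => ?_⟩
  have hc' : (c : ℂ) ≠ 0 := by exact_mod_cast hc
  simp only [hR l ((le_max_right _ _).trans_lt hl), ← h l ((le_max_left _ _).trans_lt hl)]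
  field_simp
  ring

end ContinuesTo

namespace HasRationalContinuation

variable {κ : ℕ} {F F' : ℂ → ℂ}

theorem congr (hF : HasRationalContinuation κ F) {R : ℝ} (h : ∀ l : ℂ, R < l.re → F' l = F l) :
    HasRationalContinuation κ F' := by
  refine ⟨?_, fun n => (hF.2 n).congr h⟩
  obtain ⟨R', hR'⟩ := hF.1
  refine ⟨max R R', ?_⟩
  refine (hR'.mono (halfPlane_subset (le_max_right _ _))).congr fun l hl => ?_
  rw [mem_ofPred_eq] at hl
  exact h l ((le_max_left _ _).trans_lt hl)

theorem add (hF : HasRationalContinuation κ F) (hF' : HasRationalContinuation κ F') :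
    HasRationalContinuation κ (fun l => F l + F' l) := by
  refine ⟨?_, fun n => (hF.2 n).add (hF'.2 n)⟩
  obtain ⟨R, hR⟩ := hF.1
  obtain ⟨R', hR'⟩ := hF'.1
  exact ⟨max R R', (hR.mono (halfPlane_subset (le_max_left _ _))).fun_add
    (hR'.mono (halfPlane_subset (le_max_right _ _)))⟩

theorem const_mul (hF : HasRationalContinuation κ F) (c : ℂ) :
    HasRationalContinuation κ (fun l => c * F l) := by
  refine ⟨?_, fun n => (hF.2 n).mul_differentiable (differentiable_const c)⟩
  obtain ⟨R, hR⟩ := hF.1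
  exact ⟨R, hR.const_mul c⟩

theorem mono (hF : HasRationalContinuation κ F) {κ' : ℕ} (h : κ ≤ κ') :
    HasRationalContinuation κ' F :=
  ⟨hF.1, fun n => (hF.2 n).mono h⟩

theorem zero : HasRationalContinuation κ (fun _ => 0) :=
  ⟨⟨0, differentiableOn_const _⟩, fun _ => ContinuesTo.zero⟩

theorem sum {ι : Type*} (s : Finset ι) {F : ι → ℂ → ℂ}
    (h : ∀ i ∈ s, HasRationalContinuation κ (F i)) :
    HasRationalContinuation κ (fun l => ∑ i ∈ s, F i l) := by
  classical
  induction s using Finset.induction_on with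
  | empty => simpa using zero
  | insert i s hi ih =>
    simp only [Finset.sum_insert hi]
    exact (h i (Finset.mem_insert_self i s)).add
      (ih fun j hj => h j (Finset.mem_insert_of_mem hj))

end HasRationalContinuation

theorem isOpen_re_gt (R : ℝ) : IsOpen {l : ℂ | R < l.re} :=
  isOpen_lt continuous_const Complex.continuous_re

/-- Two holomorphic functions on a half-plane that agree far to the right are equal. -/
theorem eq_of_differentiableOn_halfPlane {f g : ℂ → ℂ} {A R : ℝ}
    (hf : DifferentiableOn ℂ f {l | A < l.re}) (hg : DifferentiableOn ℂ g {l | A < l.re})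
    (h : ∀ l : ℂ, R < l.re → f l = g l) {l : ℂ} (hl : A < l.re) : f l = g l := by
  have ho := isOpen_re_gt A
  have hc : IsPreconnected {l : ℂ | A < l.re} :=
    (convex_halfSpace_re_gt A).isPreconnected
  have hz : (((max A R + 1 : ℝ)) : ℂ) ∈ {l : ℂ | A < l.re} := by
    simp only [mem_ofPred_eq, Complex.ofReal_re]
    linarith [le_max_left A R]
  refine (hf.analyticOnNhd ho).eqOn_of_preconnected_of_eventuallyEq (hg.analyticOnNhd ho) hc hz
    ?_ hl
  filter_upwards [(isOpen_re_gt R).mem_nhds (x := ((max A R + 1 : ℝ) : ℂ)) (by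
    simp only [mem_ofPred_eq, Complex.ofReal_re]
    linarith [le_max_right A R])] with x hx using h x hx

theorem meromorphicOrderAt_div_pow_mul {H : ℂ → ℂ} {p : ℂ[X]} {κ : ℕ} {x : ℂ}
    (hH : AnalyticAt ℂ H x) (hp : p.eval x ≠ 0) :
    (((-(κ : ℤ) : ℤ)) : WithTop ℤ) ≤
      meromorphicOrderAt (fun l => H l / ((l - x) ^ κ * p.eval l)) x := by
  have hpa : AnalyticAt ℂ (fun l => p.eval l) x := p.differentiable.analyticAt x
  have h1 : (fun l => H l / ((l - x) ^ κ * p.eval l)) =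
      (fun l => (l - x) ^ (-(κ : ℤ))) * fun l => H l / p.eval l := by
    funext l
    simp only [Pi.mul_apply, zpow_neg, zpow_natCast]
    rw [div_eq_mul_inv, mul_inv, div_eq_mul_inv]
    ring
  have h2 : AnalyticAt ℂ (fun l => H l / p.eval l) x := hH.div hpa hp
  have h3 : MeromorphicAt (fun l : ℂ => (l - x) ^ (-(κ : ℤ))) x := by fun_prop
  rw [h1, meromorphicOrderAt_mul h3 h2.meromorphicAt, fun_meromorphicOrderAt_zpow_id_sub_const]
  exact le_add_of_nonneg_right h2.meromorphicOrderAt_nonneg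

/-- The continuations to `re l > -n` for different `n` come with different denominators `q n`. By
the identity theorem the quotients agree, because after cross-multiplication both sides are
holomorphic and agree far to the right; so they glue. -/
theorem HasRationalContinuation.exists_meromorphicOn {κ : ℕ} {F : ℂ → ℂ}
    (hF : HasRationalContinuation κ F) {R : ℝ} (hR : 0 ≤ R)
    (hd : DifferentiableOn ℂ F {l | R < l.re}) :
    ∃ G : ℂ → ℂ, MeromorphicOn G univ ∧ (∀ l : ℂ, R < l.re → G l = F l) ∧
      (∀ l : ℂ, meromorphicOrderAt G l < 0 → ∃ q : ℚ, l = (q : ℂ)) ∧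
      ((-(κ : ℤ) : ℤ) : WithTop ℤ) ≤ meromorphicOrderAt G 0 := by
  choose q hq hr H hH R' hR' using hF.2
  have hHF : ∀ n l, R < l.re → H n l = l ^ κ * (q n).eval l * F l := by
    intro n l hl
    have hsub : {l : ℂ | R < l.re} ⊆ {l | -(n : ℝ) < l.re} :=
      halfPlane_subset ((neg_nonpos.2 n.cast_nonneg).trans hR)
    exact eq_of_differentiableOn_halfPlane ((hH n).mono hsub)
      ((((differentiable_id.pow κ).mul (q n).differentiable).differentiableOn).mul hd)
      (hR' n) hl
  have hHH : ∀ (m n : ℕ) (l : ℂ), -(m : ℝ) < l.re → m ≤ n →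
      H n l * (q m).eval l = H m l * (q n).eval l := by
    intro m n l hl hmn
    have hsub : {l : ℂ | -(m : ℝ) < l.re} ⊆ {l | -(n : ℝ) < l.re} :=
      halfPlane_subset (neg_le_neg (by exact_mod_cast hmn))
    refine eq_of_differentiableOn_halfPlane (R := R)
      (((hH n).mono hsub).mul (q m).differentiable.differentiableOn)
      ((hH m).mul (q n).differentiable.differentiableOn) (fun l hl => ?_) hl
    simp only [Pi.mul_apply, hHF n l hl, hHF m l hl]
    ring
  let N : ℂ → ℕ := fun l => ⌈|l.re|⌉₊ + 1
  -- The case distinction makes `G = F` hold exactly for `R < re l`: the quotient would take the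
  -- default value `0` at roots of `q (N l)` lying there.
  let G : ℂ → ℂ := fun l =>
    if R < l.re then F l else H (N l) l / (l ^ κ * (q (N l)).eval l)
  have hN : ∀ l, -(N l : ℝ) < l.re := by
    intro l
    have h1 := Nat.le_ceil |l.re|
    have h2 := neg_abs_le l.re
    simp only [N]
    push_cast
    linarith
  have key : ∀ l₀, ∃ n : ℕ, AnalyticAt ℂ (H n) l₀ ∧
      G =ᶠ[𝓝[≠] l₀] fun l => H n l / (l ^ κ * (q n).eval l) := by
    intro l₀
    -- Large enough to dominate `N l` for all `l` with `|re l| < |re l₀| + 1`. Near `l₀` only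
    -- finitely many `q m` then matter, and their roots are avoided on a punctured neighbourhood.
    let n := N l₀ + 2
    refine ⟨n, (hH n).analyticAt ((isOpen_re_gt _).mem_nhds ?_), ?_⟩
    · have := hN l₀
      simp only [mem_ofPred_eq, n]
      push_cast
      linarith
    have hroots : ∀ᶠ l in 𝓝[≠] l₀, l ≠ 0 ∧ ∀ m ∈ Finset.range (n + 1), (q m).eval l ≠ 0 := by
      have hfin : ∀ p : ℂ[X], p ≠ 0 → ∀ᶠ l in 𝓝[≠] l₀, p.eval l ≠ 0 := by
        intro p hp
        have : ({l | p.eval l = 0} \ {l₀} : Set ℂ).Finite := by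
          refine Set.Finite.subset (p.roots.toFinset.finite_toSet) fun l hl => ?_
          simpa [hp] using hl.1
        have h' := this.isClosed.isOpen_compl.mem_nhds (x := l₀) (by simp)
        filter_upwards [mem_nhdsWithin_of_mem_nhds h', self_mem_nhdsWithin] with l hl hl' h0
        exact hl ⟨h0, hl'⟩
      have hX := hfin X X_ne_zero
      have hall : ∀ᶠ l in 𝓝[≠] l₀, ∀ m ∈ Finset.range (n + 1), (q m).eval l ≠ 0 := by
        rw [Filter.eventually_all_finset]
        intro m _
        refine hfin _ fun h0 => hq m ?_
        simp [h0]
      filter_upwards [hX, hall] with l h1 h2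
      exact ⟨by simpa using h1, h2⟩
    have hnear : ∀ᶠ l in 𝓝[≠] l₀, |l.re| < |l₀.re| + 1 := by
      refine mem_nhdsWithin_of_mem_nhds (IsOpen.mem_nhds (s := {l : ℂ | |l.re| < |l₀.re| + 1}) ?_ ?_)
      · exact isOpen_lt (continuous_abs.comp Complex.continuous_re) continuous_const
      · simp
    filter_upwards [hroots, hnear] with l ⟨h0, hq'⟩ hl
    have hqn : (q n).eval l ≠ 0 := hq' n (by simp)
    simp only [G]
    split_ifs with h
    · rw [hHF n l h]
      field_simp
    · have hle : N l ≤ n := by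
        have : ⌈|l.re|⌉₊ ≤ ⌈|l₀.re|⌉₊ + 1 := by
          rw [Nat.ceil_le]
          push_cast
          linarith [Nat.le_ceil |l₀.re|]
        simp only [n, N]
        omega
      have hqN : (q (N l)).eval l ≠ 0 := hq' (N l) (by simpa [Nat.lt_succ_iff] using hle)
      have := hHH (N l) n l (hN l) hle
      rw [div_eq_div_iff (by positivity) (by positivity)]
      linear_combination (-(l ^ κ)) * this
  refine ⟨G, fun l₀ _ => ?_, fun l hl => by simp [G, hl], fun l₀ hl₀ => ?_, ?_⟩
  · obtain ⟨n, hn, hG⟩ := key l₀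
    refine MeromorphicAt.congr ?_ hG.symm
    have hpa : AnalyticAt ℂ (fun l => (q n).eval l) l₀ := (q n).differentiable.analyticAt l₀
    exact hn.meromorphicAt.div (((MeromorphicAt.id l₀).pow κ).mul hpa.meromorphicAt)
  · obtain ⟨n, hn, hG⟩ := key l₀
    rw [meromorphicOrderAt_congr hG] at hl₀
    by_contra hrat
    have hpa : AnalyticAt ℂ (fun l => (q n).eval l) l₀ := (q n).differentiable.analyticAt l₀
    have h0 : l₀ ≠ 0 := fun h => hrat ⟨0, by simpa using h⟩
    have : AnalyticAt ℂ (fun l => H n l / (l ^ κ * (q n).eval l)) l₀ :=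
      hn.div ((analyticAt_id.pow κ).mul hpa)
        (mul_ne_zero (pow_ne_zero _ h0) fun h => hrat (hr n l₀ h))
    exact absurd hl₀ (not_lt.2 this.meromorphicOrderAt_nonneg)
  · obtain ⟨n, hn, hG⟩ := key 0
    rw [meromorphicOrderAt_congr hG]
    simpa using meromorphicOrderAt_div_pow_mul (κ := κ) hn (hq n)

end Continuation

/-! ### Integrals of monomials: convergence and holomorphy -/

section MonomialIntegral

open ComplexConjugate

/-- The function `|ζ|^{2c} ζ^a ζ̄^b` of one complex variable. -/
noncomputable def absPowMul (c : ℂ) (a b : ℤ) (ζ : ℂ) : ℂ :=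
  (‖ζ‖ : ℂ) ^ (2 * c) * ζ ^ a * conj ζ ^ b

theorem norm_absPowMul_of_ne_zero (c : ℂ) (a b : ℤ) {ζ : ℂ} (hζ : ζ ≠ 0) :
    ‖absPowMul c a b ζ‖ = ‖ζ‖ ^ (2 * c.re + a + b) := by
  have h : 0 < ‖ζ‖ := norm_pos_iff.2 hζ
  rw [absPowMul, norm_mul, norm_mul, norm_zpow, norm_zpow, RCLike.norm_conj,
    Complex.norm_cpow_eq_rpow_re_of_pos h, Real.rpow_add h, Real.rpow_add h, Real.rpow_intCast,
    Real.rpow_intCast]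
  simp

theorem absPowMul_zero {c : ℂ} (hc : c ≠ 0) (a b : ℤ) : absPowMul c a b 0 = 0 := by
  simp [absPowMul, Complex.zero_cpow, hc]

/-- The base `1 + ‖ζ‖ ≥ 1` makes the bound increasing in the exponent, which later gives a majorant
uniform in `l`. -/
theorem norm_absPowMul_le {c : ℂ} {a b : ℤ} (hp : 0 ≤ 2 * c.re + a + b) (ζ : ℂ) :
    ‖absPowMul c a b ζ‖ ≤ (1 + ‖ζ‖) ^ (2 * c.re + a + b) := by
  by_cases h : ζ = 0
  · have h1 : ‖((‖ζ‖ : ℂ) ^ (2 * c))‖ ≤ 1 := by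
      by_cases hc : c = 0 <;> simp [h, hc, Complex.zero_cpow]
    have h2 : ∀ n : ℤ, ‖(0 : ℂ) ^ n‖ ≤ 1 := fun n => by
      by_cases hn : n = 0 <;> simp [hn, zero_zpow]
    rw [absPowMul, norm_mul, norm_mul]
    subst h
    simp only [map_zero, norm_zero, add_zero, Real.one_rpow]
    have := mul_le_one₀ (mul_le_one₀ (by simpa using h1) (norm_nonneg _) (h2 a))
      (norm_nonneg _) (h2 b)
    simpa using this
  · rw [norm_absPowMul_of_ne_zero c a b h]
    exact Real.rpow_le_rpow (norm_nonneg _) (by linarith) hp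

theorem measurable_absPowMul (c : ℂ) (a b : ℤ) : Measurable (absPowMul c a b) := by
  unfold absPowMul
  have h1 : Measurable fun ζ : ℂ => ζ ^ a := by
    fun_prop
  have h2 : Measurable fun ζ : ℂ => ζ ^ b := by
    fun_prop
  have h3 : Measurable fun ζ : ℂ => (‖ζ‖ : ℂ) ^ (2 * c) :=
    (Complex.measurable_ofReal.comp measurable_norm).pow_const _
  exact (h3.mul h1).mul (h2.comp Complex.continuous_conj.measurable)

/-- Away from `0` this is the product rule. At `ζ = 0` the function is `O(|t|^p)` with `p > 1` along
the line, so the derivative is `0`, and both terms on the right vanish because `c ≠ 0`. -/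
theorem hasDerivAt_absPowMul {c : ℂ} {a b : ℤ} (hc : c ≠ 0) (hp : 1 < 2 * c.re + a + b)
    (ζ w : ℂ) :
    HasDerivAt (fun t : ℝ => absPowMul c a b (ζ + t * w))
      ((c + a) * w * absPowMul c (a - 1) b ζ + (c + b) * conj w * absPowMul c a (b - 1) ζ) 0 := by
  have hl : HasDerivAt (fun t : ℝ => ζ + t * w) w 0 := by
    simpa using ((Complex.ofRealCLM.hasDerivAt (x := (0 : ℝ))).mul_const w).const_add ζ
  by_cases hζ : ζ = 0
  · subst hζ
    rw [absPowMul_zero hc, absPowMul_zero hc, mul_zero, mul_zero, add_zero]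
    rw [hasDerivAt_iff_isLittleO]
    simp only [zero_add, Complex.ofReal_zero, zero_mul, absPowMul_zero hc, sub_zero, smul_zero]
    have hO : (fun t : ℝ => absPowMul c a b (t * w)) =O[𝓝 0]
        fun t : ℝ => (‖(t : ℂ) * w‖) ^ (2 * c.re + a + b) := by
      refine Asymptotics.IsBigO.of_bound 1 (Eventually.of_forall fun t => ?_)
      by_cases h0 : (t : ℂ) * w = 0
      · simp [h0, absPowMul_zero hc, Real.zero_rpow (by linarith : 2 * c.re + a + b ≠ 0)]
      · rw [norm_absPowMul_of_ne_zero c a b h0, one_mul]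
        exact le_abs_self _
    refine hO.trans_isLittleO ?_
    rw [Asymptotics.isLittleO_iff]
    intro ε hε
    set p := 2 * c.re + a + b - 1 with hpdef
    have hp0 : 0 < p := by linarith
    have hlim : Tendsto (fun t : ℝ => ‖w‖ ^ (p + 1) * |t| ^ p) (𝓝 0) (𝓝 0) := by
      have h1 : ContinuousAt (fun t : ℝ => ‖w‖ ^ (p + 1) * |t| ^ p) 0 := by
        refine continuousAt_const.mul (ContinuousAt.rpow_const continuous_abs.continuousAt (Or.inr hp0.le))
      have := h1.tendsto
      simpa [Real.zero_rpow hp0.ne'] using this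
    filter_upwards [hlim.eventually (gt_mem_nhds hε)] with t ht
    have h1 : 2 * c.re + a + b = p + 1 := by simp [hpdef]
    rw [h1, norm_mul, Complex.norm_real, Real.norm_eq_abs, Real.norm_eq_abs,
      Real.mul_rpow (abs_nonneg _) (norm_nonneg _), Real.rpow_add_one' (abs_nonneg _) (by linarith),
      abs_of_nonneg (by positivity)]
    calc |t| ^ p * |t| * ‖w‖ ^ (p + 1) = (‖w‖ ^ (p + 1) * |t| ^ p) * |t| := by ring
      _ ≤ ε * |t| := by gcongr
  · have hN : HasDerivAt (fun t : ℝ => (ζ + t * w) * conj (ζ + t * w))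
        (w * conj ζ + ζ * conj w) 0 := by
      have h2 : HasDerivAt (fun t : ℝ => conj (ζ + t * w)) (conj w) 0 := by
        exact (Complex.conjCLE.toContinuousLinearMap.hasFDerivAt.comp_hasDerivAt (0 : ℝ) hl)
      simpa using hl.fun_mul h2
    -- Written as a power of `x x̄`, which is a positive real for `x ≠ 0` and so lies in the slit
    -- plane, the modulus factor can be differentiated by the complex power rule.
    have hform : ∀ x : ℂ, (‖x‖ : ℂ) ^ (2 * c) = (x * conj x) ^ c := by
      intro x
      rw [Complex.mul_conj, Complex.normSq_eq_norm_sq]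
      by_cases hx : x = 0
      · simp [hx, hc]
      · have : 0 < ‖x‖ := norm_pos_iff.2 hx
        rw [Complex.ofReal_pow, sq, Complex.mul_cpow_ofReal_nonneg this.le this.le,
          ← Complex.cpow_add _ _ (by simpa using hx), two_mul]
    have hslit : (ζ + ((0 : ℝ) : ℂ) * w) * conj (ζ + ((0 : ℝ) : ℂ) * w) ∈ Complex.slitPlane := by
      rw [Complex.mul_conj, Complex.ofReal_mem_slitPlane]
      simpa using Complex.normSq_pos.2 hζ
    have hc' : conj ζ ≠ 0 := by simpa using hζ
    have h1 := HasDerivAt.comp (0 : ℝ) ((hasDerivAt_id ((ζ + ((0 : ℝ) : ℂ) * w) *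
      conj (ζ + ((0 : ℝ) : ℂ) * w))).cpow_const (c := c) hslit) hN
    have h2 : HasDerivAt (fun t : ℝ => (ζ + t * w) ^ a) (a * ζ ^ (a - 1) * w) 0 := by
      have := (hasDerivAt_zpow a ζ (Or.inl hζ))
      exact HasDerivAt.comp (0 : ℝ) (by simpa using this) hl
    have h3 : HasDerivAt (fun t : ℝ => conj (ζ + t * w) ^ b) (b * conj ζ ^ (b - 1) * conj w) 0 := by
      have := (hasDerivAt_zpow b (conj ζ) (Or.inl hc'))
      have h4 : HasDerivAt (fun t : ℝ => conj (ζ + t * w)) (conj w) 0 := by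
        exact (Complex.conjCLE.toContinuousLinearMap.hasFDerivAt.comp_hasDerivAt (0 : ℝ) hl)
      exact HasDerivAt.comp (0 : ℝ) (by simpa using this) h4
    have h := (h1.fun_mul h2).fun_mul h3
    simp only [absPowMul, hform]
    refine h.congr_deriv ?_
    simp only [Complex.ofReal_zero, zero_mul, add_zero, Function.comp_apply, id_eq, mul_one]
    have hx : ζ * conj ζ ≠ 0 := mul_ne_zero hζ hc'
    rw [Complex.cpow_sub _ _ hx, Complex.cpow_one, zpow_sub_one₀ hζ, zpow_sub_one₀ hc']
    field_simp
    ring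

/-- Only the integrand needs a majorant: Cauchy's estimate on circles of radius `ε` bounds its
`l`-derivative by `B / ε`. A disc of radius `ε` around a point of the `ε`-ball at `l₀` stays within
`2ε < 4ε`. -/
theorem differentiableOn_integral {E : Type*} [MeasurableSpace E] {m : Measure E} {U : Set ℂ}
    (hU : IsOpen U) {G : ℂ → E → ℂ} (hm : ∀ l ∈ U, AEStronglyMeasurable (G l) m)
    (hd : ∀ z, DifferentiableOn ℂ (fun l => G l z) U)
    (hb : ∀ l₀ ∈ U, ∃ ε > 0, ∃ B : E → ℝ, Integrable B m ∧
      ∀ l ∈ U, dist l l₀ < ε → ∀ z, ‖G l z‖ ≤ B z) :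
    DifferentiableOn ℂ (fun l => ∫ z, G l z ∂m) U := by
  intro l₀ hl₀
  obtain ⟨ε₁, hε₁, B, hB, hGB⟩ := hb l₀ hl₀
  obtain ⟨ε₂, hε₂, hball⟩ := Metric.isOpen_iff.1 hU l₀ hl₀
  set ε := min ε₁ ε₂ / 4 with hε
  have hε0 : 0 < ε := by positivity
  have h1 : 4 * ε ≤ ε₁ := by rw [hε]; linarith [min_le_left ε₁ ε₂]
  have h2 : 4 * ε ≤ ε₂ := by rw [hε]; linarith [min_le_right ε₁ ε₂]
  have hin : ∀ l, dist l l₀ < 4 * ε → l ∈ U := fun l hl => hball (by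
    rw [Metric.mem_ball]; linarith)
  have hderiv : ∀ z, ∀ l ∈ U, HasDerivAt (fun l => G l z) (deriv (fun l => G l z) l) l :=
    fun z l hl => ((hd z).differentiableAt (hU.mem_nhds hl)).hasDerivAt
  refine (hasDerivAt_integral_of_dominated_loc_of_deriv_le (F := G)
    (F' := fun l z => deriv (fun l => G l z) l) (bound := fun z => B z / ε)
    (Metric.ball_mem_nhds l₀ hε0) ?_ ?_ ?_ ?_ (hB.div_const ε)
    ?_).2.differentiableAt.differentiableWithinAt
  · filter_upwards [hU.mem_nhds hl₀] with l hl using hm l hl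
  · exact hB.mono' (hm l₀ hl₀) (Eventually.of_forall fun z => hGB l₀ hl₀ (by simpa using hε₁) z)
  -- The derivative is measurable in `z` as the limit of difference quotients along the sequence `l₀
  -- + ε/(n+1)`.
  · have hseq : Tendsto (fun n : ℕ => l₀ + (ε / (n + 1 : ℝ) : ℝ)) atTop (𝓝[≠] l₀) := by
      rw [tendsto_nhdsWithin_iff]
      refine ⟨?_, Eventually.of_forall fun n => ?_⟩
      · have h3 : Tendsto (fun n : ℕ => (ε / (n + 1 : ℝ) : ℝ)) atTop (𝓝 0) := by
          have := (tendsto_one_div_add_atTop_nhds_zero_nat (𝕜 := ℝ)).const_mul ε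
          simpa [div_eq_mul_inv] using this
        have := (Complex.continuous_ofReal.tendsto 0).comp h3
        simpa using this.const_add l₀
      · have : (ε / (n + 1 : ℝ)) ≠ 0 := by positivity
        have h4 : ((ε / (n + 1 : ℝ) : ℝ) : ℂ) ≠ 0 := by exact_mod_cast this
        simpa using h4
    refine aestronglyMeasurable_of_tendsto_ae atTop
      (f := fun (n : ℕ) z => slope (fun l => G l z) l₀ (l₀ + (ε / (n + 1 : ℝ) : ℝ))) (fun n => ?_)
      (Eventually.of_forall fun z => ?_)
    · have hmem : l₀ + ((ε / (n + 1 : ℝ) : ℝ) : ℂ) ∈ U := by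
        refine hin _ ?_
        rw [dist_self_add_left, Complex.norm_real, Real.norm_eq_abs, abs_of_pos (by positivity)]
        have : ε / (n + 1 : ℝ) ≤ ε := div_le_self hε0.le (by
          have : (0 : ℝ) ≤ n := n.cast_nonneg
          linarith)
        linarith
      simp only [slope, vsub_eq_sub]
      exact ((hm _ hmem).sub (hm l₀ hl₀)).const_smul
        ((l₀ + ((ε / (n + 1 : ℝ) : ℝ) : ℂ) - l₀)⁻¹ : ℂ)
    · exact (hasDerivAt_iff_tendsto_slope.1 (hderiv z l₀ hl₀)).comp hseq
  · refine Eventually.of_forall fun z l hl => ?_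
    rw [Metric.mem_ball] at hl
    have hcl : ∀ x ∈ Metric.closedBall l ε, x ∈ U ∧ dist x l₀ < ε₁ := fun x hx => by
      have : dist x l₀ < 4 * ε := by
        linarith [dist_triangle x l l₀, Metric.mem_closedBall.1 hx]
      exact ⟨hin x this, by linarith⟩
    refine Complex.norm_deriv_le_of_forall_mem_sphere_norm_le hε0 ?_ fun x hx => ?_
    · refine DifferentiableOn.diffContOnCl ?_
      rw [closure_ball _ hε0.ne']
      exact (hd z).mono fun x hx => (hcl x hx).1
    · have := hcl x (Metric.sphere_subset_closedBall hx)
      exact hGB x this.1 this.2 z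
  · exact Eventually.of_forall fun z l hl => hderiv z l (hin l (by
      rw [Metric.mem_ball] at hl
      linarith))

/-- The function `∏ |z_j|^{2 I_j l} z_j^{a_j} z̄_j^{b_j}`. -/
noncomputable def absMonomial {d : ℕ} (I : Fin d → ℕ) (a b : Fin d → ℤ) (l : ℂ) (z : CSpace d) :
    ℂ :=
  ∏ j, absPowMul (I j * l) (a j) (b j) (z j)

/-- The integral of `|z^I|^{2l} z^a z̄^b e^{l ψ} χ` over `ℂ^d`. -/
noncomputable def monomialIntegral {d : ℕ} (I : Fin d → ℕ) (a b : Fin d → ℤ) (ψ : CSpace d → ℝ)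
    (χ : CSpace d → ℂ) (l : ℂ) : ℂ :=
  ∫ z, absMonomial I a b l z * (Complex.exp (l * ψ z) * χ z)

/-- The integrand of `monomialIntegral` is locally bounded for `re l > A`, and holomorphic
in `l`. -/
def BoundedRight {d : ℕ} (A : ℝ) (I : Fin d → ℕ) (a b : Fin d → ℤ) : Prop :=
  ∀ k, (I k = 0 → 0 ≤ a k + b k) ∧
    (I k ≠ 0 → 0 ≤ 2 * I k * A + a k + b k ∧ (0 ≤ A ∨ a k + b k ≠ 0))

section Bounds

variable {d : ℕ} {I : Fin d → ℕ} {a b : Fin d → ℤ} {A : ℝ}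

theorem BoundedRight.exponent_nonneg (h : BoundedRight A I a b) {l : ℂ} (hl : A < l.re)
    (k : Fin d) : 0 ≤ 2 * (I k * l).re + a k + b k := by
  have h1 : (I k * l : ℂ).re = I k * l.re := by simp
  rw [h1]
  by_cases hI : I k = 0
  · have := (h k).1 hI
    simp only [hI, Nat.cast_zero, zero_mul, mul_zero, zero_add]
    exact_mod_cast this
  · have h2 := ((h k).2 hI).1
    have h3 : (0 : ℝ) ≤ I k := (I k).cast_nonneg
    nlinarith [mul_le_mul_of_nonneg_left hl.le h3]

theorem measurable_absMonomial (I : Fin d → ℕ) (a b : Fin d → ℤ) (l : ℂ) :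
    Measurable (absMonomial I a b l) := by
  unfold absMonomial
  exact Finset.measurable_prod _ fun j _ =>
    (measurable_absPowMul _ _ _).comp (measurable_pi_apply j)

theorem norm_absMonomial_le (h : BoundedRight A I a b) {l : ℂ} (hl : A < l.re) {P : ℝ}
    (hP : ∀ k, 2 * (I k * l).re + a k + b k ≤ P) (z : CSpace d) :
    ‖absMonomial I a b l z‖ ≤ ((1 + ‖z‖) ^ P) ^ d := by
  rw [absMonomial, norm_prod]
  have : ∏ _j : Fin d, (1 + ‖z‖) ^ P = ((1 + ‖z‖) ^ P) ^ d := by simp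
  rw [← this]
  refine Finset.prod_le_prod (fun _ _ => norm_nonneg _) fun k _ => ?_
  have hk := h.exponent_nonneg hl k
  calc ‖absPowMul (I k * l) (a k) (b k) (z k)‖
      ≤ (1 + ‖z k‖) ^ (2 * (I k * l).re + a k + b k) := norm_absPowMul_le hk _
    _ ≤ (1 + ‖z‖) ^ (2 * (I k * l).re + a k + b k) := by
        refine Real.rpow_le_rpow (by positivity) ?_ hk
        gcongr
        exact norm_le_pi_norm z k
    _ ≤ (1 + ‖z‖) ^ P := Real.rpow_le_rpow_of_exponent_le (by linarith [norm_nonneg z]) (hP k)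

theorem differentiableOn_absMonomial (h : BoundedRight A I a b) (z : CSpace d) :
    DifferentiableOn ℂ (fun l => absMonomial I a b l z) {l | A < l.re} := by
  unfold absMonomial
  refine DifferentiableOn.fun_finsetProd fun k _ => ?_
  by_cases hI : I k = 0
  · simp only [hI, Nat.cast_zero, zero_mul]
    exact differentiableOn_const _
  by_cases hz : z k = 0
  -- At `z k = 0` the factor must be constant in `l`. It is `0`, either because `l ≠ 0` on the
  -- half-plane, or because `a k` or `b k` is nonzero and the integer power vanishes. Otherwise the
  -- convention `0 ^ 0 = 1` would create a jump at `l = 0`.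
  · refine (differentiableOn_const 0).congr fun l hl => ?_
    rw [mem_ofPred_eq] at hl
    rw [hz]
    rcases ((h k).2 hI).2 with hA | hab
    · refine absPowMul_zero (mul_ne_zero (by exact_mod_cast hI) fun h0 => ?_) _ _
      rw [h0, Complex.zero_re] at hl
      linarith
    · have : a k ≠ 0 ∨ b k ≠ 0 := by omega
      rcases this with h0 | h0 <;> simp [absPowMul, zero_zpow _ h0]
  · unfold absPowMul
    have h0 : (‖z k‖ : ℂ) ≠ 0 := by simpa using hz
    refine ((DifferentiableOn.const_cpow ?_ (Or.inl h0)).mul_const _).mul_const _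
    fun_prop

variable {ψ : CSpace d → ℝ} {χ : CSpace d → ℂ}

/-- One majorant for the whole unit disc around `l₀`; it serves both for absolute convergence and
for holomorphy in `l`. -/
theorem monomialIntegrand_bound (h : BoundedRight A I a b) (hψ : Continuous ψ) (hχ : Continuous χ)
    (hc : HasCompactSupport χ) (l₀ : ℂ) :
    ∃ B : CSpace d → ℝ, Integrable B ∧ ∀ l : ℂ, A < l.re → dist l l₀ < 1 → ∀ z,
      ‖absMonomial I a b l z * (Complex.exp (l * ψ z) * χ z)‖ ≤ B z := by
  obtain ⟨P, hP⟩ : ∃ P : ℝ, ∀ l : ℂ, dist l l₀ < 1 → ∀ k,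
      2 * (I k * l).re + a k + b k ≤ P := by
    refine ⟨∑ k, (2 * I k * (‖l₀‖ + 1) + |(a k : ℝ)| + |(b k : ℝ)|), fun l hl k => ?_⟩
    refine le_trans ?_ (Finset.single_le_sum (f := fun k =>
      2 * I k * (‖l₀‖ + 1) + |(a k : ℝ)| + |(b k : ℝ)|) (fun _ _ => by positivity)
      (Finset.mem_univ k))
    have h1 : (I k * l : ℂ).re = I k * l.re := by simp
    have h2 : l.re ≤ ‖l₀‖ + 1 := by
      have h3 := Complex.re_le_norm l
      have h4 := norm_sub_norm_le l l₀
      rw [dist_eq_norm] at hl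
      linarith
    have h3 : (0 : ℝ) ≤ I k := (I k).cast_nonneg
    rw [h1]
    nlinarith [mul_le_mul_of_nonneg_left h2 h3, le_abs_self (a k : ℝ), le_abs_self (b k : ℝ)]
  refine ⟨fun z => ((1 + ‖z‖) ^ P) ^ d * (Real.exp ((‖l₀‖ + 1) * |ψ z|) * ‖χ z‖), ?_, ?_⟩
  · refine Continuous.integrable_of_hasCompactSupport ?_ ?_
    · have h1 : Continuous fun z : CSpace d => (1 + ‖z‖) ^ P :=
        (continuous_const.add continuous_norm).rpow_const fun z =>
          Or.inl (by positivity : (0 : ℝ) < 1 + ‖z‖).ne'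
      fun_prop
    · exact (hc.norm.mul_left).mul_left
  · intro l hl hd z
    rw [norm_mul, norm_mul]
    have h1 := norm_absMonomial_le h hl (hP l hd) z
    have h2 : ‖Complex.exp (l * ψ z)‖ ≤ Real.exp ((‖l₀‖ + 1) * |ψ z|) := by
      rw [Complex.norm_exp, Real.exp_le_exp]
      have h4 := norm_sub_norm_le l l₀
      rw [dist_eq_norm] at hd
      calc (l * ψ z).re ≤ ‖l * ψ z‖ := Complex.re_le_norm _
        _ = ‖l‖ * |ψ z| := by simp
        _ ≤ _ := by gcongr; linarith
    exact mul_le_mul h1 (mul_le_mul_of_nonneg_right h2 (norm_nonneg _)) (by positivity)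
      (by positivity)

theorem measurable_monomialIntegrand (hψ : Continuous ψ) (hχ : Continuous χ) (l : ℂ) :
    AEStronglyMeasurable
      (fun z => absMonomial I a b l z * (Complex.exp (l * ψ z) * χ z)) volume := by
  have h1 : Continuous fun z => Complex.exp (l * ψ z) * χ z := by fun_prop
  exact ((measurable_absMonomial I a b l).mul h1.measurable).aestronglyMeasurable

theorem integrable_monomialIntegrand (h : BoundedRight A I a b) (hψ : Continuous ψ)
    (hχ : Continuous χ) (hc : HasCompactSupport χ) {l : ℂ} (hl : A < l.re) :
    Integrable (fun z => absMonomial I a b l z * (Complex.exp (l * ψ z) * χ z)) := by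
  obtain ⟨B, hB, hle⟩ := monomialIntegrand_bound h hψ hχ hc l
  exact hB.mono' (measurable_monomialIntegrand hψ hχ l)
    (Eventually.of_forall fun z => hle l hl (by simp) z)

theorem differentiableOn_monomialIntegral (h : BoundedRight A I a b) (hψ : Continuous ψ)
    (hχ : Continuous χ) (hc : HasCompactSupport χ) :
    DifferentiableOn ℂ (monomialIntegral I a b ψ χ) {l | A < l.re} := by
  refine differentiableOn_integral (isOpen_re_gt A)
    (fun l _ => measurable_monomialIntegrand hψ hχ l) (fun z => ?_) fun l₀ _ => ?_
  · refine (differentiableOn_absMonomial h z).fun_mul (Differentiable.differentiableOn ?_)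
    fun_prop
  · obtain ⟨B, hB, hle⟩ := monomialIntegrand_bound h hψ hχ hc l₀
    exact ⟨1, one_pos, B, hB, fun l hl hd z => hle l hl hd z⟩

end Bounds

end MonomialIntegral

/-! ### Functional equations and continuation of monomial integrals -/

section MonomialContinuation

open ComplexConjugate

variable {d : ℕ} {I : Fin d → ℕ} {a b : Fin d → ℤ} {A : ℝ} {ψ : CSpace d → ℝ} {χ : CSpace d → ℂ}

theorem absMonomial_eq_mul (I : Fin d → ℕ) (a b : Fin d → ℤ) (l : ℂ) (z : CSpace d) (j : Fin d) :
    absMonomial I a b l z = absPowMul (I j * l) (a j) (b j) (z j) *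
      ∏ k ∈ Finset.univ.erase j, absPowMul (I k * l) (a k) (b k) (z k) :=
  (Finset.mul_prod_erase _ _ (Finset.mem_univ j)).symm

theorem absMonomial_sub_left (I : Fin d → ℕ) (a b : Fin d → ℤ) (l : ℂ) (z : CSpace d)
    (j : Fin d) :
    absMonomial I (a - Pi.single j 1) b l z = absPowMul (I j * l) (a j - 1) (b j) (z j) *
      ∏ k ∈ Finset.univ.erase j, absPowMul (I k * l) (a k) (b k) (z k) := by
  rw [absMonomial_eq_mul _ _ _ _ _ j]
  congr 1
  · simp
  · refine Finset.prod_congr rfl fun k hk => ?_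
    simp [Pi.single_eq_of_ne (Finset.ne_of_mem_erase hk)]

theorem absMonomial_sub_right (I : Fin d → ℕ) (a b : Fin d → ℤ) (l : ℂ) (z : CSpace d)
    (j : Fin d) :
    absMonomial I a (b - Pi.single j 1) l z = absPowMul (I j * l) (a j) (b j - 1) (z j) *
      ∏ k ∈ Finset.univ.erase j, absPowMul (I k * l) (a k) (b k) (z k) := by
  rw [absMonomial_eq_mul _ _ _ _ _ j]
  congr 1
  · simp
  · refine Finset.prod_congr rfl fun k hk => ?_
    simp [Pi.single_eq_of_ne (Finset.ne_of_mem_erase hk)]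

theorem hasLineDerivAt_absMonomial {l : ℂ} {j : Fin d} (hl : (I j * l : ℂ) ≠ 0)
    (hp : 1 < 2 * (I j * l : ℂ).re + a j + b j) (z : CSpace d) (w : ℂ) :
    HasLineDerivAt ℝ (absMonomial I a b l)
      ((I j * l + a j) * w * absMonomial I (a - Pi.single j 1) b l z +
        (I j * l + b j) * conj w * absMonomial I a (b - Pi.single j 1) l z) z
      (Pi.single j w) := by
  rw [HasLineDerivAt, absMonomial_sub_left, absMonomial_sub_right]
  have h := (hasDerivAt_absPowMul hl hp (z j) w).mul_const
    (∏ k ∈ Finset.univ.erase j, absPowMul (I k * l) (a k) (b k) (z k))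
  have hfun : (fun t : ℝ => absMonomial I a b l (z + t • (Pi.single j w : CSpace d))) = fun t : ℝ =>
      absPowMul (I j * l) (a j) (b j) (z j + t * w) *
        ∏ k ∈ Finset.univ.erase j, absPowMul (I k * l) (a k) (b k) (z k) := by
    funext t
    rw [absMonomial_eq_mul _ _ _ _ _ j]
    congr 1
    · simp
    · refine Finset.prod_congr rfl fun k hk => ?_
      simp [Pi.single_eq_of_ne (Finset.ne_of_mem_erase hk)]
  rw [hfun]
  refine h.congr_deriv ?_
  ring

/-- The operator `∂/∂x_j + ε ∂/∂y_j`. -/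
noncomputable def wirtinger (ε : ℂ) (j : Fin d) (χ : CSpace d → ℂ) (z : CSpace d) : ℂ :=
  fderiv ℝ χ z (Pi.single j 1) + ε * fderiv ℝ χ z (Pi.single j Complex.I)

theorem contDiff_wirtinger (hχ : ContDiff ℝ ∞ χ) (ε : ℂ) (j : Fin d) :
    ContDiff ℝ ∞ (wirtinger ε j χ) := by
  have h := hχ.fderiv_right (m := ∞) (by simp)
  exact (h.clm_apply contDiff_const).add (contDiff_const.mul (h.clm_apply contDiff_const))

theorem hasCompactSupport_wirtinger (hc : HasCompactSupport χ) (ε : ℂ) (j : Fin d) :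
    HasCompactSupport (wirtinger ε j χ) := by
  refine hc.mono' fun z hz => ?_
  by_contra h
  refine hz ?_
  have h0 : fderiv ℝ χ z = 0 := by
    have : z ∉ Function.support (fderiv ℝ χ) := fun h' => h (support_fderiv_subset ℝ h')
    simpa using this
  simp [wirtinger, h0]

/-- Integration by parts in the real direction `w` of the `j`-th variable. The summand with the
factor `l` comes from differentiating `e^{lψ}`. -/
theorem integral_absMonomial_mul_fderiv (h₀ : BoundedRight A I a b) {j : Fin d} (hI : I j ≠ 0)
    (hA : 0 ≤ A) (ha : BoundedRight A I (a - Pi.single j 1) b)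
    (hb : BoundedRight A I a (b - Pi.single j 1)) (hψ : ContDiff ℝ ∞ ψ) (hχ : ContDiff ℝ ∞ χ)
    (hc : HasCompactSupport χ) {l : ℂ} (hl : A < l.re) (w : ℂ) :
    ∫ z, absMonomial I a b l z *
        (Complex.exp (l * ψ z) * (fderiv ℝ χ z (Pi.single j w) +
          l * (χ z * fderiv ℝ (fun z => (ψ z : ℂ)) z (Pi.single j w)))) =
      -((I j * l + a j) * w * monomialIntegral I (a - Pi.single j 1) b ψ χ l +
        (I j * l + b j) * conj w * monomialIntegral I a (b - Pi.single j 1) ψ χ l) := by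
  have hψc : ContDiff ℝ ∞ fun z => (ψ z : ℂ) := Complex.ofRealCLM.contDiff.comp hψ
  have h1 := integrable_monomialIntegrand ha hψ.continuous hχ.continuous hc hl
  have h2 := integrable_monomialIntegrand hb hψ.continuous hχ.continuous hc hl
  have hl0 : (I j * l : ℂ) ≠ 0 := mul_ne_zero (by exact_mod_cast hI) fun h => by
    rw [h, Complex.zero_re] at hl
    linarith
  -- `ha` gives `0 ≤ 2 I_j A + a_j + b_j - 1`; the inequality becomes strict since `re l > A` and
  -- `I_j > 0`.
  have hp : 1 < 2 * (I j * l : ℂ).re + a j + b j := by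
    have h3 := ((ha j).2 hI).1
    simp only [Pi.sub_apply, Pi.single_eq_same, Int.cast_sub, Int.cast_one] at h3
    have h4 : (I j * l : ℂ).re = I j * l.re := by simp
    have h5 : (0 : ℝ) < I j := by exact_mod_cast Nat.pos_of_ne_zero hI
    rw [h4]
    nlinarith [mul_lt_mul_of_pos_left hl h5]
  let g : CSpace d → ℂ := fun z => Complex.exp (l * ψ z) * χ z
  have hg : ∀ z, HasLineDerivAt ℝ g (Complex.exp (l * ψ z) * (fderiv ℝ χ z (Pi.single j w) +
      l * (χ z * fderiv ℝ (fun z => (ψ z : ℂ)) z (Pi.single j w)))) z (Pi.single j w) := by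
    intro z
    have h6 := (hχ.differentiable (by simp) z).hasFDerivAt
    have h7 := (hψc.differentiable (by simp) z).hasFDerivAt
    have h8 := ((h7.const_mul l).cexp.mul h6).hasLineDerivAt (Pi.single j w)
    convert! h8 using 1
    simp only [add_apply, smul_apply, smul_eq_mul]
    ring
  let F := ∫ z, absMonomial I a b l z *
        (Complex.exp (l * ψ z) * (fderiv ℝ χ z (Pi.single j w) +
          l * (χ z * fderiv ℝ (fun z => (ψ z : ℂ)) z (Pi.single j w))))
  have hχ1 : ContDiff ℝ ∞ fun z => fderiv ℝ χ z (Pi.single j w) +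
      l * (χ z * fderiv ℝ (fun z => (ψ z : ℂ)) z (Pi.single j w)) :=
    ((hχ.fderiv_right (m := ∞) (by simp)).clm_apply contDiff_const).add
      (contDiff_const.mul (hχ.mul
        ((hψc.fderiv_right (m := ∞) (by simp)).clm_apply contDiff_const)))
  have hc1 : HasCompactSupport fun z => fderiv ℝ χ z (Pi.single j w) +
      l * (χ z * fderiv ℝ (fun z => (ψ z : ℂ)) z (Pi.single j w)) :=
    (hc.fderiv_apply (𝕜 := ℝ) _).add ((hc.mul_right).mul_left)
  have hM' : Integrable fun z => ((I j * l + a j) * w * absMonomial I (a - Pi.single j 1) b l z +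
        (I j * l + b j) * conj w * absMonomial I a (b - Pi.single j 1) l z) * g z := by
    refine ((h1.const_mul ((I j * l + a j) * w)).add
      (h2.const_mul ((I j * l + b j) * conj w))).congr (Eventually.of_forall fun z => ?_)
    simp only [Pi.add_apply, g]
    ring
  have key := integral_bilinear_hasLineDerivAt_right_eq_neg_left_of_integrable
    (μ := volume) (B := ContinuousLinearMap.mul ℝ ℂ) (f := absMonomial I a b l) (g := g)
    (v := Pi.single j w) hM'
    (integrable_monomialIntegrand h₀ hψ.continuous hχ1.continuous hc1 hl)
    (integrable_monomialIntegrand h₀ hψ.continuous hχ.continuous hc hl)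
    (fun z _ => hasLineDerivAt_absMonomial hl0 hp z w) (fun z _ => hg z)
  simp only [ContinuousLinearMap.mul_apply'] at key
  rw [key, monomialIntegral, monomialIntegral, ← integral_const_mul, ← integral_const_mul,
    ← integral_add (h1.const_mul _) (h2.const_mul _)]
  congr 2
  funext z
  simp only [g]
  ring

/-- The directions `1` and `i` are combined with weights `1` and `ε`. For `ε = -i` the coefficient
`1 - ε i` vanishes and only `a` is lowered; for `ε = i` only `b` is. -/
theorem monomialIntegral_wirtinger (h₀ : BoundedRight A I a b) {j : Fin d} (hI : I j ≠ 0)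
    (hA : 0 ≤ A) (ha : BoundedRight A I (a - Pi.single j 1) b)
    (hb : BoundedRight A I a (b - Pi.single j 1)) (hψ : ContDiff ℝ ∞ ψ) (hχ : ContDiff ℝ ∞ χ)
    (hc : HasCompactSupport χ) {l : ℂ} (hl : A < l.re) (ε : ℂ) :
    monomialIntegral I a b ψ (wirtinger ε j χ) l +
        l * monomialIntegral I a b ψ (fun z => χ z * wirtinger ε j (fun z => (ψ z : ℂ)) z) l =
      -((1 + ε * Complex.I) * (I j * l + a j) * monomialIntegral I (a - Pi.single j 1) b ψ χ l +
        (1 - ε * Complex.I) * (I j * l + b j) *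
          monomialIntegral I a (b - Pi.single j 1) ψ χ l) := by
  have hψc : ContDiff ℝ ∞ fun z => (ψ z : ℂ) := Complex.ofRealCLM.contDiff.comp hψ
  have e1 := integral_absMonomial_mul_fderiv h₀ hI hA ha hb hψ hχ hc hl 1
  have e2 := integral_absMonomial_mul_fderiv h₀ hI hA ha hb hψ hχ hc hl Complex.I
  have hint : ∀ w : ℂ, Integrable fun z => absMonomial I a b l z *
        (Complex.exp (l * ψ z) * (fderiv ℝ χ z (Pi.single j w) +
          l * (χ z * fderiv ℝ (fun z => (ψ z : ℂ)) z (Pi.single j w)))) := fun w => by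
    refine integrable_monomialIntegrand h₀ hψ.continuous (ContDiff.continuous (n := ∞) (𝕜 := ℝ) ?_)
      ?_ hl
    · exact ((hχ.fderiv_right (m := ∞) (by simp)).clm_apply contDiff_const).add
        (contDiff_const.mul (hχ.mul
          ((hψc.fderiv_right (m := ∞) (by simp)).clm_apply contDiff_const)))
    · exact (hc.fderiv_apply (𝕜 := ℝ) _).add ((hc.mul_right).mul_left)
  have hi1 := integrable_monomialIntegrand h₀ hψ.continuous (contDiff_wirtinger hχ ε j).continuous
    (hasCompactSupport_wirtinger hc ε j) hl
  have hi2 := integrable_monomialIntegrand h₀ hψ.continuous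
    (hχ.mul (contDiff_wirtinger hψc ε j)).continuous hc.mul_right hl
  have key : monomialIntegral I a b ψ (wirtinger ε j χ) l +
      l * monomialIntegral I a b ψ (fun z => χ z * wirtinger ε j (fun z => (ψ z : ℂ)) z) l =
      (∫ z, absMonomial I a b l z *
        (Complex.exp (l * ψ z) * (fderiv ℝ χ z (Pi.single j 1) +
          l * (χ z * fderiv ℝ (fun z => (ψ z : ℂ)) z (Pi.single j 1))))) +
      ε * ∫ z, absMonomial I a b l z *
        (Complex.exp (l * ψ z) * (fderiv ℝ χ z (Pi.single j Complex.I) +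
          l * (χ z * fderiv ℝ (fun z => (ψ z : ℂ)) z (Pi.single j Complex.I)))) := by
    rw [monomialIntegral, monomialIntegral, ← integral_const_mul, ← integral_const_mul,
      ← integral_add hi1 (hi2.const_mul l), ← integral_add (hint 1) ((hint Complex.I).const_mul ε)]
    congr 1
    funext z
    simp only [wirtinger]
    ring
  rw [key, e1, e2]
  simp only [map_one, Complex.conj_I]
  ring

theorem exists_boundedRight (h : ∀ k, I k = 0 → 0 ≤ a k + b k) :
    ∃ R : ℝ, ∀ A, R ≤ A → BoundedRight A I a b := by
  refine ⟨∑ k, (|(a k : ℝ)| + |(b k : ℝ)|), fun A hA k => ⟨h k, fun hI => ?_⟩⟩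
  have h1 := Finset.single_le_sum (f := fun k => |(a k : ℝ)| + |(b k : ℝ)|)
    (fun _ _ => by positivity) (Finset.mem_univ k)
  have h2 : (1 : ℝ) ≤ I k := by exact_mod_cast Nat.one_le_iff_ne_zero.2 hI
  have h0 : |(a k : ℝ)| + |(b k : ℝ)| ≤ A := h1.trans hA
  have hA0 : 0 ≤ A := le_trans (by positivity) h0
  refine ⟨?_, Or.inl hA0⟩
  nlinarith [neg_abs_le (a k : ℝ), neg_abs_le (b k : ℝ)]

/-- The number of variables in which the exponents of `z` and of `z̄` are both negative. -/
def mixedCount (a b : Fin d → ℤ) : ℕ := (Finset.univ.filter fun k => a k < 0 ∧ b k < 0).card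

/-- The functional equation: `z_j^{a_j}` is, up to a linear factor in `l`, the `z_j`-derivative of
`z_j^{a_j + 1}`. It is `monomialIntegral_wirtinger` with `a` shifted by one, valid where all three
monomials involved are bounded. -/
theorem exists_raise_left (h : ∀ k, I k = 0 → 0 ≤ a k ∧ 0 ≤ b k) {j : Fin d} (hI : I j ≠ 0)
    (hψ : ContDiff ℝ ∞ ψ) (hχ : ContDiff ℝ ∞ χ) (hc : HasCompactSupport χ) :
    ∃ R : ℝ, ∀ l : ℂ, R < l.re →
      ((I j : ℂ) * l + (a j + 1 : ℤ)) * monomialIntegral I a b ψ χ l =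
        -1 / 2 * (monomialIntegral I (a + Pi.single j 1) b ψ (wirtinger (-Complex.I) j χ) l +
        l * monomialIntegral I (a + Pi.single j 1) b ψ
          (fun z => χ z * wirtinger (-Complex.I) j (fun z => (ψ z : ℂ)) z) l) := by
  have hne : ∀ k, I k = 0 → k ≠ j := fun k hk hkj => hI (hkj ▸ hk)
  obtain ⟨R₁, h₁⟩ := exists_boundedRight (I := I) (a := a) (b := b) fun k hk => by
    have := h k hk
    omega
  obtain ⟨R₂, h₂⟩ := exists_boundedRight (I := I) (a := a + Pi.single j 1) (b := b) fun k hk => by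
    have := h k hk
    simp only [Pi.add_apply, Pi.single_eq_of_ne (hne k hk)]
    omega
  obtain ⟨R₃, h₃⟩ := exists_boundedRight (I := I) (a := a + Pi.single j 1)
    (b := b - Pi.single j 1) fun k hk => by
      have := h k hk
      simp only [Pi.add_apply, Pi.sub_apply, Pi.single_eq_of_ne (hne k hk)]
      omega
  refine ⟨max 0 (max R₁ (max R₂ R₃)), fun l hl => ?_⟩
  have key := monomialIntegral_wirtinger (h₂ _ (by simp)) hI (le_max_left 0 _)
    (by rw [add_sub_cancel_right]; exact h₁ _ (by simp)) (h₃ _ (by simp)) hψ hχ hc hl (-Complex.I)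
  rw [key, add_sub_cancel_right]
  simp only [Pi.add_apply, Pi.single_eq_same]
  have hII : -Complex.I * Complex.I = 1 := by simp
  rw [hII]
  push_cast
  ring

theorem exists_raise_right (h : ∀ k, I k = 0 → 0 ≤ a k ∧ 0 ≤ b k) {j : Fin d} (hI : I j ≠ 0)
    (hψ : ContDiff ℝ ∞ ψ) (hχ : ContDiff ℝ ∞ χ) (hc : HasCompactSupport χ) :
    ∃ R : ℝ, ∀ l : ℂ, R < l.re →
      ((I j : ℂ) * l + (b j + 1 : ℤ)) * monomialIntegral I a b ψ χ l =
        -1 / 2 * (monomialIntegral I a (b + Pi.single j 1) ψ (wirtinger Complex.I j χ) l +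
        l * monomialIntegral I a (b + Pi.single j 1) ψ
          (fun z => χ z * wirtinger Complex.I j (fun z => (ψ z : ℂ)) z) l) := by
  have hne : ∀ k, I k = 0 → k ≠ j := fun k hk hkj => hI (hkj ▸ hk)
  obtain ⟨R₁, h₁⟩ := exists_boundedRight (I := I) (a := a) (b := b) fun k hk => by
    have := h k hk
    omega
  obtain ⟨R₂, h₂⟩ := exists_boundedRight (I := I) (a := a) (b := b + Pi.single j 1) fun k hk => by
    have := h k hk
    simp only [Pi.add_apply, Pi.single_eq_of_ne (hne k hk)]
    omega
  obtain ⟨R₃, h₃⟩ := exists_boundedRight (I := I) (a := a - Pi.single j 1)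
    (b := b + Pi.single j 1) fun k hk => by
      have := h k hk
      simp only [Pi.add_apply, Pi.sub_apply, Pi.single_eq_of_ne (hne k hk)]
      omega
  refine ⟨max 0 (max R₁ (max R₂ R₃)), fun l hl => ?_⟩
  have key := monomialIntegral_wirtinger (h₂ _ (by simp)) hI (le_max_left 0 _)
    (h₃ _ (by simp)) (by rw [add_sub_cancel_right]; exact h₁ _ (by simp)) hψ hχ hc hl Complex.I
  rw [key, add_sub_cancel_right]
  simp only [Pi.add_apply, Pi.single_eq_same]
  rw [Complex.I_mul_I]
  push_cast
  ring

theorem mixedCount_le_of_imp {a' b' : Fin d → ℤ} (h : ∀ k, a' k < 0 ∧ b' k < 0 → a k < 0 ∧ b k < 0) :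
    mixedCount a' b' ≤ mixedCount a b :=
  Finset.card_le_card fun k => by simpa using h k

/-- Exponents are raised one at a time until the integrand is locally bounded for `re l > -n`. The
order of the operations is chosen so that a divisor vanishing at `l = 0` occurs at most once for
each variable in which both exponents start negative. -/
theorem continuesTo_monomialIntegral (n : ℕ) (hψ : ContDiff ℝ ∞ ψ)
    (h : ∀ k, I k = 0 → 0 ≤ a k ∧ 0 ≤ b k) (hχ : ContDiff ℝ ∞ χ) (hc : HasCompactSupport χ) :
    ContinuesTo n (mixedCount a b) (monomialIntegral I a b ψ χ) := by
  -- The number of raises still needed, variable by variable. The summand `1` ensures `a k + b k ≠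
  -- 0` at the end, as `BoundedRight` demands when its bound is negative.
  let deficit : (Fin d → ℤ) → (Fin d → ℤ) → ℕ := fun a b =>
    ∑ k, if I k = 0 then 0 else (2 * n * I k + 1 - a k - b k).toNat
  induction hN : deficit a b using Nat.strong_induction_on generalizing a b χ with
  | _ N ih =>
    by_cases hall : ∀ k, I k ≠ 0 → 2 * n * I k + 1 ≤ a k + b k
    · have hB : BoundedRight (-(n : ℝ)) I a b := by
        refine fun k => ⟨fun hk => add_nonneg (h k hk).1 (h k hk).2, fun hk => ?_⟩
        have h1 := hall k hk
        have h2 : ((2 * n * I k + 1 : ℤ) : ℝ) ≤ (a k + b k : ℤ) := by exact_mod_cast h1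
        push_cast at h2
        refine ⟨by linarith, Or.inr ?_⟩
        have : (0 : ℤ) ≤ 2 * n * I k := by positivity
        omega
      exact (ContinuesTo.of_differentiableOn
        (differentiableOn_monomialIntegral hB hψ.continuous hχ.continuous hc)).mono (Nat.zero_le _)
    push Not at hall
    obtain ⟨j, hI, hj⟩ := hall
    have hψc : ContDiff ℝ ∞ fun z => (ψ z : ℂ) := Complex.ofRealCLM.contDiff.comp hψ
    have hne : ∀ k, I k = 0 → k ≠ j := fun k hk hkj => hI (hkj ▸ hk)
    -- Raise `a j` unless it is the only negative exponent of the `j`-th variable; in that case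
    -- raise `b j`.
    by_cases hcase : 0 ≤ a j ∨ b j < 0
    · have hlt : deficit (a + Pi.single j 1) b < N := by
        rw [← hN]
        refine Finset.sum_lt_sum (fun k _ => ?_) ⟨j, Finset.mem_univ j, ?_⟩
        · by_cases hk : k = j
          · subst hk
            simp only [Pi.add_apply, Pi.single_eq_same]
            split_ifs <;> omega
          · simp [Pi.single_eq_of_ne hk]
        · simp only [Pi.add_apply, Pi.single_eq_same, if_neg hI]
          omega
      have h' : ∀ k, I k = 0 → 0 ≤ (a + Pi.single j 1 : Fin d → ℤ) k ∧ 0 ≤ b k := fun k hk => by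
        simpa [Pi.single_eq_of_ne (hne k hk)] using h k hk
      have e1 := ih _ hlt h' (contDiff_wirtinger hχ (-Complex.I) j)
        (hasCompactSupport_wirtinger hc (-Complex.I) j) rfl
      have e2 := ih _ hlt h' (hχ.mul (contDiff_wirtinger hψc (-Complex.I) j))
        hc.mul_right rfl
      have e := (e1.add (e2.mul_differentiable differentiable_id)).mul_differentiable
        (differentiable_const (-1 / 2 : ℂ))
      obtain ⟨R, hR⟩ := exists_raise_left h hI hψ hχ hc
      have hle : mixedCount (a + Pi.single j 1) b ≤ mixedCount a b := by
        refine mixedCount_le_of_imp fun k hk => ?_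
        by_cases hkj : k = j
        · subst hkj
          simp only [Pi.add_apply, Pi.single_eq_same] at hk
          omega
        · simpa [Pi.single_eq_of_ne hkj] using hk
      -- Here `a j = -1`, which in this case forces `b j < 0`. The divisor `I j * l` costs one order
      -- at `0`, but afterwards `a j = 0` and `j` has left the mixed count.
      by_cases h0 : a j + 1 = 0
      · have hlt' : mixedCount (a + Pi.single j 1) b + 1 ≤ mixedCount a b := by
          refine Finset.card_lt_card ?_
          rw [Finset.ssubset_iff_of_subset]
          · refine ⟨j, ?_, ?_⟩
            · simp only [Finset.mem_filter, Finset.mem_univ, true_and]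
              omega
            · simp only [Finset.mem_filter, Finset.mem_univ, true_and, Pi.add_apply,
                Pi.single_eq_same]
              omega
          · intro k hk
            simp only [Finset.mem_filter, Finset.mem_univ, true_and] at hk ⊢
            by_cases hkj : k = j
            · subst hkj
              simp only [Pi.add_apply, Pi.single_eq_same] at hk
              omega
            · simpa [Pi.single_eq_of_ne hkj] using hk
        refine (e.of_natCast_mul hI (R := R) fun l hl => ?_).mono hlt'
        have := hR l hl
        rw [h0, Int.cast_zero, add_zero] at this
        exact this
      · exact (e.of_linear_mul hI h0 hR).mono hle
    · push Not at hcase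
      have hlt : deficit a (b + Pi.single j 1) < N := by
        rw [← hN]
        refine Finset.sum_lt_sum (fun k _ => ?_) ⟨j, Finset.mem_univ j, ?_⟩
        · by_cases hk : k = j
          · subst hk
            simp only [Pi.add_apply, Pi.single_eq_same]
            split_ifs <;> omega
          · simp [Pi.single_eq_of_ne hk]
        · simp only [Pi.add_apply, Pi.single_eq_same, if_neg hI]
          omega
      have h' : ∀ k, I k = 0 → 0 ≤ a k ∧ 0 ≤ (b + Pi.single j 1 : Fin d → ℤ) k := fun k hk => by
        simpa [Pi.single_eq_of_ne (hne k hk)] using h k hk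
      have e1 := ih _ hlt h' (contDiff_wirtinger hχ Complex.I j)
        (hasCompactSupport_wirtinger hc Complex.I j) rfl
      have e2 := ih _ hlt h' (hχ.mul (contDiff_wirtinger hψc Complex.I j))
        hc.mul_right rfl
      have e := (e1.add (e2.mul_differentiable differentiable_id)).mul_differentiable
        (differentiable_const (-1 / 2 : ℂ))
      obtain ⟨R, hR⟩ := exists_raise_right h hI hψ hχ hc
      -- Now `b j ≥ 0`, so the constant term `b j + 1` of the divisor is nonzero.
      refine (e.of_linear_mul hI (by omega) hR).mono (mixedCount_le_of_imp fun k hk => ?_)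
      by_cases hkj : k = j
      · subst hkj
        simp only [Pi.add_apply, Pi.single_eq_same] at hk
        omega
      · simpa [Pi.single_eq_of_ne hkj] using hk

theorem hasRationalContinuation_monomialIntegral (hψ : ContDiff ℝ ∞ ψ)
    (h : ∀ k, I k = 0 → 0 ≤ a k ∧ 0 ≤ b k) (hχ : ContDiff ℝ ∞ χ) (hc : HasCompactSupport χ) :
    HasRationalContinuation (mixedCount a b) (monomialIntegral I a b ψ χ) := by
  refine ⟨?_, fun n => continuesTo_monomialIntegral n hψ h hχ hc⟩
  obtain ⟨R, hR⟩ := exists_boundedRight (I := I) (a := a) (b := b) fun k hk =>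
    add_nonneg (h k hk).1 (h k hk).2
  exact ⟨R, differentiableOn_monomialIntegral (hR R le_rfl) hψ.continuous hχ.continuous hc⟩

end MonomialContinuation

/-! ### Integrals depending smoothly on parameters -/

section ParametricIntegral

/-- Differentiation under the integral sign for a family depending smoothly on parameters. -/
theorem hasFDerivAt_integral_of_contDiffOn {E G : Type*} [NormedAddCommGroup E] [NormedSpace ℂ E]
    [FiniteDimensional ℂ E] [NormedAddCommGroup G] [NormedSpace ℂ G]
    {K : ℂ × E → G} {U : Set (ℂ × E)} (hU : IsOpen U) (hK : ContDiffOn ℂ ∞ K U) {Ω : Set E}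
    (hΩ : IsOpen Ω) (hΩU : ∀ t ∈ Icc (0 : ℝ) 1, ∀ z ∈ Ω, ((t : ℂ), z) ∈ U) {z₀ : E}
    (hz₀ : z₀ ∈ Ω) :
    HasFDerivAt (fun z => ∫ t in (0 : ℝ)..1, K (t, z))
      (∫ t in (0 : ℝ)..1, (fderiv ℂ K (t, z₀)).comp (ContinuousLinearMap.inr ℂ ℂ E)) z₀ := by
  have : ProperSpace E := FiniteDimensional.proper ℂ E
  obtain ⟨ε, hε, hball⟩ := Metric.isOpen_iff.1 hΩ z₀ hz₀
  have hcb : Metric.closedBall z₀ (ε / 2) ⊆ Ω :=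
    (Metric.closedBall_subset_ball (by linarith)).trans hball
  have hmaps : ∀ z ∈ Ω, MapsTo (fun t : ℝ => ((t : ℂ), z)) (uIcc 0 1) U := by
    intro z hz t ht
    rw [uIcc_of_le zero_le_one] at ht
    exact hΩU t ht z hz
  have hc : ∀ z : E, ContinuousOn (fun t : ℝ => ((t : ℂ), z)) (uIcc 0 1) := fun z =>
    (Complex.continuous_ofReal.prodMk continuous_const).continuousOn
  have hK1 : ContinuousOn (fun p => (fderiv ℂ K p).comp (ContinuousLinearMap.inr ℂ ℂ E)) U :=
    (((hK.fderiv_of_isOpen hU (m := 0) (by simp)).continuousOn).clm_comp continuousOn_const)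
  let S : Set (ℂ × E) := ((fun t : ℝ => (t : ℂ)) '' Icc 0 1) ×ˢ Metric.closedBall z₀ (ε / 2)
  have hS : IsCompact S :=
    (isCompact_Icc.image Complex.continuous_ofReal).prod (isCompact_closedBall _ _)
  have hSU : S ⊆ U := by
    rintro ⟨t, z⟩ ⟨⟨s, hs, rfl⟩, hz⟩
    exact hΩU s hs z (hcb hz)
  obtain ⟨C, hC⟩ := hS.exists_bound_of_continuousOn (hK1.mono hSU)
  refine (intervalIntegral.hasFDerivAt_integral_of_dominated_of_fderiv_le
    (F' := fun z t => (fderiv ℂ K (t, z)).comp (ContinuousLinearMap.inr ℂ ℂ E))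
    (bound := fun _ => C) (Metric.ball_mem_nhds z₀ (half_pos hε)) ?_ ?_ ?_ ?_ ?_ ?_)
  · filter_upwards [hΩ.mem_nhds hz₀] with z hz
    exact ((hK.continuousOn.comp (hc z) (hmaps z hz)).mono
      uIoc_subset_uIcc).aestronglyMeasurable measurableSet_uIoc
  · exact (hK.continuousOn.comp (hc z₀) (hmaps z₀ hz₀)).intervalIntegrable
  · exact ((hK1.comp (hc z₀) (hmaps z₀ hz₀)).mono
      uIoc_subset_uIcc).aestronglyMeasurable measurableSet_uIoc
  · refine Eventually.of_forall fun t ht z hz => ?_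
    rw [uIoc_of_le zero_le_one] at ht
    exact hC _ ⟨⟨t, ⟨ht.1.le, ht.2⟩, rfl⟩, Metric.ball_subset_closedBall hz⟩
  · exact intervalIntegrable_const
  · refine Eventually.of_forall fun t ht z hz => ?_
    rw [uIoc_of_le zero_le_one] at ht
    have hm : ((t : ℂ), z) ∈ U :=
      hΩU t ⟨ht.1.le, ht.2⟩ z (hcb (Metric.ball_subset_closedBall hz))
    have h1 := ((hK.contDiffAt (hU.mem_nhds hm)).differentiableAt (by simp)).hasFDerivAt
    exact h1.comp z (hasFDerivAt_prodMk_right _ z)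

/-- Induction on the order of smoothness. The derivative is again a parametric integral but takes
values in a space of linear maps, so the target `G` varies inside the induction and all spaces live
in one universe. -/
theorem contDiffOn_integral {E : Type} [NormedAddCommGroup E] [NormedSpace ℂ E]
    [FiniteDimensional ℂ E] {U : Set (ℂ × E)} (hU : IsOpen U) {Ω : Set E}
    (hΩ : IsOpen Ω) (hΩU : ∀ t ∈ Icc (0 : ℝ) 1, ∀ z ∈ Ω, ((t : ℂ), z) ∈ U) (n : ℕ) :
    ∀ {G : Type} [NormedAddCommGroup G] [NormedSpace ℂ G] {K : ℂ × E → G},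
      ContDiffOn ℂ ∞ K U → ContDiffOn ℂ n (fun z => ∫ t in (0 : ℝ)..1, K (t, z)) Ω := by
  induction n with
  | zero =>
    intro G _ _ K hK
    exact contDiffOn_zero.2 fun z hz =>
      (hasFDerivAt_integral_of_contDiffOn hU hK hΩ hΩU hz).continuousAt.continuousWithinAt
  | succ n ih =>
    intro G _ _ K hK
    have hd : ∀ z ∈ Ω, HasFDerivAt (fun z => ∫ t in (0 : ℝ)..1, K (t, z))
        (∫ t in (0 : ℝ)..1, (fderiv ℂ K (t, z)).comp (ContinuousLinearMap.inr ℂ ℂ E)) z :=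
      fun z hz => hasFDerivAt_integral_of_contDiffOn hU hK hΩ hΩU hz
    push_cast
    rw [contDiffOn_succ_iff_fderiv_of_isOpen hΩ]
    refine ⟨fun z hz => (hd z hz).differentiableAt.differentiableWithinAt, by simp, ?_⟩
    have hK' : ContDiffOn ℂ ∞ (fun p => (fderiv ℂ K p).comp (ContinuousLinearMap.inr ℂ ℂ E)) U :=
      (hK.fderiv_of_isOpen hU (by simp)).clm_comp contDiffOn_const
    exact (ih hK').congr fun z hz => (hd z hz).fderiv

end ParametricIntegral

/-! ### Holomorphic functions near the origin: identity theorem and division by coordinates -/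

section HolomorphicGerms

variable {d : ℕ} {ρ : ℝ} {f g : CSpace d → ℂ}

theorem norm_update_le (z : CSpace d) (j : Fin d) {t : ℂ} (ht : ‖t‖ ≤ 1) :
    ‖Function.update z j (t * z j)‖ ≤ ‖z‖ := by
  rw [pi_norm_le_iff_of_nonneg (norm_nonneg _)]
  intro k
  by_cases hk : k = j
  · subst hk
    rw [Function.update_self, norm_mul]
    exact (mul_le_of_le_one_left (norm_nonneg _) ht).trans (norm_le_pi_norm z k)
  · rw [Function.update_of_ne hk]
    exact norm_le_pi_norm z k

theorem update_eq_add (z : CSpace d) (j : Fin d) (t : ℂ) :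
    Function.update z j (t * z j) = z + ((t - 1) * z j) • (Pi.single j 1 : CSpace d) := by
  funext k
  by_cases hk : k = j
  · subst hk
    simp
    ring
  · simp [hk]

/-- A holomorphic function that vanishes on a coordinate hyperplane is divisible by the
coordinate. -/
theorem exists_eq_coord_mul (hf : ContDiffOn ℂ ∞ f (Metric.ball 0 ρ)) (j : Fin d)
    (h0 : ∀ z ∈ Metric.ball (0 : CSpace d) ρ, z j = 0 → f z = 0) :
    ∃ f₁ : CSpace d → ℂ, ContDiffOn ℂ ∞ f₁ (Metric.ball 0 ρ) ∧
      ∀ z ∈ Metric.ball (0 : CSpace d) ρ, f z = z j * f₁ z := by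
  -- Hadamard's lemma: `L (t, z)` multiplies the `j`-th coordinate of `z` by `t`, and `f` vanishes
  -- at `t = 0`, so `f z = z_j ∫₀¹ ∂_j f (L (t, z)) dt`. Balls of the supremum norm are stable under
  -- this scaling.
  let L : ℂ × CSpace d → CSpace d := fun p => p.2 + ((p.1 - 1) * p.2 j) • (Pi.single j 1)
  have hL : ContDiff ℂ ∞ L := by
    have h1 : ContDiff ℂ ∞ fun p : ℂ × CSpace d => p.2 j :=
      (contDiff_apply ℂ ℂ j).comp contDiff_snd
    exact contDiff_snd.add ((((contDiff_fst.sub contDiff_const).mul h1)).smul contDiff_const)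
  have hLU : ∀ t : ℂ, ∀ z, L (t, z) = Function.update z j (t * z j) :=
    fun t z => (update_eq_add z j t).symm
  let U : Set (ℂ × CSpace d) := L ⁻¹' Metric.ball 0 ρ
  have hU : IsOpen U := Metric.isOpen_ball.preimage hL.continuous
  have hmem : ∀ t ∈ Icc (0 : ℝ) 1, ∀ z ∈ Metric.ball (0 : CSpace d) ρ, ((t : ℂ), z) ∈ U := by
    intro t ht z hz
    simp only [U, mem_preimage, hLU, mem_ball_zero_iff] at hz ⊢
    refine (norm_update_le z j ?_).trans_lt hz
    rw [Complex.norm_real, Real.norm_eq_abs, abs_of_nonneg ht.1]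
    exact ht.2
  have hdf : ContDiffOn ℂ ∞ (fderiv ℂ f) (Metric.ball 0 ρ) :=
    hf.fderiv_of_isOpen Metric.isOpen_ball (by simp)
  have hK : ContDiffOn ℂ ∞ (fun p => fderiv ℂ f (L p) (Pi.single j 1)) U :=
    (hdf.comp hL.contDiffOn fun p hp => hp).clm_apply contDiffOn_const
  refine ⟨fun z => ∫ t in (0 : ℝ)..1, fderiv ℂ f (L (t, z)) (Pi.single j 1),
    contDiffOn_infty.2 fun n => contDiffOn_integral hU Metric.isOpen_ball hmem n hK,
    fun z hz => ?_⟩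
  have hder : ∀ t ∈ uIcc (0 : ℝ) 1, HasDerivAt (fun t : ℝ => f (L (t, z)))
      (z j * fderiv ℂ f (L (t, z)) (Pi.single j 1)) t := by
    intro t ht
    rw [uIcc_of_le zero_le_one] at ht
    have h1 := ((hf.contDiffAt (Metric.isOpen_ball.mem_nhds (hmem t ht z hz))).differentiableAt
      (by simp)).hasFDerivAt
    have h2 : HasDerivAt (fun t : ℝ => L (t, z)) (z j • (Pi.single j 1 : CSpace d)) t := by
      have h3 : HasDerivAt (fun t : ℝ => ((t : ℂ) - 1) * z j) (z j) t := by
        simpa using ((Complex.ofRealCLM.hasDerivAt (x := t)).sub_const 1).mul_const (z j)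
      exact (h3.smul_const (Pi.single j 1 : CSpace d)).const_add z
    have h4 := (h1.restrictScalars ℝ).comp_hasDerivAt t h2
    simpa [Function.comp_def] using h4
  have hint : IntervalIntegrable (fun t : ℝ => z j * fderiv ℂ f (L (t, z)) (Pi.single j 1))
      volume 0 1 := by
    refine ContinuousOn.intervalIntegrable ?_
    rw [uIcc_of_le zero_le_one]
    refine continuousOn_const.mul (hK.continuousOn.comp (by fun_prop) fun t ht => hmem t ht z hz)
  have key := intervalIntegral.integral_eq_sub_of_hasDerivAt hder hint
  rw [intervalIntegral.integral_const_mul] at key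
  rw [key]
  have e1 : L (((1 : ℝ) : ℂ), z) = z := by simp [L]
  have e2 : f (L (((0 : ℝ) : ℂ), z)) = 0 := by
    refine h0 _ (hmem 0 (by simp) z hz) ?_
    rw [hLU]
    simp
  rw [e1, e2, sub_zero]

theorem differentiableOn_line {s : Set (CSpace d)} (hs : IsOpen s) (hf : DifferentiableOn ℂ f s)
    (z v : CSpace d) :
    IsOpen {t : ℂ | z + t • v ∈ s} ∧
      DifferentiableOn ℂ (fun t : ℂ => f (z + t • v)) {t : ℂ | z + t • v ∈ s} := by
  have hc : Continuous fun t : ℂ => z + t • v := by fun_prop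
  refine ⟨hs.preimage hc, hf.comp (Differentiable.differentiableOn (by fun_prop)) fun t ht => ht⟩

theorem isPreconnected_line {s : Set (CSpace d)} (hs : Convex ℝ s) (z v : CSpace d) :
    IsPreconnected {t : ℂ | z + t • v ∈ s} := by
  refine Convex.isPreconnected ?_
  intro x hx y hy a b ha hb hab
  have := hs hx hy ha hb hab
  rw [mem_ofPred_eq] at hx hy ⊢
  convert this using 1
  simp only [smul_add, smul_assoc, add_smul]
  nth_rw 1 [← one_smul ℝ z, ← hab, add_smul]
  abel

/-- A holomorphic function on a convex open set that vanishes near a point vanishes. -/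
theorem eq_zero_of_eventually_eq_zero {s : Set (CSpace d)} (hs : IsOpen s) (hc : Convex ℝ s)
    (hf : DifferentiableOn ℂ f s) {p q : CSpace d} (hp : p ∈ s) (hq : q ∈ s)
    (h : ∀ᶠ z in 𝓝 p, f z = 0) : f q = 0 := by
  obtain ⟨ho, hd⟩ := differentiableOn_line hs hf p (q - p)
  have h0 : (0 : ℂ) ∈ {t : ℂ | p + t • (q - p) ∈ s} := by simpa using hp
  have h1 : (1 : ℂ) ∈ {t : ℂ | p + t • (q - p) ∈ s} := by simpa using hq
  have hcont : Tendsto (fun t : ℂ => p + t • (q - p)) (𝓝 0) (𝓝 p) := by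
    have : Continuous fun t : ℂ => p + t • (q - p) := by fun_prop
    simpa using this.tendsto 0
  have := (hd.analyticOnNhd ho).eqOn_zero_of_preconnected_of_eventuallyEq_zero
    (isPreconnected_line hc p (q - p)) h0 (hcont.eventually h) h1
  simpa using this

theorem frequently_ne_zero {s : Set (CSpace d)} (hs : IsOpen s) (hc : Convex ℝ s)
    (hf : DifferentiableOn ℂ f s) {p q : CSpace d} (hp : p ∈ s) (hq : q ∈ s) (hfq : f q ≠ 0) :
    ∃ᶠ z in 𝓝 p, f z ≠ 0 := fun h =>
  hfq (eq_zero_of_eventually_eq_zero hs hc hf hp hq (by simpa using h))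

theorem exists_mul_ne_zero {s : Set (CSpace d)} (hs : IsOpen s) (hc : Convex ℝ s)
    (hf : DifferentiableOn ℂ f s) (hg : DifferentiableOn ℂ g s) (h : ∃ z ∈ s, f z ≠ 0)
    (h' : ∃ z ∈ s, g z ≠ 0) : ∃ z ∈ s, f z * g z ≠ 0 := by
  obtain ⟨p, hp, hfp⟩ := h
  obtain ⟨q, hq, hgq⟩ := h'
  have h1 : ∀ᶠ z in 𝓝 p, z ∈ s ∧ f z ≠ 0 :=
    Filter.Eventually.and (hs.mem_nhds hp)
      ((hf.differentiableAt (hs.mem_nhds hp)).continuousAt.eventually_ne hfp)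
  obtain ⟨z, hz, hz'⟩ := ((frequently_ne_zero hs hc hg hp hq hgq).and_eventually h1).exists
  exact ⟨z, hz'.1, mul_ne_zero hz'.2 hz⟩

theorem differentiableOn_prod {ι : Type*} (A : Finset ι) {s : Set (CSpace d)}
    {F : ι → CSpace d → ℂ} (hF : ∀ i ∈ A, DifferentiableOn ℂ (F i) s) :
    DifferentiableOn ℂ (fun z => ∏ i ∈ A, F i z) s := by
  classical
  induction A using Finset.induction_on with
  | empty => simp
  | insert i A hi ih =>
    simp only [Finset.prod_insert hi]
    exact (hF i (Finset.mem_insert_self i A)).mul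
      (ih fun j hj => hF j (Finset.mem_insert_of_mem hj))

theorem exists_prod_ne_zero {ι : Type*} (A : Finset ι) {s : Set (CSpace d)} (hs : IsOpen s)
    (hc : Convex ℝ s) {F : ι → CSpace d → ℂ} (hF : ∀ i ∈ A, DifferentiableOn ℂ (F i) s)
    (h : ∀ i ∈ A, ∃ z ∈ s, F i z ≠ 0) (hne : s.Nonempty) : ∃ z ∈ s, ∏ i ∈ A, F i z ≠ 0 := by
  classical
  induction A using Finset.induction_on with
  | empty =>
    obtain ⟨z, hz⟩ := hne
    exact ⟨z, hz, by simp⟩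
  | insert i A hi ih =>
    simp only [Finset.prod_insert hi]
    refine exists_mul_ne_zero hs hc (hF i (Finset.mem_insert_self i A)) ?_
      (h i (Finset.mem_insert_self i A))
      (ih (fun j hj => hF j (Finset.mem_insert_of_mem hj))
        fun j hj => h j (Finset.mem_insert_of_mem hj))
    exact differentiableOn_prod A fun j hj => hF j (Finset.mem_insert_of_mem hj)

/-- Splitting off the powers of the coordinates that divide a holomorphic function. -/
theorem exists_eq_monomial_mul (hρ : 0 < ρ) (A : Finset (Fin d))
    (hf : ContDiffOn ℂ ∞ f (Metric.ball 0 ρ)) (h0 : ∃ z ∈ Metric.ball (0 : CSpace d) ρ, f z ≠ 0) :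
    ∃ (J : Fin d → ℕ) (f' : CSpace d → ℂ), (∀ j ∉ A, J j = 0) ∧
      ContDiffOn ℂ ∞ f' (Metric.ball 0 ρ) ∧
      (∀ z ∈ Metric.ball (0 : CSpace d) ρ, f z = (∏ j, z j ^ J j) * f' z) ∧
      ∀ j ∈ A, ∃ z ∈ Metric.ball (0 : CSpace d) ρ, z j = 0 ∧ f' z ≠ 0 := by
  obtain ⟨v, hv, hfv⟩ := h0
  -- The process of dividing by coordinates terminates because the order at `t = 0` of `t ↦ f (t
  -- v)`, finite as `f v ≠ 0`, drops by one with every division. The same `v` works for all the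
  -- quotients.
  have hline : ∀ f : CSpace d → ℂ, ContDiffOn ℂ ∞ f (Metric.ball 0 ρ) → f v ≠ 0 →
      AnalyticAt ℂ (fun t : ℂ => f (t • v)) 0 ∧ ¬ ∀ᶠ t in 𝓝 (0 : ℂ), f (t • v) = 0 := by
    intro f hf hfv
    obtain ⟨ho, hd⟩ := differentiableOn_line Metric.isOpen_ball (hf.differentiableOn (by simp)) 0 v
    simp only [zero_add] at ho hd
    have hm0 : (0 : ℂ) ∈ {t : ℂ | t • v ∈ Metric.ball 0 ρ} := by simpa using hρ
    refine ⟨hd.analyticAt (ho.mem_nhds hm0), fun h => hfv ?_⟩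
    have := (hd.analyticOnNhd ho).eqOn_zero_of_preconnected_of_eventuallyEq_zero
      (by simpa using isPreconnected_line (convex_ball (0 : CSpace d) ρ) 0 v) hm0 h
      (show (1 : ℂ) ∈ {t : ℂ | t • v ∈ Metric.ball 0 ρ} by simpa using hv)
    simpa using this
  have hfin : analyticOrderAt (fun t : ℂ => f (t • v)) 0 ≠ ⊤ := by
    rw [Ne, analyticOrderAt_eq_top]
    exact (hline f hf hfv).2
  obtain ⟨m, hm⟩ := ENat.ne_top_iff_exists.1 hfin
  induction m generalizing f with
  | zero =>
    refine ⟨0, f, by simp, hf, by simp, fun j _ => ⟨0, by simpa using hρ, rfl, ?_⟩⟩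
    have := (hline f hf hfv).1.analyticOrderAt_eq_zero.1 hm.symm
    simpa using this
  | succ m ih =>
    by_cases hA : ∀ j ∈ A, ∃ z ∈ Metric.ball (0 : CSpace d) ρ, z j = 0 ∧ f z ≠ 0
    · exact ⟨0, f, by simp, hf, by simp, hA⟩
    push Not at hA
    obtain ⟨j, hj, hz⟩ := hA
    obtain ⟨f₁, hf₁, hff₁⟩ := exists_eq_coord_mul hf j hz
    have hfv₁ : f₁ v ≠ 0 := fun h => hfv (by rw [hff₁ v hv, h, mul_zero])
    have hvj : v j ≠ 0 := fun h => hfv (by rw [hff₁ v hv, h, zero_mul])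
    have h1 := hline f₁ hf₁ hfv₁
    have heq : (fun t : ℂ => f (t • v)) =ᶠ[𝓝 0]
        (fun t : ℂ => t * v j) * (fun t : ℂ => f₁ (t • v)) := by
      have hc : ContinuousAt (fun t : ℂ => t • v) 0 := by fun_prop
      have : ∀ᶠ t in 𝓝 (0 : ℂ), t • v ∈ Metric.ball (0 : CSpace d) ρ :=
        hc (Metric.isOpen_ball.mem_nhds (by simpa using hρ))
      filter_upwards [this] with t ht
      rw [hff₁ _ ht]
      simp
    have ho1 : analyticOrderAt (fun t : ℂ => t * v j) 0 = 1 := by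
      have ha : AnalyticAt ℂ (fun t : ℂ => t * v j) 0 := by fun_prop
      have := (ha.analyticOrderAt_eq_natCast (n := 1)).2 ⟨fun _ => v j, by fun_prop, hvj, by simp⟩
      simpa using this
    have hm1 : (m : ℕ∞) = analyticOrderAt (fun t : ℂ => f₁ (t • v)) 0 := by
      rw [analyticOrderAt_congr heq, analyticOrderAt_mul (by fun_prop) h1.1, ho1] at hm
      have h2 : (m : ℕ∞) + 1 = analyticOrderAt (fun t : ℂ => f₁ (t • v)) 0 + 1 := by
        rw [add_comm (analyticOrderAt _ _), ← hm]
        norm_cast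
      exact ENat.add_left_injective_of_ne_top (by simp) h2
    obtain ⟨J, f', hJ, hf', hfac, hne⟩ := ih hf₁ hfv₁ (hm1 ▸ ENat.natCast_ne_top m) hm1
    refine ⟨J + Pi.single j 1, f', fun k hk => ?_, hf', fun z hz => ?_, hne⟩
    · have : k ≠ j := fun h => hk (h ▸ hj)
      simp [hJ k hk, this]
    · rw [hff₁ z hz, hfac z hz]
      have : ∏ k, z k ^ (J + Pi.single j 1 : Fin d → ℕ) k = z j * ∏ k, z k ^ J k := by
        simp only [Pi.add_apply, pow_add, Finset.prod_mul_distrib]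
        rw [mul_comm]
        congr 1
        rw [Finset.prod_eq_single j (fun k _ hk => by simp [hk]) (by simp)]
        simp
      rw [this]
      ring

end HolomorphicGerms

/-! ### Generic complex discs through a neighbourhood of the origin -/

section Slices

variable {d : ℕ} {ρ : ℝ} {f g : CSpace d → ℂ}

/-- The projection of `ℂ^d` onto the hyperplane `z_j = 0` along `v`. -/
noncomputable def projAlong (v : CSpace d) (j : Fin d) (z : CSpace d) : CSpace d :=
  z + (-(z j / v j)) • v

theorem continuous_projAlong (v : CSpace d) (j : Fin d) : Continuous (projAlong v j) := by
  unfold projAlong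
  fun_prop

theorem differentiable_projAlong (v : CSpace d) (j : Fin d) :
    Differentiable ℂ (projAlong v j) := by
  unfold projAlong
  fun_prop

theorem projAlong_of_eq_zero (v : CSpace d) {j : Fin d} {z : CSpace d} (h : z j = 0) :
    projAlong v j z = z := by
  simp [projAlong, h]

theorem add_smul_eq_projAlong {v z : CSpace d} {j : Fin d} (hv : v j ≠ 0) {t : ℂ}
    (h : (z + t • v) j = 0) : z + t • v = projAlong v j z := by
  have : t = -(z j / v j) := by
    simp only [Pi.add_apply, Pi.smul_apply, smul_eq_mul] at h
    field_simp
    linear_combination h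
  rw [projAlong, this]

theorem convex_preimage_projAlong (v : CSpace d) (j : Fin d) (ρ : ℝ) :
    Convex ℝ (projAlong v j ⁻¹' Metric.ball 0 ρ) := by
  intro x hx y hy a b ha hb hab
  have := convex_ball (0 : CSpace d) ρ hx hy ha hb hab
  rw [mem_preimage]
  convert this using 1
  simp only [projAlong, Pi.add_apply, Pi.smul_apply, Complex.real_smul]
  funext k
  simp only [Pi.add_apply, Pi.smul_apply, smul_eq_mul, Complex.real_smul]
  ring

/-- The preimage of the ball under the projection is open and convex, and contains both `0` and the
given point of the hyperplane, so the identity theorem applies on it. -/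
theorem frequently_projAlong_ne_zero (hf : ContDiffOn ℂ ∞ f (Metric.ball 0 ρ)) (v : CSpace d)
    {j : Fin d} (h : ∃ z ∈ Metric.ball (0 : CSpace d) ρ, z j = 0 ∧ f z ≠ 0) :
    ∃ᶠ z in 𝓝 (0 : CSpace d), f (projAlong v j z) ≠ 0 := by
  obtain ⟨q, hq, hqj, hfq⟩ := h
  have hρ : 0 < ρ := (norm_nonneg q).trans_lt (by simpa using hq)
  have ho : IsOpen (projAlong v j ⁻¹' Metric.ball 0 ρ) :=
    Metric.isOpen_ball.preimage (continuous_projAlong v j)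
  refine frequently_ne_zero (f := fun z => f (projAlong v j z)) ho
    (convex_preimage_projAlong v j ρ) ?_ (p := 0) (q := q) ?_ ?_ ?_
  · exact (hf.differentiableOn (by simp)).comp (differentiable_projAlong v j).differentiableOn
      fun z hz => hz
  · rw [mem_preimage, projAlong_of_eq_zero v rfl]
    simpa using hρ
  · rwa [mem_preimage, projAlong_of_eq_zero v hqj]
  · rwa [projAlong_of_eq_zero v hqj]

theorem exists_generic_direction (hρ : 0 < ρ) (hf : ContDiffOn ℂ ∞ f (Metric.ball 0 ρ))
    (hg : ContDiffOn ℂ ∞ g (Metric.ball 0 ρ))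
    (hf0 : ∃ z ∈ Metric.ball (0 : CSpace d) ρ, f z ≠ 0)
    (hg0 : ∃ z ∈ Metric.ball (0 : CSpace d) ρ, g z ≠ 0) :
    ∃ v ∈ Metric.ball (0 : CSpace d) ρ, (∀ j, v j ≠ 0) ∧ f v ≠ 0 ∧ g v ≠ 0 := by
  have hB := Metric.isOpen_ball (x := (0 : CSpace d)) (ε := ρ)
  have hc := convex_ball (0 : CSpace d) ρ
  have hcoord : ∃ z ∈ Metric.ball (0 : CSpace d) ρ, ∏ j, z j ≠ 0 := by
    refine ⟨fun _ => ((ρ / 2 : ℝ) : ℂ), ?_, Finset.prod_ne_zero_iff.2 fun j _ => ?_⟩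
    · rw [mem_ball_zero_iff, pi_norm_lt_iff hρ]
      intro j
      rw [Complex.norm_real, Real.norm_eq_abs, abs_of_pos (by linarith)]
      linarith
    · exact_mod_cast (by positivity : ρ / 2 ≠ 0)
  have hd : DifferentiableOn ℂ (fun z : CSpace d => ∏ j, z j) (Metric.ball 0 ρ) :=
    differentiableOn_prod _ fun j _ => (differentiable_apply j).differentiableOn
  have hfd := hf.differentiableOn (by simp)
  have hgd := hg.differentiableOn (by simp)
  obtain ⟨v, hv, hv0⟩ := exists_mul_ne_zero hB hc hd (hfd.mul hgd) hcoord
    (exists_mul_ne_zero hB hc hfd hgd hf0 hg0)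
  refine ⟨v, hv, fun j => ?_, ?_, ?_⟩
  · exact Finset.prod_ne_zero_iff.1 (left_ne_zero_of_mul hv0) j (Finset.mem_univ j)
  · exact left_ne_zero_of_mul (right_ne_zero_of_mul hv0)
  · exact right_ne_zero_of_mul (right_ne_zero_of_mul hv0)

theorem eventually_line_ne_zero (hρ : 0 < ρ) (hf : ContDiffOn ℂ ∞ f (Metric.ball 0 ρ))
    {v : CSpace d} (hv : v ∈ Metric.ball (0 : CSpace d) ρ) (hfv : f v ≠ 0) :
    ∀ᶠ t in 𝓝[≠] (0 : ℂ), f (t • v) ≠ 0 := by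
  obtain ⟨ho, hd⟩ := differentiableOn_line Metric.isOpen_ball (hf.differentiableOn (by simp)) 0 v
  simp only [zero_add] at ho hd
  have hm0 : (0 : ℂ) ∈ {t : ℂ | t • v ∈ Metric.ball 0 ρ} := by simpa using hρ
  rcases (hd.analyticAt (ho.mem_nhds hm0)).eventually_eq_zero_or_eventually_ne_zero with h | h
  · refine absurd ?_ hfv
    have := (hd.analyticOnNhd ho).eqOn_zero_of_preconnected_of_eventuallyEq_zero
      (by simpa using isPreconnected_line (convex_ball (0 : CSpace d) ρ) 0 v) hm0 h
      (show (1 : ℂ) ∈ {t : ℂ | t • v ∈ Metric.ball 0 ρ} by simpa using hv)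
    simpa using this
  · exact h

/-- On the compact circle through the origin's slice `|f|` has a positive minimum; half of it
survives for nearby centres. -/
theorem eventually_lower_bound_on_circle (hf : ContDiffOn ℂ ∞ f (Metric.ball 0 ρ))
    {v : CSpace d} {r : ℝ} (hr : 0 < r) (hin : ∀ t : ℂ, ‖t‖ = r → t • v ∈ Metric.ball 0 ρ)
    (hne : ∀ t : ℂ, ‖t‖ = r → f (t • v) ≠ 0) :
    ∃ δ > 0, ∀ᶠ z in 𝓝 (0 : CSpace d), ∀ t : ℂ, ‖t‖ = r → δ ≤ ‖f (z + t • v)‖ := by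
  have hcont : ∀ t : ℂ, ‖t‖ = r → ContinuousAt (fun p : CSpace d × ℂ => ‖f (p.1 + p.2 • v)‖) (0, t) := by
    intro t ht
    have h1 : ContinuousAt f ((0 : CSpace d) + t • v) := by
      rw [zero_add]
      exact hf.continuousOn.continuousAt (Metric.isOpen_ball.mem_nhds (hin t ht))
    exact (h1.comp (f := fun p : CSpace d × ℂ => p.1 + p.2 • v) (x := (0, t))
      (by fun_prop)).norm
  have hK : IsCompact (Metric.sphere (0 : ℂ) r) := isCompact_sphere _ _
  have hKne : (Metric.sphere (0 : ℂ) r).Nonempty := (NormedSpace.sphere_nonempty).2 hr.le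
  obtain ⟨t₀, ht₀, hmin⟩ := hK.exists_isMinOn hKne (f := fun t => ‖f (t • v)‖) (by
    intro t ht
    rw [mem_sphere_zero_iff_norm] at ht
    have h1 : ContinuousAt f (t • v) :=
      hf.continuousOn.continuousAt (Metric.isOpen_ball.mem_nhds (hin t ht))
    exact (h1.comp (f := fun t : ℂ => t • v) (by fun_prop)).norm.continuousWithinAt)
  rw [mem_sphere_zero_iff_norm] at ht₀
  have hpos : 0 < ‖f (t₀ • v)‖ := norm_pos_iff.2 (hne t₀ ht₀)
  refine ⟨‖f (t₀ • v)‖ / 2, half_pos hpos, ?_⟩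
  have := hK.eventually_forall_of_forall_eventually (x₀ := (0 : CSpace d))
    (P := fun z t => ‖f (t₀ • v)‖ / 2 ≤ ‖f (z + t • v)‖) fun t ht => by
      have h2 : ‖f (t₀ • v)‖ ≤ ‖f (t • v)‖ := hmin ht
      rw [mem_sphere_zero_iff_norm] at ht
      have h3 := (hcont t ht).eventually (lt_mem_nhds (a := ‖f (t₀ • v)‖ / 2) (by
        simp only [zero_add]
        linarith))
      exact h3.mono fun p hp => hp.le
  filter_upwards [this] with z hz t ht
  exact hz t (by simpa using ht)

/-- Discs in a generic direction, on whose boundaries `f` and `g` are bounded below, and which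
for a dense set of centres meet the coordinate hyperplanes outside the zeros of `f` and `g`. -/
theorem exists_generic_slices (hρ : 0 < ρ) (A : Finset (Fin d))
    (hf : ContDiffOn ℂ ∞ f (Metric.ball 0 ρ)) (hg : ContDiffOn ℂ ∞ g (Metric.ball 0 ρ))
    (hf0 : ∃ z ∈ Metric.ball (0 : CSpace d) ρ, f z ≠ 0)
    (hg0 : ∃ z ∈ Metric.ball (0 : CSpace d) ρ, g z ≠ 0)
    (hfA : ∀ j ∈ A, ∃ z ∈ Metric.ball (0 : CSpace d) ρ, z j = 0 ∧ f z ≠ 0)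
    (hgA : ∀ j ∈ A, ∃ z ∈ Metric.ball (0 : CSpace d) ρ, z j = 0 ∧ g z ≠ 0) :
    ∃ (v : CSpace d) (r δ ρ' : ℝ), 0 < r ∧ r ≤ 1 / 8 ∧ 0 < δ ∧ 0 < ρ' ∧ ρ' ≤ ρ / 2 ∧
      (∀ z ∈ Metric.ball (0 : CSpace d) ρ', ∀ t : ℂ, ‖t‖ ≤ 8 * r →
        z + t • v ∈ Metric.ball 0 (ρ / 2)) ∧
      (∀ z ∈ Metric.ball (0 : CSpace d) ρ', ∀ t : ℂ, ‖t‖ = r →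
        δ ≤ ‖f (z + t • v)‖ ∧ δ ≤ ‖g (z + t • v)‖) ∧
      ∀ p ∈ Metric.ball (0 : CSpace d) ρ', ∃ᶠ z in 𝓝 p, ∀ t : ℂ,
        (∃ j ∈ A, (z + t • v) j = 0) → f (z + t • v) ≠ 0 ∧ g (z + t • v) ≠ 0 := by
  obtain ⟨v, hv, hvj, hfv, hgv⟩ := exists_generic_direction hρ hf hg hf0 hg0
  have hsmall : ∀ᶠ t in 𝓝 (0 : ℂ), t • v ∈ Metric.ball (0 : CSpace d) (ρ / 4) := by
    have hc : ContinuousAt (fun t : ℂ => t • v) 0 := by fun_prop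
    exact hc (Metric.isOpen_ball.mem_nhds (by simpa using hρ))
  have hne := (eventually_line_ne_zero hρ hf hv hfv).and (eventually_line_ne_zero hρ hg hv hgv)
  rw [eventually_nhdsWithin_iff] at hne
  obtain ⟨ε, hε, hball⟩ := Metric.eventually_nhds_iff.1 (hne.and hsmall)
  -- Gives `8 r < ε`: the division argument uses the circles of radius `r` and `7 r` inside the disc
  -- of radius `8 r`.
  set r := min (ε / 16) (1 / 8) with hrdef
  have hr : 0 < r := by positivity
  have hrε : 8 * r < ε := by
    have := min_le_left (ε / 16) (1 / 8)
    rw [← hrdef] at this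
    linarith
  have hcirc : ∀ t : ℂ, ‖t‖ ≤ 8 * r → t • v ∈ Metric.ball (0 : CSpace d) (ρ / 4) := fun t ht =>
    (hball (by rw [dist_zero_right]; linarith)).2
  have hsub4 : Metric.ball (0 : CSpace d) (ρ / 4) ⊆ Metric.ball 0 ρ :=
    Metric.ball_subset_ball (by linarith)
  have hne' : ∀ t : ℂ, ‖t‖ = r → f (t • v) ≠ 0 ∧ g (t • v) ≠ 0 := fun t ht =>
    (hball (by rw [dist_zero_right]; linarith)).1 (by
      rw [mem_compl_singleton_iff]
      rintro rfl
      rw [norm_zero] at ht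
      linarith)
  have hin : ∀ t : ℂ, ‖t‖ = r → t • v ∈ Metric.ball (0 : CSpace d) ρ := fun t ht =>
    hsub4 (hcirc t (by linarith))
  obtain ⟨δ₁, hδ₁, h₁⟩ := eventually_lower_bound_on_circle hf hr hin fun t ht => (hne' t ht).1
  obtain ⟨δ₂, hδ₂, h₂⟩ := eventually_lower_bound_on_circle hg hr hin fun t ht => (hne' t ht).2
  have hproj : ∀ᶠ z in 𝓝 (0 : CSpace d), ∀ j ∈ A, projAlong v j z ∈ Metric.ball 0 ρ := by
    rw [Filter.eventually_all_finset]
    intro j _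
    refine (continuous_projAlong v j).continuousAt (Metric.isOpen_ball.mem_nhds ?_)
    rw [projAlong_of_eq_zero v rfl]
    simpa using hρ
  obtain ⟨ρ₁, hρ₁, hb₁⟩ := Metric.eventually_nhds_iff.1 ((h₁.and h₂).and hproj)
  set ρ' := min ρ₁ (ρ / 4) with hρ'def
  have hρ'1 : ρ' ≤ ρ₁ := min_le_left _ _
  have hρ'2 : ρ' ≤ ρ / 4 := min_le_right _ _
  have hρ' : 0 < ρ' := by positivity
  have hb : ∀ z ∈ Metric.ball (0 : CSpace d) ρ', _ := fun z hz => hb₁ (y := z) (by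
    rw [Metric.mem_ball] at hz
    linarith)
  refine ⟨v, r, min δ₁ δ₂, ρ', hr, min_le_right _ _, by positivity, hρ', by linarith,
    fun z hz t ht => ?_, fun z hz t ht => ?_, fun p hp => ?_⟩
  · have h3 := hcirc t ht
    rw [mem_ball_zero_iff] at h3 hz ⊢
    linarith [norm_add_le z (t • v)]
  · exact ⟨(min_le_left _ _).trans ((hb z hz).1.1 t ht),
      (min_le_right _ _).trans ((hb z hz).1.2 t ht)⟩
  · have hB := Metric.isOpen_ball (x := (0 : CSpace d)) (ε := ρ')
    have hc := convex_ball (0 : CSpace d) ρ'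
    have hcomp : ∀ {f : CSpace d → ℂ}, ContDiffOn ℂ ∞ f (Metric.ball 0 ρ) → ∀ j ∈ A,
        DifferentiableOn ℂ (fun z => f (projAlong v j z)) (Metric.ball 0 ρ') := fun hf j hj =>
      (hf.differentiableOn (by simp)).comp (differentiable_projAlong v j).differentiableOn
        fun z hz => (hb z hz).2 j hj
    have hex : ∀ {f : CSpace d → ℂ}, ContDiffOn ℂ ∞ f (Metric.ball 0 ρ) → ∀ j,
        (∃ z ∈ Metric.ball (0 : CSpace d) ρ, z j = 0 ∧ f z ≠ 0) →
        ∃ z ∈ Metric.ball (0 : CSpace d) ρ', f (projAlong v j z) ≠ 0 := fun hf j h => by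
      obtain ⟨z, hz, hz'⟩ := ((frequently_projAlong_ne_zero hf v h).and_eventually
        (Metric.ball_mem_nhds (0 : CSpace d) hρ')).exists
      exact ⟨z, hz', hz⟩
    -- As `v j ≠ 0`, the line `z + t v` meets `z_j = 0` in the single point `projAlong v j z`. So
    -- the centre `z` is good as soon as one holomorphic function of `z`, the product over `A`, is
    -- nonzero, and this holds on a dense set.
    obtain ⟨q, hq, hq0⟩ := exists_prod_ne_zero A hB hc
      (F := fun j z => f (projAlong v j z) * g (projAlong v j z))
      (fun j hj => (hcomp hf j hj).mul (hcomp hg j hj))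
      (fun j hj => exists_mul_ne_zero hB hc (hcomp hf j hj) (hcomp hg j hj)
        (hex hf j (hfA j hj)) (hex hg j (hgA j hj)))
      ⟨0, by simpa using hρ'⟩
    refine (frequently_ne_zero hB hc
      (differentiableOn_prod A fun j hj => (hcomp hf j hj).mul (hcomp hg j hj)) hp hq
      hq0).mono fun z hz t ht => ?_
    obtain ⟨j, hj, hzj⟩ := ht
    rw [add_smul_eq_projAlong (hvj j) hzj]
    exact mul_ne_zero_iff.1 (Finset.prod_ne_zero_iff.1 hz j hj)

/-- The minimum principle on a disc. -/
theorem le_norm_of_forall_sphere {h : ℂ → ℂ} {U : Set ℂ} {r δ : ℝ}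
    (hd : DifferentiableOn ℂ h U) (hr : 0 < r) (hsub : Metric.closedBall 0 r ⊆ U) (hδ : 0 < δ)
    (hs : ∀ t : ℂ, ‖t‖ = r → δ ≤ ‖h t‖) (hne : ∀ t : ℂ, ‖t‖ < r → h t ≠ 0) {t : ℂ}
    (ht : ‖t‖ ≤ r) : δ ≤ ‖h t‖ := by
  have hne' : ∀ t : ℂ, ‖t‖ ≤ r → h t ≠ 0 := fun t ht => by
    rcases ht.lt_or_eq with h1 | h1
    · exact hne t h1
    · exact norm_pos_iff.1 (hδ.trans_le (hs t h1))
  have hdc : DiffContOnCl ℂ (fun t => (h t)⁻¹) (Metric.ball 0 r) := by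
    refine DifferentiableOn.diffContOnCl ?_
    rw [closure_ball _ hr.ne']
    exact (hd.mono hsub).inv fun t ht => hne' t (by simpa using ht)
  have key := Complex.norm_le_of_forall_mem_frontier_norm_le Metric.isBounded_ball hdc (C := δ⁻¹)
    (fun t ht => by
      rw [frontier_ball _ hr.ne', mem_sphere_zero_iff_norm] at ht
      rw [norm_inv]
      exact inv_anti₀ hδ (hs t ht)) (z := t) (by
      rw [closure_ball _ hr.ne']
      simpa using ht)
  rw [norm_inv] at key
  exact (inv_le_inv₀ (norm_pos_iff.2 (hne' t ht)) hδ).1 key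

/-- A holomorphic function whose zeros lie on coordinate hyperplanes, on none of which it vanishes
identically, has no zero at the origin. -/
theorem ne_zero_of_zeros_on_coord (hρ : 0 < ρ) (A : Finset (Fin d))
    (hf : ContDiffOn ℂ ∞ f (Metric.ball 0 ρ))
    (hfA : ∀ j ∈ A, ∃ z ∈ Metric.ball (0 : CSpace d) ρ, z j = 0 ∧ f z ≠ 0)
    (hf0 : ∃ z ∈ Metric.ball (0 : CSpace d) ρ, f z ≠ 0)
    (hz : ∀ z ∈ Metric.ball (0 : CSpace d) ρ, f z = 0 → ∃ j ∈ A, z j = 0) : f 0 ≠ 0 := by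
  obtain ⟨v, r, δ, ρ', hr, -, hδ, hρ', -, hin, hcirc, hdense⟩ :=
    exists_generic_slices hρ A hf hf hf0 hf0 hfA hfA
  have hsub2 : Metric.ball (0 : CSpace d) (ρ / 2) ⊆ Metric.ball 0 ρ :=
    Metric.ball_subset_ball (by linarith)
  have h0 : (0 : CSpace d) ∈ Metric.ball (0 : CSpace d) ρ' := by simpa using hρ'
  -- On a disc with a good centre `f` has no zeros at all: they would lie on hyperplanes, where the
  -- disc avoids the zeros of `f`. The minimum principle bounds `|f|` below at the centre, by a
  -- constant independent of the disc, and continuity carries this to `0`.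
  have hfreq : ∃ᶠ z in 𝓝 (0 : CSpace d), δ ≤ ‖f z‖ := by
    refine ((hdense 0 h0).and_eventually (Metric.ball_mem_nhds _ hρ')).mono fun z hz' => ?_
    obtain ⟨hgen, hzρ⟩ := hz'
    obtain ⟨ho, hd⟩ := differentiableOn_line Metric.isOpen_ball
      (hf.differentiableOn (by simp)) z v
    have := le_norm_of_forall_sphere hd hr (fun t ht => ?_) hδ
      (fun t ht => (hcirc z hzρ t ht).1) (fun t ht h0 => ?_) (t := 0) (by simpa using hr.le)
    · simpa using this
    · rw [mem_closedBall_zero_iff] at ht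
      exact hsub2 (hin z hzρ t (by linarith))
    · exact (hgen t (hz _ (hsub2 (hin z hzρ t (by linarith))) h0)).1 h0
  intro hf0
  have hcont : ContinuousAt f 0 :=
    hf.continuousOn.continuousAt (Metric.ball_mem_nhds _ hρ)
  have hlt : ∀ᶠ z in 𝓝 (0 : CSpace d), ‖f z‖ < δ := by
    have h1 := hcont.norm
    rw [ContinuousAt, hf0, norm_zero] at h1
    exact h1.eventually (gt_mem_nhds hδ)
  obtain ⟨z, hz1, hz2⟩ := (hfreq.and_eventually hlt).exists
  linarith

end Slices

/-! ### Families of functions on a disc with uniformly bounded derivatives -/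

section SmoothlyBounded

variable {S : Type*} {Δ : Set ℂ}

/-- A family of smooth functions on `Δ` all of whose derivatives are bounded, uniformly in the
family. -/
def SmoothlyBounded {F : Type*} [NormedAddCommGroup F] [NormedSpace ℝ F] (Δ : Set ℂ)
    (v : S → ℂ → F) : Prop :=
  (∀ s, ContDiffOn ℝ ∞ (v s) Δ) ∧
    ∀ j : ℕ, ∃ C, ∀ s, ∀ t ∈ Δ, ‖iteratedFDerivWithin ℝ j (v s) Δ t‖ ≤ C

/-- Restrictions of one smooth function to discs with the same direction `L` inside a compact set:
each derivative is bounded on `K`, and composing with `L` costs powers of `‖L‖`. -/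
theorem smoothlyBounded_comp_affine {E : Type*} [NormedAddCommGroup E] [NormedSpace ℝ E]
    {F : Type*} [NormedAddCommGroup F] [NormedSpace ℝ F] (hΔ : IsOpen Δ) {Ω K : Set E}
    (hΩ : IsOpen Ω) (hK : IsCompact K) (hKΩ : K ⊆ Ω) (L : ℂ →L[ℝ] E) {z : S → E}
    (hz : ∀ s, ∀ t ∈ Δ, z s + L t ∈ K) {b : E → F} (hb : ContDiffOn ℝ ∞ b Ω) :
    SmoothlyBounded Δ fun s t => b (z s + L t) := by
  have haff : ∀ s, ContDiff ℝ ∞ fun t => z s + L t := fun s => contDiff_const.add L.contDiff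
  refine ⟨fun s => hb.comp (haff s).contDiffOn fun t ht => hKΩ (hz s t ht), fun j => ?_⟩
  obtain ⟨C, hC⟩ := hK.exists_bound_of_continuousOn
    (((hb.continuousOn_iteratedFDerivWithin (m := j) (by exact_mod_cast le_top)
      hΩ.uniqueDiffOn)).mono hKΩ)
  refine ⟨C * ∏ _i : Fin j, ‖L‖, fun s t ht => ?_⟩
  let Ω' : Set E := (fun x => z s + x) ⁻¹' Ω
  have hΩ' : IsOpen Ω' := hΩ.preimage (by fun_prop)
  have hb' : ContDiffOn ℝ ∞ (fun x => b (z s + x)) Ω' :=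
    hb.comp (contDiff_const.add contDiff_id).contDiffOn fun x hx => hx
  have hLo : IsOpen (L ⁻¹' Ω') := hΩ'.preimage L.continuous
  have hLt : L t ∈ Ω' := hKΩ (hz s t ht)
  have e1 : iteratedFDerivWithin ℝ j (fun t => b (z s + L t)) Δ t =
      iteratedFDerivWithin ℝ j ((fun x => b (z s + x)) ∘ L) (L ⁻¹' Ω') t := by
    rw [iteratedFDerivWithin_of_isOpen j hΔ ht, iteratedFDerivWithin_of_isOpen j hLo hLt]
    rfl
  have e2 : iteratedFDerivWithin ℝ j (fun x => b (z s + x)) Ω' (L t) =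
      iteratedFDerivWithin ℝ j b Ω (z s + L t) := by
    rw [iteratedFDerivWithin_of_isOpen j hΩ' hLt, iteratedFDerivWithin_of_isOpen j hΩ hLt]
    exact congrFun (iteratedFDeriv_comp_add_left' j (z s)) (L t)
  rw [e1, L.iteratedFDerivWithin_comp_right hb' hΩ'.uniqueDiffOn hLo.uniqueDiffOn hLt
    (by exact_mod_cast le_top), e2]
  refine (ContinuousMultilinearMap.norm_compContinuousLinearMap_le _ _).trans ?_
  gcongr
  exact hC _ (hz s t ht)

namespace SmoothlyBounded

variable {F : Type*} [NormedAddCommGroup F] [NormedSpace ℝ F] {v w : S → ℂ → F}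

theorem bounded (hv : SmoothlyBounded Δ v) : ∃ C, ∀ s, ∀ t ∈ Δ, ‖v s t‖ ≤ C := by
  obtain ⟨C, hC⟩ := hv.2 0
  exact ⟨C, fun s t ht => by simpa using hC s t ht⟩

theorem congr (hv : SmoothlyBounded Δ v) (h : ∀ s, ∀ t ∈ Δ, w s t = v s t) :
    SmoothlyBounded Δ w := by
  refine ⟨fun s => (hv.1 s).congr (h s), fun j => ?_⟩
  obtain ⟨C, hC⟩ := hv.2 j
  refine ⟨C, fun s t ht => ?_⟩
  rw [iteratedFDerivWithin_congr (h s) ht]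
  exact hC s t ht

theorem sub (hΔ : IsOpen Δ) (hv : SmoothlyBounded Δ v) (hw : SmoothlyBounded Δ w) :
    SmoothlyBounded Δ fun s t => v s t - w s t := by
  refine ⟨fun s => (hv.1 s).sub (hw.1 s), fun j => ?_⟩
  obtain ⟨C, hC⟩ := hv.2 j
  obtain ⟨C', hC'⟩ := hw.2 j
  refine ⟨C + C', fun s t ht => ?_⟩
  have hj : ((j : ℕ∞) : WithTop ℕ∞) ≤ ∞ := by exact_mod_cast le_top
  have := iteratedFDerivWithin_sub_apply (((hv.1 s).of_le hj) t ht) (((hw.1 s).of_le hj) t ht)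
    hΔ.uniqueDiffOn ht
  rw [show (fun s t => v s t - w s t) s = v s - w s from rfl, this]
  exact (norm_sub_le _ _).trans (add_le_add (hC s t ht) (hC' s t ht))

theorem clm_comp {G : Type*} [NormedAddCommGroup G] [NormedSpace ℝ G] (hΔ : IsOpen Δ)
    (hv : SmoothlyBounded Δ v) (T : F →L[ℝ] G) : SmoothlyBounded Δ fun s t => T (v s t) := by
  refine ⟨fun s => T.contDiff.comp_contDiffOn (hv.1 s), fun j => ?_⟩
  obtain ⟨C, hC⟩ := hv.2 j
  refine ⟨‖T‖ * C, fun s t ht => ?_⟩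
  have hj : ((j : ℕ∞) : WithTop ℕ∞) ≤ ∞ := by exact_mod_cast le_top
  have := T.iteratedFDerivWithin_comp_left ((hv.1 s) t ht) hΔ.uniqueDiffOn ht hj
  rw [show (fun s t => T (v s t)) s = T ∘ v s from rfl, this]
  exact (ContinuousLinearMap.norm_compContinuousMultilinearMap_le _ _).trans
    (mul_le_mul_of_nonneg_left (hC s t ht) (norm_nonneg _))

theorem smul [NormedSpace ℂ F] [IsScalarTower ℝ ℂ F] (hΔ : IsOpen Δ) {q : S → ℂ → ℂ}
    (hq : SmoothlyBounded Δ q) (hv : SmoothlyBounded Δ v) :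
    SmoothlyBounded Δ fun s t => q s t • v s t := by
  refine ⟨fun s => (hq.1 s).smul (hv.1 s), fun j => ?_⟩
  choose C hC using hq.2
  choose C' hC' using hv.2
  refine ⟨∑ i ∈ Finset.range (j + 1), (j.choose i : ℝ) * C i * C' (j - i), fun s t ht => ?_⟩
  refine (norm_iteratedFDerivWithin_smul_le (hq.1 s) (hv.1 s) hΔ.uniqueDiffOn ht
    (n := j) (by exact_mod_cast le_top)).trans ?_
  refine Finset.sum_le_sum fun i _ => ?_
  have h1 := hC i s t ht
  have h2 := hC' (j - i) s t ht
  have h3 : 0 ≤ C i := (norm_nonneg _).trans h1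
  gcongr

theorem fderivWithin (hΔ : IsOpen Δ) (hv : SmoothlyBounded Δ v) :
    SmoothlyBounded Δ fun s => _root_.fderivWithin ℝ (v s) Δ := by
  refine ⟨fun s => (hv.1 s).fderivWithin hΔ.uniqueDiffOn (by simp), fun j => ?_⟩
  obtain ⟨C, hC⟩ := hv.2 (j + 1)
  refine ⟨C, fun s t ht => ?_⟩
  rw [norm_iteratedFDerivWithin_fderivWithin hΔ.uniqueDiffOn ht]
  exact hC s t ht

end SmoothlyBounded

end SmoothlyBounded

/-! ### Dividing by linear factors of one variable -/

section Peeling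

variable {Δ : Set ℂ}

/-- The real-linear map `w ↦ (x ↦ σ x • w)`. -/
noncomputable def smulRightCLM {E F : Type*} [NormedAddCommGroup E] [NormedSpace ℝ E]
    [NormedAddCommGroup F] [NormedSpace ℝ F] [NormedSpace ℂ F] [IsScalarTower ℝ ℂ F]
    (σ : E →L[ℝ] ℂ) : F →L[ℝ] E →L[ℝ] F :=
  ((ContinuousLinearMap.compL ℝ E ℂ F).flip σ).comp (ContinuousLinearMap.lsmul ℝ ℂ).flip

theorem smulRightCLM_apply {E F : Type*} [NormedAddCommGroup E] [NormedSpace ℝ E]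
    [NormedAddCommGroup F] [NormedSpace ℝ F] [NormedSpace ℂ F] [IsScalarTower ℝ ℂ F]
    (σ : E →L[ℝ] ℂ) (w : F) : smulRightCLM σ w = σ.smulRight w := by
  ext x
  simp [smulRightCLM]

/-- The derivative is the next lower power of the linear factor times a smooth cofactor, so that
induction on the power is possible. -/
theorem hasFDerivAt_linear_pow_smul {F : Type*} [NormedAddCommGroup F] [NormedSpace ℝ F]
    [NormedSpace ℂ F] [IsScalarTower ℝ ℂ F] (σ : ℂ →L[ℝ] ℂ) (c : ℂ) (m : ℕ) {v : ℂ → F} {t : ℂ}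
    {v' : ℂ →L[ℝ] F} (hv : HasFDerivAt v v' t) :
    HasFDerivAt (fun t => σ (t - c) ^ (m + 1) • v t)
      (σ (t - c) ^ m • (((m + 1 : ℕ) : ℂ) • σ.smulRight (v t) + σ (t - c) • v')) t := by
  have h1 : HasFDerivAt (fun t => σ (t - c)) σ t :=
    σ.hasFDerivAt.comp t ((hasFDerivAt_id t).sub_const c)
  have h2 := (h1.pow (m + 1)).smul hv
  refine h2.congr_fderiv ?_
  ext x
  simp only [Nat.add_sub_cancel, add_apply, smul_apply, ContinuousLinearMap.smulRight_apply,
    smul_eq_mul, pow_succ, smul_add, smul_smul, nsmul_eq_mul]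
  rw [add_comm]
  congr 2
  push_cast
  ring

/-- If `v` is smooth and the `m`-th derivative of `(t - c)^m v` (or of its analogue with the
conjugate) is bounded by `C`, then so is `v`. -/
theorem norm_le_of_linear_pow_smul (hΔ : IsOpen Δ) (hc : Convex ℝ Δ) {σ : ℂ →L[ℝ] ℂ}
    (hσ : ∀ t, ‖σ t‖ = ‖t‖) {c : ℂ} (hcΔ : c ∈ Δ) {C : ℝ} (m : ℕ) :
    ∀ {F : Type} [NormedAddCommGroup F] [NormedSpace ℝ F] [NormedSpace ℂ F] [IsScalarTower ℝ ℂ F]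
      {v : ℂ → F}, ContDiffOn ℝ ∞ v Δ →
      (∀ t ∈ Δ, ‖iteratedFDerivWithin ℝ m (fun t => σ (t - c) ^ m • v t) Δ t‖ ≤ C) →
      ∀ t ∈ Δ, ‖v t‖ ≤ C := by
  induction m with
  | zero =>
    intro F _ _ _ _ v hv h t ht
    simpa using h t ht
  | succ m ih =>
    intro F _ _ _ _ v hv h
    -- The induction hypothesis applied to this cofactor gives `‖y‖ ≤ C`.
    let y : ℂ → ℂ →L[ℝ] F := fun t =>
      ((m + 1 : ℕ) : ℂ) • σ.smulRight (v t) + σ (t - c) • fderivWithin ℝ v Δ t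
    have hder : ∀ t ∈ Δ, HasFDerivAt (fun t => σ (t - c) ^ (m + 1) • v t)
        (σ (t - c) ^ m • y t) t := by
      intro t ht
      refine hasFDerivAt_linear_pow_smul σ c m ?_
      rw [fderivWithin_of_isOpen hΔ ht]
      exact ((hv.contDiffAt (hΔ.mem_nhds ht)).differentiableAt (by simp)).hasFDerivAt
    have hq : ContDiff ℝ ∞ fun t => σ (t - c) := σ.contDiff.comp (contDiff_id.sub contDiff_const)
    have hy : ContDiffOn ℝ ∞ y Δ := by
      refine ContDiffOn.add ?_ (hq.contDiffOn.smul (hv.fderivWithin hΔ.uniqueDiffOn (by simp)))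
      have h1 := (((m + 1 : ℕ) : ℂ) • smulRightCLM (F := F) σ).contDiff
        (n := ∞) |>.comp_contDiffOn hv
      exact h1.congr fun t _ => by simp [smulRightCLM_apply]
    have hyC : ∀ t ∈ Δ, ‖y t‖ ≤ C := by
      refine ih hy fun t ht => ?_
      have := h t ht
      rw [← norm_iteratedFDerivWithin_fderivWithin hΔ.uniqueDiffOn ht] at this
      rwa [iteratedFDerivWithin_congr (fun t ht => by
        rw [fderivWithin_of_isOpen hΔ ht, (hder t ht).fderiv]) ht] at this
    have hne : ∀ t ∈ Δ, t ≠ c → ‖v t‖ ≤ C := by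
      intro t ht htc
      have hpos : 0 < ‖t - c‖ := norm_pos_iff.2 (sub_ne_zero.2 htc)
      have hseg := hc.segment_subset hcΔ ht
      -- Along the segment from `c` to `t` the derivative is at most `‖t - c‖^m C`, so the mean
      -- value inequality yields `‖t - c‖^(m+1) ‖v t‖ ≤ ‖t - c‖^(m+1) C`. The point `t = c` follows
      -- by continuity.
      have key := (convex_segment c t).norm_image_sub_le_of_norm_hasFDerivWithin_le
        (f := fun t => σ (t - c) ^ (m + 1) • v t) (f' := fun t => σ (t - c) ^ m • y t)
        (C := ‖t - c‖ ^ m * C) (fun x hx => (hder x (hseg hx)).hasFDerivWithinAt)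
        (fun x hx => ?_) (left_mem_segment ℝ c t) (right_mem_segment ℝ c t)
      · simp only [sub_self, map_zero, ne_eq, Nat.add_eq_zero_iff, one_ne_zero, and_false,
          not_false_eq_true, zero_pow, zero_smul, sub_zero, norm_smul, norm_pow, hσ] at key
        have h2 : ‖t - c‖ ^ (m + 1) * ‖v t‖ ≤ ‖t - c‖ ^ (m + 1) * C := by
          refine key.trans (le_of_eq ?_)
          ring
        exact le_of_mul_le_mul_left h2 (by positivity)
      · rw [norm_smul, norm_pow, hσ]
        have h3 : ‖x - c‖ ≤ ‖t - c‖ := by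
          obtain ⟨a, ha, rfl⟩ := (segment_eq_image' ℝ c t ▸ hx :
            x ∈ (fun θ : ℝ => c + θ • (t - c)) '' Icc 0 1)
          simp only [add_sub_cancel_left, norm_smul, Real.norm_eq_abs, abs_of_nonneg ha.1]
          exact mul_le_of_le_one_left (norm_nonneg _) ha.2
        gcongr
        exact hyC x (hseg hx)
    intro t ht
    by_cases htc : t = c
    · subst htc
      have hcont : ContinuousAt v t := hv.continuousOn.continuousAt (hΔ.mem_nhds ht)
      refine le_of_tendsto (hcont.norm.tendsto.mono_left (nhdsWithin_le_nhds (s := {t}ᶜ))) ?_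
      filter_upwards [self_mem_nhdsWithin, mem_nhdsWithin_of_mem_nhds (hΔ.mem_nhds ht)] with x hx hx'
      exact hne x hx' hx
    · exact hne t ht htc

/-- With `σ` the identity or conjugation and `q = σ (t - c s)`, one has `q^(N+1) Dv = q D(q^N v) - N
σ ⊗ (q^N v)`. So the hypothesis on `v` with power `N` passes to `Dv` with power `N + 1`; this is why
`N` is arbitrary, and each derivative reduces to a bound on values. -/
theorem iteratedFDerivWithin_bounded_of_smul {S : Type*} {r : ℝ} {σ : ℂ →L[ℝ] ℂ}
    (hσ : ∀ t, ‖σ t‖ = ‖t‖) {c : S → ℂ} (hcΔ : ∀ s, c s ∈ Metric.ball (0 : ℂ) r) (j : ℕ) :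
    ∀ {F : Type} [NormedAddCommGroup F] [NormedSpace ℝ F] [NormedSpace ℂ F] [IsScalarTower ℝ ℂ F]
      {v : S → ℂ → F} (N : ℕ), (∀ s, ContDiffOn ℝ ∞ (v s) (Metric.ball 0 r)) →
      SmoothlyBounded (Metric.ball 0 r) (fun s t => σ (t - c s) ^ N • v s t) →
      ∃ C, ∀ s, ∀ t ∈ Metric.ball 0 r, ‖iteratedFDerivWithin ℝ j (v s) (Metric.ball 0 r) t‖ ≤ C := by
  have hΔ := Metric.isOpen_ball (x := (0 : ℂ)) (ε := r)
  induction j with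
  | zero =>
    intro F _ _ _ _ v N hv hb
    obtain ⟨C, hC⟩ := hb.2 N
    refine ⟨C, fun s t ht => ?_⟩
    rw [norm_iteratedFDerivWithin_zero]
    exact norm_le_of_linear_pow_smul hΔ (convex_ball _ _) hσ (hcΔ s) N (hv s) (hC s) t ht
  | succ j ih =>
    intro F _ _ _ _ v N hv hb
    have hq : SmoothlyBounded (Metric.ball (0 : ℂ) r) fun s t => σ (t - c s) := by
      refine (smoothlyBounded_comp_affine hΔ (Ω := univ) (K := Metric.closedBall 0 (r + r))
        isOpen_univ (isCompact_closedBall _ _) (subset_univ _) (ContinuousLinearMap.id ℝ ℂ)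
        (z := fun s => -c s) (fun s t ht => ?_) (b := fun t => σ t) σ.contDiff.contDiffOn).congr
        fun s t _ => ?_
      · have h1 := hcΔ s
        rw [mem_ball_zero_iff] at h1 ht
        rw [mem_closedBall_zero_iff]
        refine (norm_add_le _ _).trans ?_
        rw [norm_neg]
        exact add_le_add h1.le ht.le
      · simp only [ContinuousLinearMap.id_apply]
        rw [neg_add_eq_sub]
    have hD : SmoothlyBounded (Metric.ball 0 r)
        (fun s t => σ (t - c s) ^ (N + 1) • fderivWithin ℝ (v s) (Metric.ball 0 r) t) := by
      have h1 := SmoothlyBounded.sub hΔ (SmoothlyBounded.smul hΔ hq (hb.fderivWithin hΔ))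
        (hb.clm_comp hΔ ((N : ℂ) • smulRightCLM (F := F) σ))
      refine h1.congr fun s t ht => ?_
      have hd : HasFDerivAt (v s) (fderivWithin ℝ (v s) (Metric.ball 0 r) t) t := by
        rw [fderivWithin_of_isOpen hΔ ht]
        exact (((hv s).contDiffAt (hΔ.mem_nhds ht)).differentiableAt (by simp)).hasFDerivAt
      cases N with
      | zero =>
        rw [fderivWithin_of_isOpen hΔ ht]
        simp [fderivWithin_of_isOpen hΔ ht]
      | succ N =>
        rw [fderivWithin_of_isOpen (f := fun t => σ (t - c s) ^ (N + 1) • v s t) hΔ ht,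
          (hasFDerivAt_linear_pow_smul σ (c s) N hd).fderiv]
        ext x
        simp only [smul_apply, sub_apply, add_apply, smulRightCLM_apply,
          ContinuousLinearMap.smulRight_apply, smul_add, smul_smul]
        rw [add_comm, eq_sub_iff_add_eq]
        ring_nf
        exact add_comm _ _
    obtain ⟨C, hC⟩ := ih (N + 1) (fun s => (hv s).fderivWithin hΔ.uniqueDiffOn (by simp)) hD
    refine ⟨C, fun s t ht => ?_⟩
    rw [← norm_iteratedFDerivWithin_fderivWithin hΔ.uniqueDiffOn ht]
    exact hC s t ht

/-- Division by a family of linear factors preserves smooth boundedness. -/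
theorem SmoothlyBounded.of_linear_smul {S : Type*} {r : ℝ} {σ : ℂ →L[ℝ] ℂ}
    (hσ : ∀ t, ‖σ t‖ = ‖t‖) {c : S → ℂ} (hcΔ : ∀ s, c s ∈ Metric.ball (0 : ℂ) r)
    {F : Type} [NormedAddCommGroup F] [NormedSpace ℝ F] [NormedSpace ℂ F] [IsScalarTower ℝ ℂ F]
    {v : S → ℂ → F} (hv : ∀ s, ContDiffOn ℝ ∞ (v s) (Metric.ball 0 r))
    (hb : SmoothlyBounded (Metric.ball 0 r) (fun s t => σ (t - c s) • v s t)) :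
    SmoothlyBounded (Metric.ball 0 r) v :=
  ⟨hv, fun j => iteratedFDerivWithin_bounded_of_smul hσ hcΔ j 1 hv (by simpa using hb)⟩

end Peeling

/-! ### Uniform division by holomorphic and anti-holomorphic functions on a disc -/

section HolomorphicDivision

open ComplexConjugate

/-- For `|c| < r` the factor `|t - c|` is at least `6 r` on the outer circle and at most `2 r` on
the inner one. Splitting off a zero therefore divides the ratio of the upper to the lower bound by
three. -/
theorem exists_split_zero {h : ℂ → ℂ} {r M δ : ℝ} (hr : 0 < r)
    (hd : DifferentiableOn ℂ h (Metric.ball 0 (8 * r))) (hM : ∀ t : ℂ, ‖t‖ = 7 * r → ‖h t‖ ≤ M)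
    (hδ : ∀ t : ℂ, ‖t‖ = r → δ ≤ ‖h t‖) {c : ℂ} (hc : c ∈ Metric.ball (0 : ℂ) r) (h0 : h c = 0) :
    ∃ h₁ : ℂ → ℂ, (∀ t, h t = (t - c) * h₁ t) ∧
      DifferentiableOn ℂ h₁ (Metric.ball 0 (8 * r)) ∧
      (∀ t : ℂ, ‖t‖ = 7 * r → ‖h₁ t‖ ≤ M / (6 * r)) ∧
      ∀ t : ℂ, ‖t‖ = r → δ / (2 * r) ≤ ‖h₁ t‖ := by
  have heq : ∀ t, h t = (t - c) * dslope h c t := fun t => by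
    have := sub_smul_dslope h c t
    rw [h0, sub_zero, smul_eq_mul] at this
    exact this.symm
  rw [mem_ball_zero_iff] at hc
  have hnhds : Metric.ball (0 : ℂ) (8 * r) ∈ 𝓝 c :=
    Metric.isOpen_ball.mem_nhds (by rw [mem_ball_zero_iff]; linarith)
  refine ⟨dslope h c, heq, (Complex.differentiableOn_dslope hnhds).2 hd, fun t ht => ?_,
    fun t ht => ?_⟩
  · have h1 := hM t ht
    have h2 : 6 * r ≤ ‖t - c‖ := by
      have := norm_sub_norm_le t c
      linarith
    rw [heq, norm_mul] at h1
    rw [le_div_iff₀ (by positivity)]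
    calc ‖dslope h c t‖ * (6 * r) ≤ ‖dslope h c t‖ * ‖t - c‖ := by gcongr
      _ ≤ M := by rwa [mul_comm]
  · have h1 := hδ t ht
    have h2 : ‖t - c‖ ≤ 2 * r := by
      have := norm_sub_le t c
      linarith
    rw [heq, norm_mul] at h1
    rw [div_le_iff₀ (by positivity)]
    calc δ ≤ ‖t - c‖ * ‖dslope h c t‖ := h1
      _ ≤ 2 * r * ‖dslope h c t‖ := by gcongr
      _ = ‖dslope h c t‖ * (2 * r) := mul_comm _ _

/-- By the maximum principle the ratio `M / δ` cannot fall below one, which limits the number of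
zeros that can be split off. -/
theorem lower_le_upper {h : ℂ → ℂ} {r M δ : ℝ} (hr : 0 < r)
    (hd : DifferentiableOn ℂ h (Metric.ball 0 (8 * r))) (hM : ∀ t : ℂ, ‖t‖ = 7 * r → ‖h t‖ ≤ M)
    (hδ : ∀ t : ℂ, ‖t‖ = r → δ ≤ ‖h t‖) : δ ≤ M := by
  have hdc : DiffContOnCl ℂ h (Metric.ball 0 (7 * r)) := by
    refine DifferentiableOn.diffContOnCl (hd.mono ?_)
    rw [closure_ball _ (by positivity)]
    exact Metric.closedBall_subset_ball (by linarith)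
  have hnorm : ‖(r : ℂ)‖ = r := by
    rw [Complex.norm_real, Real.norm_eq_abs, abs_of_pos hr]
  refine (hδ r hnorm).trans ?_
  refine Complex.norm_le_of_forall_mem_frontier_norm_le Metric.isBounded_ball hdc (fun t ht => ?_) ?_
  · rw [frontier_ball _ (by positivity), mem_sphere_zero_iff_norm] at ht
    exact hM t ht
  · rw [closure_ball _ (by positivity), mem_closedBall_zero_iff, hnorm]
    linarith

theorem div_lt_of_lt_two_pow_succ {r M δ : ℝ} (hr : 0 < r) (hδ : 0 < δ) {n : ℕ}
    (h : M < 2 ^ (n + 1) * δ) : M / (6 * r) < 2 ^ n * (δ / (2 * r)) := by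
  have hpos : 0 < 2 ^ n * δ := by positivity
  have h1 : 2 ^ n * (δ / (2 * r)) = 3 * (2 ^ n * δ) / (6 * r) := by
    field_simp
    norm_num
  rw [h1, div_lt_div_iff_of_pos_right (by positivity)]
  rw [pow_succ] at h
  linarith

theorem SmoothlyBounded.comp_index {S T : Type*} {Δ : Set ℂ} {F : Type*} [NormedAddCommGroup F]
    [NormedSpace ℝ F] {v : S → ℂ → F} (hv : SmoothlyBounded Δ v) (e : T → S) :
    SmoothlyBounded Δ fun t => v (e t) :=
  ⟨fun t => hv.1 (e t), fun j => (hv.2 j).imp fun _ hC t => hC (e t)⟩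

/-- Uniform division by holomorphic and anti-holomorphic functions of one variable. -/
theorem bounded_of_holomorphic_smul {F : Type} [NormedAddCommGroup F] [NormedSpace ℝ F]
    [NormedSpace ℂ F] [IsScalarTower ℝ ℂ F] {r : ℝ} (hr : 0 < r) (N : ℕ) :
    ∀ {S : Type} {h g : S → ℂ → ℂ} {v : S → ℂ → F} {M δ M' δ' : ℝ} {n n' : ℕ}, n + n' = N →
      0 < δ → 0 < δ' → M < 2 ^ n * δ → M' < 2 ^ n' * δ' →
      (∀ s, DifferentiableOn ℂ (h s) (Metric.ball 0 (8 * r))) →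
      (∀ s, DifferentiableOn ℂ (g s) (Metric.ball 0 (8 * r))) →
      (∀ s, ∀ t : ℂ, ‖t‖ = 7 * r → ‖h s t‖ ≤ M) → (∀ s, ∀ t : ℂ, ‖t‖ = 7 * r → ‖g s t‖ ≤ M') →
      (∀ s, ∀ t : ℂ, ‖t‖ = r → δ ≤ ‖h s t‖) → (∀ s, ∀ t : ℂ, ‖t‖ = r → δ' ≤ ‖g s t‖) →
      (∀ s, ContDiffOn ℝ ∞ (v s) (Metric.ball 0 r)) →
      SmoothlyBounded (Metric.ball 0 r) (fun s t => (h s t * conj (g s t)) • v s t) →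
      ∃ C, ∀ s, ∀ t ∈ Metric.ball (0 : ℂ) r, ‖v s t‖ ≤ C := by
  have hsub : Metric.ball (0 : ℂ) r ⊆ Metric.ball 0 (8 * r) :=
    Metric.ball_subset_ball (by linarith)
  have hreal : ∀ {f : ℂ → ℂ}, DifferentiableOn ℂ f (Metric.ball 0 (8 * r)) →
      ContDiffOn ℝ ∞ f (Metric.ball 0 r) := fun hf =>
    ((hf.contDiffOn (n := ∞) Metric.isOpen_ball).restrict_scalars ℝ).mono hsub
  -- `n` and `n'` bound the numbers of zeros of `h s` and `g s` that can still be removed. The index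
  -- type is quantified inside, since the induction step passes to subfamilies.
  induction N with
  | zero =>
    intro S h g v M δ M' δ' n n' hn hδ hδ' hM hM' hh hg hhM hgM hhδ hgδ hv hb
    have hn0 : n = 0 := by omega
    rw [hn0, pow_zero, one_mul] at hM
    -- Here `M < δ`, so the family is empty and the bound is vacuous.
    exact ⟨0, fun s => absurd (lower_le_upper hr (hh s) (hhM s) (hhδ s)) (not_le.2 hM)⟩
  | succ N ih =>
    intro S h g v M δ M' δ' n n' hn hδ hδ' hM hM' hh hg hhM hgM hhδ hgδ hv hb
    rcases Nat.eq_zero_or_pos n with hn0 | hnpos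
    · rw [hn0, pow_zero, one_mul] at hM
      exact ⟨0, fun s => absurd (lower_le_upper hr (hh s) (hhM s) (hhδ s)) (not_le.2 hM)⟩
    rcases Nat.eq_zero_or_pos n' with hn0 | hnpos'
    · rw [hn0, pow_zero, one_mul] at hM'
      exact ⟨0, fun s => absurd (lower_le_upper hr (hg s) (hgM s) (hgδ s)) (not_le.2 hM')⟩
    obtain ⟨m, rfl⟩ : ∃ m, n = m + 1 := ⟨n - 1, by omega⟩
    obtain ⟨m', rfl⟩ : ∃ m', n' = m' + 1 := ⟨n' - 1, by omega⟩
    -- Treat together all indices for which `h s` has a zero in the disc: move one linear factor out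
    -- of each `h s`, and remove it from the boundedness hypothesis by
    -- `SmoothlyBounded.of_linear_smul`.
    obtain ⟨C₁, hC₁⟩ : ∃ C, ∀ s : {s : S // ∃ c ∈ Metric.ball (0 : ℂ) r, h s c = 0},
        ∀ t ∈ Metric.ball (0 : ℂ) r, ‖v s t‖ ≤ C := by
      choose c hc hc0 using fun s : {s : S // ∃ c ∈ Metric.ball (0 : ℂ) r, h s c = 0} => s.2
      choose h₁ he hd hu hl using fun s : {s : S // ∃ c ∈ Metric.ball (0 : ℂ) r, h s c = 0} =>
        exists_split_zero hr (hh s) (hhM s) (hhδ s) (hc s) (hc0 s)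
      refine ih (h := h₁) (g := fun s => g s) (n := m) (n' := m' + 1) (by omega)
        (by positivity) hδ' (div_lt_of_lt_two_pow_succ hr hδ hM) hM' hd (fun s => hg s) hu
        (fun s => hgM s) hl (fun s => hgδ s) (fun s => hv s) ?_
      refine SmoothlyBounded.of_linear_smul (σ := ContinuousLinearMap.id ℝ ℂ) (fun _ => rfl) hc
        (fun s => ((hreal (hd s)).mul (Complex.conjCLE.contDiff.comp_contDiffOn
          (hreal (hg s)))).smul (hv s)) ((hb.comp_index Subtype.val).congr fun s t _ => ?_)
      simp only [ContinuousLinearMap.id_apply, smul_smul, he s t, mul_assoc]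
    obtain ⟨C₂, hC₂⟩ : ∃ C, ∀ s : {s : S // ∃ c ∈ Metric.ball (0 : ℂ) r, g s c = 0},
        ∀ t ∈ Metric.ball (0 : ℂ) r, ‖v s t‖ ≤ C := by
      choose c hc hc0 using fun s : {s : S // ∃ c ∈ Metric.ball (0 : ℂ) r, g s c = 0} => s.2
      choose g₁ he hd hu hl using fun s : {s : S // ∃ c ∈ Metric.ball (0 : ℂ) r, g s c = 0} =>
        exists_split_zero hr (hg s) (hgM s) (hgδ s) (hc s) (hc0 s)
      refine ih (S := {s : S // ∃ c ∈ Metric.ball (0 : ℂ) r, g s c = 0}) (g := g₁) (h := fun s => h s) (n := m + 1) (n' := m') (by omega)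
        hδ (by positivity) hM (div_lt_of_lt_two_pow_succ hr hδ' hM') (fun s => hh s) hd
        (fun s => hhM s) hu (fun s => hhδ s) hl (fun s => hv s) ?_
      refine SmoothlyBounded.of_linear_smul (σ := Complex.conjCLE.toContinuousLinearMap)
        (fun t => RCLike.norm_conj t) hc
        (fun s => ((hreal (hh s)).mul (Complex.conjCLE.contDiff.comp_contDiffOn
          (hreal (hd s)))).smul (hv s)) ((hb.comp_index Subtype.val).congr fun s t _ => ?_)
      simp only [ContinuousLinearEquiv.coe_coe, Complex.conjCLE_apply, smul_smul, he s t, map_mul]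
      congr 1
      ring
    -- For the remaining indices neither function has a zero in the disc, and the minimum principle
    -- bounds `|h s|` by `δ` and `|g s|` by `δ'` from below.
    obtain ⟨C₃, hC₃⟩ := hb.bounded
    refine ⟨max (max C₁ C₂) (C₃ / (δ * δ')), fun s t ht => ?_⟩
    by_cases h1 : ∃ c ∈ Metric.ball (0 : ℂ) r, h s c = 0
    · exact (hC₁ ⟨s, h1⟩ t ht).trans ((le_max_left _ _).trans (le_max_left _ _))
    by_cases h2 : ∃ c ∈ Metric.ball (0 : ℂ) r, g s c = 0
    · exact (hC₂ ⟨s, h2⟩ t ht).trans ((le_max_right _ _).trans (le_max_left _ _))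
    refine le_trans ?_ (le_max_right _ _)
    have hcb : Metric.closedBall (0 : ℂ) r ⊆ Metric.ball 0 (8 * r) :=
      Metric.closedBall_subset_ball (by linarith)
    have htr : ‖t‖ ≤ r := (mem_ball_zero_iff.1 ht).le
    have e1 := le_norm_of_forall_sphere (hh s) hr hcb hδ (hhδ s)
      (fun t ht h0 => h1 ⟨t, mem_ball_zero_iff.2 ht, h0⟩) htr
    have e2 := le_norm_of_forall_sphere (hg s) hr hcb hδ' (hgδ s)
      (fun t ht h0 => h2 ⟨t, mem_ball_zero_iff.2 ht, h0⟩) htr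
    have e3 := hC₃ s t ht
    rw [norm_smul, norm_mul, RCLike.norm_conj] at e3
    rw [le_div_iff₀ (by positivity)]
    calc ‖v s t‖ * (δ * δ') ≤ ‖v s t‖ * (‖h s t‖ * ‖g s t‖) := by gcongr
      _ ≤ C₃ := by rwa [mul_comm]

end HolomorphicDivision

/-! ### Smooth extension across the zeros of a holomorphic function -/

section SmoothExtension

open ComplexConjugate

variable {d : ℕ}

/-- The mean value inequality on the complement of the zeros of a holomorphic function in a
convex open set. -/
theorem norm_sub_le_off_zeros {W : Set (CSpace d)} (hW : IsOpen W) (hWc : Convex ℝ W)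
    {h : CSpace d → ℂ} (hh : DifferentiableOn ℂ h W) {F : Type*} [NormedAddCommGroup F]
    [NormedSpace ℝ F] {Φ : CSpace d → F} {Λ : CSpace d →L[ℝ] F} {C : ℝ}
    (hd : ∀ z ∈ W, h z ≠ 0 → DifferentiableAt ℝ Φ z)
    (hb : ∀ z ∈ W, h z ≠ 0 → ‖fderiv ℝ Φ z - Λ‖ ≤ C) {p q : CSpace d} (hp : p ∈ W) (hq : q ∈ W)
    (hhp : h p ≠ 0) (hhq : h q ≠ 0) : ‖Φ q - Φ p - Λ (q - p)‖ ≤ C * ‖q - p‖ := by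
  set w := q - p with hw
  obtain ⟨ho, hφ⟩ := differentiableOn_line hW hh p w
  have hpre := isPreconnected_line hWc p w
  have hmem : ∀ x ∈ Icc (0 : ℝ) 1, (x : ℂ) ∈ {t : ℂ | p + t • w ∈ W} := by
    intro x hx
    have := hWc hp hq (sub_nonneg.2 hx.2) hx.1 (sub_add_cancel 1 x)
    rw [mem_ofPred_eq]
    convert this using 1
    rw [hw, Complex.coe_smul, smul_sub, sub_smul, one_smul]
    abel
  -- In the complex line through `p` and `q` the zeros of `h` are isolated. Translating the real
  -- segment by `s i w` with `s ≠ 0` small moves it off them; the inequality holds on the translated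
  -- segments, and then `s` tends to `0`.
  have hev : ∀ᶠ (s : ℝ) in 𝓝 (0 : ℝ), ∀ x ∈ Icc (0 : ℝ) 1,
      p + ((x : ℂ) + (s : ℂ) * Complex.I) • w ∈ W ∧
        (s ≠ 0 → h (p + ((x : ℂ) + (s : ℂ) * Complex.I) • w) ≠ 0) := by
    refine isCompact_Icc.eventually_forall_of_forall_eventually fun x hx => ?_
    have hcont : Tendsto (fun y : ℝ × ℝ => (y.2 : ℂ) + y.1 * Complex.I) (𝓝 (0, x)) (𝓝 (x : ℂ)) := by
      have : Continuous fun y : ℝ × ℝ => (y.2 : ℂ) + y.1 * Complex.I := by fun_prop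
      simpa using this.tendsto (0, x)
    have hne : ∀ᶠ t in 𝓝[≠] (x : ℂ), h (p + t • w) ≠ 0 := by
      rcases (hφ.analyticAt (ho.mem_nhds (hmem x hx))).eventually_eq_zero_or_eventually_ne_zero
        with h1 | h1
      · refine absurd ?_ hhp
        have := (hφ.analyticOnNhd ho).eqOn_zero_of_preconnected_of_eventuallyEq_zero hpre
          (hmem x hx) h1 (show (0 : ℂ) ∈ {t : ℂ | p + t • w ∈ W} by simpa using hp)
        simpa using this
      · exact h1
    rw [eventually_nhdsWithin_iff] at hne
    have hin : ∀ᶠ y : ℝ × ℝ in 𝓝 (0, x), p + ((y.2 : ℂ) + y.1 * Complex.I) • w ∈ W :=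
      hcont.eventually (ho.mem_nhds (hmem x hx))
    filter_upwards [hcont.eventually hne, hin] with y h1 h2
    refine ⟨h2, fun hy => h1 ?_⟩
    rw [mem_compl_singleton_iff]
    intro h3
    have := congrArg Complex.im h3
    simp at this
    exact hy this
  have hle : ∀ᶠ (s : ℝ) in 𝓝[≠] (0 : ℝ), ‖Φ (q + ((s : ℂ) * Complex.I) • w) -
      Φ (p + ((s : ℂ) * Complex.I) • w) - Λ w‖ ≤ C * ‖w‖ := by
    filter_upwards [mem_nhdsWithin_of_mem_nhds hev, self_mem_nhdsWithin] with s hs hs0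
    have hseg : ∀ z ∈ segment ℝ (p + ((s : ℂ) * Complex.I) • w) (q + ((s : ℂ) * Complex.I) • w),
        z ∈ W ∧ h z ≠ 0 := by
      intro z hz
      rw [segment_eq_image'] at hz
      obtain ⟨x, hx, rfl⟩ := hz
      have h1 := hs x hx
      have h2 : p + ((s : ℂ) * Complex.I) • w + x • (q + ((s : ℂ) * Complex.I) • w -
          (p + ((s : ℂ) * Complex.I) • w)) = p + ((x : ℂ) + s * Complex.I) • w := by
        rw [add_sub_add_right_eq_sub, ← hw, add_smul, Complex.coe_smul]
        abel
      beta_reduce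
      rw [h2]
      exact ⟨h1.1, h1.2 hs0⟩
    have key := (convex_segment (𝕜 := ℝ) (p + ((s : ℂ) * Complex.I) • w)
      (q + ((s : ℂ) * Complex.I) • w)).norm_image_sub_le_of_norm_hasFDerivWithin_le'
      (f := Φ) (f' := fderiv ℝ Φ) (φ := Λ) (C := C)
      (fun z hz => ((hd z (hseg z hz).1 (hseg z hz).2).hasFDerivAt).hasFDerivWithinAt)
      (fun z hz => hb z (hseg z hz).1 (hseg z hz).2)
      (left_mem_segment ℝ _ _) (right_mem_segment ℝ _ _)
    rwa [add_sub_add_right_eq_sub] at key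
  have hlim : ∀ z, DifferentiableAt ℝ Φ z →
      Tendsto (fun s : ℝ => Φ (z + ((s : ℂ) * Complex.I) • w)) (𝓝[≠] 0) (𝓝 (Φ z)) := by
    intro z hz
    have h1 : Tendsto (fun s : ℝ => z + ((s : ℂ) * Complex.I) • w) (𝓝 0) (𝓝 z) := by
      have : Continuous fun s : ℝ => z + ((s : ℂ) * Complex.I) • w := by fun_prop
      simpa using this.tendsto 0
    exact (hz.continuousAt.tendsto.comp h1).mono_left nhdsWithin_le_nhds
  exact le_of_tendsto (((hlim q (hd q hq hhq)).sub (hlim p (hd p hp hhp))).sub_const (Λ w)).norm hle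

/-- The functions in `W` off the zeros of `h` to which the extension theorem applies: a class of
smooth functions with bounded values, closed under taking derivatives. -/
structure IsBoundedClass (W : Set (CSpace d)) (h : CSpace d → ℂ)
    (P : ∀ {F : Type} [NormedAddCommGroup F] [NormedSpace ℝ F] [NormedSpace ℂ F]
      [IsScalarTower ℝ ℂ F], (CSpace d → F) → Prop) : Prop where
  differentiableAt : ∀ {F : Type} [NormedAddCommGroup F] [NormedSpace ℝ F] [NormedSpace ℂ F]
    [IsScalarTower ℝ ℂ F] {Φ : CSpace d → F}, P Φ → ∀ z ∈ W, h z ≠ 0 → DifferentiableAt ℝ Φ z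
  bounded : ∀ {F : Type} [NormedAddCommGroup F] [NormedSpace ℝ F] [NormedSpace ℂ F]
    [IsScalarTower ℝ ℂ F] {Φ : CSpace d → F}, P Φ → ∃ C, ∀ z ∈ W, h z ≠ 0 → ‖Φ z‖ ≤ C
  fderiv : ∀ {F : Type} [NormedAddCommGroup F] [NormedSpace ℝ F] [NormedSpace ℂ F]
    [IsScalarTower ℝ ℂ F] {Φ : CSpace d → F}, P Φ → P (_root_.fderiv ℝ Φ)

section

variable {W : Set (CSpace d)} {h : CSpace d → ℂ}
  {P : ∀ {F : Type} [NormedAddCommGroup F] [NormedSpace ℝ F] [NormedSpace ℂ F]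
      [IsScalarTower ℝ ℂ F], (CSpace d → F) → Prop}
  {F : Type} [NormedAddCommGroup F] [NormedSpace ℝ F] [NormedSpace ℂ F]
  [IsScalarTower ℝ ℂ F] {Φ : CSpace d → F}

theorem neBot_nhdsWithin_ne_zero (hW : IsOpen W) (hdense : ∀ p ∈ W, ∃ᶠ z in 𝓝 p, h z ≠ 0)
    {p : CSpace d} (hp : p ∈ W) : (𝓝[W ∩ {z | h z ≠ 0}] p).NeBot := by
  rw [inter_comm, nhdsWithin_inter_of_mem' (mem_nhdsWithin_of_mem_nhds (hW.mem_nhds hp))]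
  exact frequently_mem_iff_neBot.1 (hdense p hp)

/-- A bounded derivative makes `Φ` Lipschitz off the zeros, hence Cauchy at each point of the zero
set. -/
theorem IsBoundedClass.tendsto_extendFrom (hP : IsBoundedClass W h @P) (hW : IsOpen W)
    (hWc : Convex ℝ W) (hh : DifferentiableOn ℂ h W) (hdense : ∀ p ∈ W, ∃ᶠ z in 𝓝 p, h z ≠ 0)
    [CompleteSpace F] (hΦ : P Φ) {p : CSpace d} (hp : p ∈ W) :
    Tendsto Φ (𝓝[W ∩ {z | h z ≠ 0}] p) (𝓝 (extendFrom (W ∩ {z | h z ≠ 0}) Φ p)) := by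
  obtain ⟨C, hC⟩ := hP.bounded (hP.fderiv hΦ)
  have hlip : LipschitzOnWith C.toNNReal Φ (W ∩ {z | h z ≠ 0}) := by
    refine LipschitzOnWith.of_dist_le_mul fun x hx y hy => ?_
    rw [dist_eq_norm, dist_eq_norm]
    have := norm_sub_le_off_zeros hW hWc hh (Λ := 0) (hP.differentiableAt hΦ)
      (fun z hz hz' => by simpa using hC z hz hz') hy.1 hx.1 hy.2 hx.2
    simp only [zero_apply, sub_zero] at this
    exact this.trans (mul_le_mul_of_nonneg_right (Real.le_coe_toNNReal C) (norm_nonneg _))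
  have hne := neBot_nhdsWithin_ne_zero hW hdense hp
  refine _root_.tendsto_extendFrom ?_
  have hc : Cauchy (map Φ (𝓝[W ∩ {z | h z ≠ 0}] p)) := by
    refine Cauchy.map_of_le (s := W ∩ {z | h z ≠ 0}) (cauchy_nhds.mono nhdsWithin_le_nhds)
      hlip.uniformContinuousOn ?_
    exact le_principal_iff.2 self_mem_nhdsWithin
  exact CompleteSpace.complete hc

/-- The derivative itself has a limit `Λ` at `p`. Near `p` the mean value inequality for `Φ - Λ` has
constant `ε`; letting both end points approach, one `y` and the other `p`, gives differentiability
of the extension. -/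
theorem IsBoundedClass.hasFDerivAt_extendFrom (hP : IsBoundedClass W h @P) (hW : IsOpen W)
    (hWc : Convex ℝ W) (hh : DifferentiableOn ℂ h W) (hdense : ∀ p ∈ W, ∃ᶠ z in 𝓝 p, h z ≠ 0)
    [CompleteSpace F] (hΦ : P Φ) {p : CSpace d} (hp : p ∈ W) :
    HasFDerivAt (extendFrom (W ∩ {z | h z ≠ 0}) Φ)
      (extendFrom (W ∩ {z | h z ≠ 0}) (_root_.fderiv ℝ Φ) p) p := by
  set E₀ := W ∩ {z | h z ≠ 0} with hE₀
  set Λ := extendFrom E₀ (_root_.fderiv ℝ Φ) p with hΛ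
  have hlim := hP.tendsto_extendFrom hW hWc hh hdense (hP.fderiv hΦ) hp
  rw [hasFDerivAt_iff_isLittleO, Asymptotics.isLittleO_iff]
  intro ε hε
  have h1 : ∀ᶠ z in 𝓝[E₀] p, ‖_root_.fderiv ℝ Φ z - Λ‖ ≤ ε := by
    filter_upwards [hlim.eventually (Metric.ball_mem_nhds Λ hε)] with z hz
    rw [dist_eq_norm] at hz
    exact hz.le
  rw [eventually_nhdsWithin_iff] at h1
  obtain ⟨η, hη, hball⟩ := Metric.eventually_nhds_iff_ball.1
    (h1.and (hW.mem_nhds hp : ∀ᶠ z in 𝓝 p, z ∈ W))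
  filter_upwards [Metric.ball_mem_nhds p hη] with y hy
  have hyW : y ∈ W := (hball y hy).2
  have hkey : ∀ a ∈ E₀ ∩ Metric.ball p η, ∀ b ∈ E₀ ∩ Metric.ball p η,
      ‖Φ b - Φ a - Λ (b - a)‖ ≤ ε * ‖b - a‖ := by
    intro a ha b hb
    refine norm_sub_le_off_zeros (W := W ∩ Metric.ball p η) (hW.inter Metric.isOpen_ball)
      (hWc.inter (convex_ball p η)) (hh.mono inter_subset_left)
      (fun z hz hz' => hP.differentiableAt hΦ z hz.1 hz')
      (fun z hz hz' => (hball z hz.2).1 ⟨hz.1, hz'⟩) ⟨ha.1.1, ha.2⟩ ⟨hb.1.1, hb.2⟩ ha.1.2 hb.1.2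
  have hney := neBot_nhdsWithin_ne_zero hW hdense hyW
  have hnep := neBot_nhdsWithin_ne_zero hW hdense hp
  have ty := hP.tendsto_extendFrom hW hWc hh hdense hΦ hyW
  have tp := hP.tendsto_extendFrom hW hWc hh hdense hΦ hp
  have iy : Tendsto (fun z : CSpace d => z) (𝓝[E₀] y) (𝓝 y) := tendsto_id.mono_left nhdsWithin_le_nhds
  have ip : Tendsto (fun z : CSpace d => z) (𝓝[E₀] p) (𝓝 p) := tendsto_id.mono_left nhdsWithin_le_nhds
  have hstep : ∀ a ∈ E₀ ∩ Metric.ball p η,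
      ‖extendFrom E₀ Φ y - Φ a - Λ (y - a)‖ ≤ ε * ‖y - a‖ := by
    intro a ha
    refine le_of_tendsto_of_tendsto (b := 𝓝[E₀] y)
      (((ty.sub_const (Φ a)).sub ((Λ.continuous.tendsto _).comp (iy.sub_const a))).norm)
      ((iy.sub_const a).norm.const_mul ε) ?_
    filter_upwards [self_mem_nhdsWithin,
      mem_nhdsWithin_of_mem_nhds (Metric.isOpen_ball.mem_nhds hy)] with b hb hb'
    exact hkey a ha b ⟨hb, hb'⟩
  refine le_of_tendsto_of_tendsto (b := 𝓝[E₀] p)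
      (((tendsto_const_nhds.sub tp).sub ((Λ.continuous.tendsto _).comp
        (tendsto_const_nhds.sub ip))).norm)
      ((tendsto_const_nhds.sub ip).norm.const_mul ε) ?_
  filter_upwards [self_mem_nhdsWithin,
      mem_nhdsWithin_of_mem_nhds (Metric.ball_mem_nhds p hη)] with a ha ha'
  exact hstep a ⟨ha, ha'⟩

/-- The derivative of the extension is the extension of the derivative, which belongs to the class
again. -/
theorem IsBoundedClass.contDiffOn_extendFrom (hP : IsBoundedClass W h @P) (hW : IsOpen W)
    (hWc : Convex ℝ W) (hh : DifferentiableOn ℂ h W) (hdense : ∀ p ∈ W, ∃ᶠ z in 𝓝 p, h z ≠ 0)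
    (n : ℕ) : ∀ {F : Type} [NormedAddCommGroup F] [NormedSpace ℝ F] [NormedSpace ℂ F]
      [IsScalarTower ℝ ℂ F] [CompleteSpace F] {Φ : CSpace d → F}, P Φ →
      ContDiffOn ℝ n (extendFrom (W ∩ {z | h z ≠ 0}) Φ) W := by
  induction n with
  | zero =>
    intro F _ _ _ _ _ Φ hΦ
    exact contDiffOn_zero.2 fun z hz =>
      (hP.hasFDerivAt_extendFrom hW hWc hh hdense hΦ hz).continuousAt.continuousWithinAt
  | succ n ih =>
    intro F _ _ _ _ _ Φ hΦ
    have hd := fun z hz => hP.hasFDerivAt_extendFrom hW hWc hh hdense hΦ (p := z) hz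
    push_cast
    rw [contDiffOn_succ_iff_fderiv_of_isOpen hW]
    exact ⟨fun z hz => (hd z hz).differentiableAt.differentiableWithinAt, by simp,
      (ih (hP.fderiv hΦ)).congr fun z hz => (hd z hz).fderiv⟩

end

end SmoothExtension

/-! ### Replacing holomorphic denominators by monomials -/

section Clearing

open ComplexConjugate

variable {d : ℕ} {ρ : ℝ} {A : Finset (Fin d)} {f g : CSpace d → ℂ}

/-- The points of the ball which lie off the coordinate hyperplanes or off the zeros of `f g`. -/
def smoothLocus (ρ : ℝ) (A : Finset (Fin d)) (f g : CSpace d → ℂ) : Set (CSpace d) :=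
  {z | z ∈ Metric.ball 0 ρ ∧ (f z * g z ≠ 0 ∨ ∀ j ∈ A, z j ≠ 0)}

theorem isOpen_smoothLocus (hf : ContinuousOn f (Metric.ball 0 ρ))
    (hg : ContinuousOn g (Metric.ball 0 ρ)) : IsOpen (smoothLocus ρ A f g) := by
  have h1 : IsOpen (Metric.ball (0 : CSpace d) ρ ∩ (fun z => f z * g z) ⁻¹' {0}ᶜ) :=
    (hf.mul hg).isOpen_inter_preimage Metric.isOpen_ball isOpen_compl_singleton
  have h2 : IsOpen (Metric.ball (0 : CSpace d) ρ ∩ ⋂ j ∈ A, {z | z j ≠ 0}) :=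
    Metric.isOpen_ball.inter (isOpen_biInter_finset fun j _ =>
      isOpen_ne_fun (continuous_apply j) continuous_const)
  convert h1.union h2 using 1
  ext z
  simp only [smoothLocus, mem_ofPred_eq, mem_union, mem_inter_iff, mem_preimage, mem_compl_iff,
    mem_singleton_iff, mem_iInter]
  tauto

/-- The smooth functions on the smooth locus of which some multiple by a power of `f ḡ` extends
smoothly to the ball. -/
def IsQuotientClass (ρ : ℝ) (A : Finset (Fin d)) (f g : CSpace d → ℂ) {F : Type}
    [NormedAddCommGroup F] [NormedSpace ℝ F] [NormedSpace ℂ F] [IsScalarTower ℝ ℂ F]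
    (Θ : CSpace d → F) : Prop :=
  ContDiffOn ℝ ∞ Θ (smoothLocus ρ A f g) ∧ ∃ (N : ℕ) (b : CSpace d → F),
    ContDiffOn ℝ ∞ b (Metric.ball 0 ρ) ∧
      ∀ z ∈ smoothLocus ρ A f g, (f z * conj (g z)) ^ N • Θ z = b z

theorem contDiffOn_mul_conj (hf : ContDiffOn ℂ ∞ f (Metric.ball 0 ρ))
    (hg : ContDiffOn ℂ ∞ g (Metric.ball 0 ρ)) :
    ContDiffOn ℝ ∞ (fun z => f z * conj (g z)) (Metric.ball 0 ρ) :=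
  (hf.restrict_scalars ℝ).mul
    ((Complex.conjCLE : ℂ →L[ℝ] ℂ).contDiff.comp_contDiffOn (hg.restrict_scalars ℝ))

theorem isBoundedBilinearMap_smulRight {E F : Type*} [NormedAddCommGroup E] [NormedSpace ℝ E]
    [NormedAddCommGroup F] [NormedSpace ℝ F] [NormedSpace ℂ F] [IsScalarTower ℝ ℂ F] :
    IsBoundedBilinearMap ℝ fun p : (E →L[ℝ] ℂ) × F => p.1.smulRight p.2 where
  add_left c c' w := by ext; simp [add_smul]
  smul_left r c w := by
    ext x
    simp only [ContinuousLinearMap.smulRight_apply, smul_apply]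
    exact smul_assoc _ _ _
  add_right c w w' := by ext; simp
  smul_right r c w := by
    ext x
    simp only [ContinuousLinearMap.smulRight_apply, smul_apply]
    exact smul_comm _ _ _
  bound := ⟨1, one_pos, fun c w => by
    rw [one_mul]
    refine ContinuousLinearMap.opNorm_le_bound _ (by positivity) fun x => ?_
    rw [ContinuousLinearMap.smulRight_apply, norm_smul]
    calc _ ≤ ‖c‖ * ‖x‖ * ‖w‖ := by gcongr; exact c.le_opNorm x
      _ = _ := by ring⟩

/-- With `q = f ḡ` and `b = q^N Θ`, the product rule gives `q^(N+1) DΘ = q Db - N Dq ⊗ b`, whose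
right side is smooth on the ball. -/
theorem IsQuotientClass.fderiv (hf : ContDiffOn ℂ ∞ f (Metric.ball 0 ρ))
    (hg : ContDiffOn ℂ ∞ g (Metric.ball 0 ρ)) {F : Type} [NormedAddCommGroup F] [NormedSpace ℝ F]
    [NormedSpace ℂ F] [IsScalarTower ℝ ℂ F] {Θ : CSpace d → F} (h : IsQuotientClass ρ A f g Θ) :
    IsQuotientClass ρ A f g (_root_.fderiv ℝ Θ) := by
  obtain ⟨hΘ, N, b, hb, hN⟩ := h
  have hG : IsOpen (smoothLocus ρ A f g) := isOpen_smoothLocus hf.continuousOn hg.continuousOn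
  have hq := contDiffOn_mul_conj hf hg
  set q : CSpace d → ℂ := fun z => f z * conj (g z) with hqdef
  have hB : IsOpen (Metric.ball (0 : CSpace d) ρ) := Metric.isOpen_ball
  refine ⟨hΘ.fderiv_of_isOpen hG (by simp), N + 1, fun z => q z • _root_.fderiv ℝ b z -
    (N : ℂ) • (_root_.fderiv ℝ q z).smulRight (b z), ?_, ?_⟩
  · refine (hq.smul (hb.fderiv_of_isOpen hB (by simp))).sub
      (ContDiffOn.const_smul (N : ℂ) ?_)
    exact isBoundedBilinearMap_smulRight.contDiff.comp_contDiffOn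
      ((hq.fderiv_of_isOpen hB (by simp)).prodMk hb)
  · intro z hz
    have hΘz : HasFDerivAt Θ (_root_.fderiv ℝ Θ z) z :=
      ((hΘ.contDiffAt (hG.mem_nhds hz)).differentiableAt (by simp)).hasFDerivAt
    have hqz : HasFDerivAt q (_root_.fderiv ℝ q z) z :=
      ((hq.contDiffAt (hB.mem_nhds hz.1)).differentiableAt (by simp)).hasFDerivAt
    have hbz : HasFDerivAt b (_root_.fderiv ℝ b z) z :=
      ((hb.contDiffAt (hB.mem_nhds hz.1)).differentiableAt (by simp)).hasFDerivAt
    have h1 := ((hqz.pow N).smul hΘz).congr_of_eventuallyEq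
      (f₁ := b) (by filter_upwards [hG.mem_nhds hz] with w hw using (hN w hw).symm)
    have h2 := hbz.unique h1
    show q z ^ (N + 1) • _root_.fderiv ℝ Θ z = q z • _root_.fderiv ℝ b z - _
    rw [h2, ← hN z hz]
    ext x
    simp only [smul_apply, sub_apply, add_apply, ContinuousLinearMap.smulRight_apply, smul_add, smul_smul, smul_eq_mul,
      nsmul_eq_mul]
    rw [eq_sub_iff_add_eq]
    cases N with
    | zero => simp
    | succ N =>
      simp only [Nat.add_sub_cancel]
      congr 2
      · ring
      · ring

/-- Boundedness is checked on generic discs, which stay inside the smooth locus and on which `(f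
ḡ)^N Φ` is the restriction of a smooth function; the one-variable division bounds `Φ` on them
uniformly. The radius `ρ'` depends on `f` and `g` only, so it serves all derivatives at once. -/
theorem exists_isBoundedClass (hρ : 0 < ρ) (A : Finset (Fin d))
    (hf : ContDiffOn ℂ ∞ f (Metric.ball 0 ρ)) (hg : ContDiffOn ℂ ∞ g (Metric.ball 0 ρ))
    (hf0 : ∃ z ∈ Metric.ball 0 ρ, f z ≠ 0) (hg0 : ∃ z ∈ Metric.ball 0 ρ, g z ≠ 0)
    (hfA : ∀ j ∈ A, ∃ z ∈ Metric.ball 0 ρ, z j = 0 ∧ f z ≠ 0)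
    (hgA : ∀ j ∈ A, ∃ z ∈ Metric.ball 0 ρ, z j = 0 ∧ g z ≠ 0) :
    ∃ ρ', 0 < ρ' ∧ ρ' ≤ ρ / 2 ∧ IsBoundedClass (Metric.ball 0 ρ') (fun z => f z * g z)
      (@IsQuotientClass d ρ A f g) := by
  obtain ⟨v, r, δ, ρ', hr, -, hδ, hρ', hρρ, hline, hcirc, hgen⟩ :=
    exists_generic_slices hρ A hf hg hf0 hg0 hfA hgA
  have hG : IsOpen (smoothLocus ρ A f g) := isOpen_smoothLocus hf.continuousOn hg.continuousOn
  have hsub : Metric.ball (0 : CSpace d) ρ' ⊆ Metric.ball 0 ρ :=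
    Metric.ball_subset_ball (by linarith)
  have hK : Metric.closedBall (0 : CSpace d) (ρ / 2) ⊆ Metric.ball 0 ρ :=
    Metric.closedBall_subset_ball (by linarith)
  have hmem : ∀ z ∈ Metric.ball (0 : CSpace d) ρ', f z * g z ≠ 0 → z ∈ smoothLocus ρ A f g :=
    fun z hz h => ⟨hsub hz, Or.inl h⟩
  refine ⟨ρ', hρ', hρρ, ⟨?_, ?_, ?_⟩⟩
  · intro F _ _ _ _ Φ hΦ z hz hz0
    exact (hΦ.1.contDiffAt (hG.mem_nhds (hmem z hz hz0))).differentiableAt (by simp)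
  · intro F _ _ _ _ Φ hΦ
    obtain ⟨hΘ, N, b, hb, hN⟩ := hΦ
    -- `n` is chosen so large that the upper bound for `h^N` is below `2^n` times the lower bound
    -- `δ^N` on the circles.
    have hbound : ∀ {h : CSpace d → ℂ}, ContDiffOn ℂ ∞ h (Metric.ball 0 ρ) →
        ∃ (M : ℝ) (n : ℕ), M < 2 ^ n * δ ^ N ∧ ∀ z ∈ Metric.closedBall (0 : CSpace d) (ρ / 2),
          ‖h z ^ N‖ ≤ M := by
      intro h hh
      obtain ⟨M, hM⟩ := (isCompact_closedBall (0 : CSpace d) (ρ / 2)).exists_bound_of_continuousOn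
        ((hh.continuousOn.mono hK).pow N)
      obtain ⟨n, hn⟩ := pow_unbounded_of_one_lt (M / δ ^ N) one_lt_two
      exact ⟨M, n, (div_lt_iff₀ (pow_pos hδ N)).1 hn, hM⟩
    obtain ⟨M, n, hM, hMb⟩ := hbound hf
    obtain ⟨M', n', hM', hMb'⟩ := hbound hg
    -- The good centres: where the line meets a hyperplane, neither `f` nor `g` vanishes.
    set S : Type := {z : CSpace d // z ∈ Metric.ball 0 ρ' ∧
      ∀ t : ℂ, (∃ j ∈ A, (z + t • v) j = 0) → f (z + t • v) ≠ 0 ∧ g (z + t • v) ≠ 0} with hS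
    have hin : ∀ (s : S) (t : ℂ), ‖t‖ ≤ 8 * r →
        s.1 + t • v ∈ Metric.closedBall (0 : CSpace d) (ρ / 2) := fun s t ht =>
      Metric.ball_subset_closedBall (hline s.1 s.2.1 t ht)
    have hinG : ∀ (s : S) (t : ℂ), ‖t‖ ≤ 8 * r → s.1 + t • v ∈ smoothLocus ρ A f g := by
      intro s t ht
      refine ⟨hK (hin s t ht), ?_⟩
      by_cases hj : ∃ j ∈ A, (s.1 + t • v) j = 0
      · exact Or.inl (mul_ne_zero (s.2.2 t hj).1 (s.2.2 t hj).2)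
      · push Not at hj
        exact Or.inr hj
    have hdiff : ∀ {h : CSpace d → ℂ}, ContDiffOn ℂ ∞ h (Metric.ball 0 ρ) → ∀ s : S,
        DifferentiableOn ℂ (fun t : ℂ => h (s.1 + t • v) ^ N) (Metric.ball 0 (8 * r)) := by
      intro h hh s
      refine DifferentiableOn.fun_pow ?_ N
      refine ((differentiableOn_line Metric.isOpen_ball (hh.differentiableOn (by simp)) s.1 v).2).mono
        fun t ht => ?_
      exact hK (hin s t (mem_ball_zero_iff.1 ht).le)
    have hball : ∀ t ∈ Metric.ball (0 : ℂ) r, ‖t‖ ≤ 8 * r := fun t ht => by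
      have := mem_ball_zero_iff.1 ht
      linarith
    have hsm : ∀ s : S, ContDiffOn ℝ ∞ (fun t : ℂ => Φ (s.1 + t • v)) (Metric.ball 0 r) := by
      intro s
      obtain ⟨z, hz⟩ := s
      have h1 : ContDiff ℝ ∞ fun t : ℂ => z + t • v := by fun_prop
      exact hΘ.comp h1.contDiffOn fun t ht => hinG ⟨z, hz⟩ t (hball t ht)
    obtain ⟨C, hC⟩ := bounded_of_holomorphic_smul (F := F) hr (n + n') (S := S)
      (h := fun s t => f (s.1 + t • v) ^ N) (g := fun s t => g (s.1 + t • v) ^ N)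
      (v := fun s t => Φ (s.1 + t • v)) rfl (pow_pos hδ N) (pow_pos hδ N) hM hM'
      (hdiff hf) (hdiff hg)
      (fun s t ht => hMb _ (hin s t (by linarith))) (fun s t ht => hMb' _ (hin s t (by linarith)))
      (fun s t ht => by
        rw [norm_pow]
        exact pow_le_pow_left₀ hδ.le (hcirc s.1 s.2.1 t ht).1 N)
      (fun s t ht => by
        rw [norm_pow]
        exact pow_le_pow_left₀ hδ.le (hcirc s.1 s.2.1 t ht).2 N)
      hsm
      ((smoothlyBounded_comp_affine (S := S) Metric.isOpen_ball Metric.isOpen_ball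
        (isCompact_closedBall (0 : CSpace d) (ρ / 2)) hK
        ((ContinuousLinearMap.id ℝ ℂ).smulRight v) (z := Subtype.val)
        (fun s t ht => hin s t (hball t ht)) (b := b) hb).congr fun s t ht => by
          have := hN _ (hinG s t (hball t ht))
          rw [mul_pow, ← map_pow] at this
          exact this)
    -- A value exceeding `C` would persist on a neighbourhood and hence be attained at a good
    -- centre.
    refine ⟨C, fun z hz hz0 => ?_⟩
    by_contra! hlt
    have hcont : ContinuousAt (fun z => ‖Φ z‖) z :=
      (hΘ.continuousOn.continuousAt (hG.mem_nhds (hmem z hz hz0))).norm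
    obtain ⟨w, hw, hw1, hw2⟩ := ((hgen z hz).and_eventually ((hcont.eventually_const_lt hlt).and
      (Metric.isOpen_ball.mem_nhds hz))).exists
    have := hC ⟨w, hw2, hw⟩ 0 (by simpa using hr)
    simp only [zero_smul, add_zero] at this
    linarith
  · intro F _ _ _ _ Φ hΦ
    exact hΦ.fderiv hf hg

/-- A smooth function off the coordinate hyperplanes which becomes smooth after multiplication by
`f ḡ`, with `f` and `g` holomorphic, becomes smooth after multiplication by a monomial in the
coordinates and their conjugates. -/
theorem exists_monomial_mul_contDiffOn (hρ : 0 < ρ) (A : Finset (Fin d))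
    (hf : ContDiffOn ℂ ∞ f (Metric.ball 0 ρ)) (hg : ContDiffOn ℂ ∞ g (Metric.ball 0 ρ))
    (hf0 : ∃ z ∈ Metric.ball 0 ρ, f z ≠ 0) (hg0 : ∃ z ∈ Metric.ball 0 ρ, g z ≠ 0) :
    ∃ (ρ' : ℝ) (J K : Fin d → ℕ), 0 < ρ' ∧ ρ' ≤ ρ ∧ (∀ j ∉ A, J j = 0 ∧ K j = 0) ∧
      ∀ u a : CSpace d → ℂ, ContDiffOn ℝ ∞ u {z | z ∈ Metric.ball 0 ρ ∧ ∀ j ∈ A, z j ≠ 0} →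
        ContDiffOn ℝ ∞ a (Metric.ball 0 ρ) →
        (∀ z ∈ Metric.ball 0 ρ, (∀ j ∈ A, z j ≠ 0) → f z * conj (g z) * u z = a z) →
        ∃ U : CSpace d → ℂ, ContDiffOn ℝ ∞ U (Metric.ball 0 ρ') ∧
          ∀ z ∈ Metric.ball 0 ρ', (∀ j ∈ A, z j ≠ 0) →
            U z = (∏ j, z j ^ J j) * (∏ j, conj (z j) ^ K j) * u z := by
  -- The coordinate factors of `f` and `g` go into the monomial. What remains vanishes identically
  -- on no hyperplane `z_j = 0` with `j ∈ A`, as generic slicing requires.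
  obtain ⟨J, f', hJ, hf', hff, hfA⟩ := exists_eq_monomial_mul hρ A hf hf0
  obtain ⟨K, g', hK, hg', hgg, hgA⟩ := exists_eq_monomial_mul hρ A hg hg0
  have hf0' : ∃ z ∈ Metric.ball 0 ρ, f' z ≠ 0 := by
    obtain ⟨z, hz, h⟩ := hf0
    exact ⟨z, hz, fun h0 => h (by rw [hff z hz, h0, mul_zero])⟩
  have hg0' : ∃ z ∈ Metric.ball 0 ρ, g' z ≠ 0 := by
    obtain ⟨z, hz, h⟩ := hg0
    exact ⟨z, hz, fun h0 => h (by rw [hgg z hz, h0, mul_zero])⟩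
  obtain ⟨ρ', hρ', hρρ, hP⟩ := exists_isBoundedClass hρ A hf' hg' hf0' hg0' hfA hgA
  have hsub : Metric.ball (0 : CSpace d) ρ' ⊆ Metric.ball 0 ρ :=
    Metric.ball_subset_ball (by linarith)
  refine ⟨ρ', J, K, hρ', by linarith, fun j hj => ⟨hJ j hj, hK j hj⟩, fun u a hu ha h => ?_⟩
  classical
  set V : Set (CSpace d) := {z | z ∈ Metric.ball 0 ρ ∧ ∀ j ∈ A, z j ≠ 0} with hV
  have hVo : IsOpen V := by
    have h2 : IsOpen (Metric.ball (0 : CSpace d) ρ ∩ ⋂ j ∈ A, {z | z j ≠ 0}) :=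
      Metric.isOpen_ball.inter (isOpen_biInter_finset fun j _ =>
        isOpen_ne_fun (continuous_apply j) continuous_const)
    convert h2 using 1
    ext z
    simp [hV]
  set mono : CSpace d → ℂ := fun z => (∏ j, z j ^ J j) * (∏ j, conj (z j) ^ K j) with hmono
  have hmonos : ContDiff ℝ ∞ mono := by
    have h1 : ∀ j : Fin d, ContDiff ℝ ∞ fun z : CSpace d => z j := fun j => contDiff_apply ℝ ℂ j
    exact (contDiff_prod fun j _ => (h1 j).pow _).mul (contDiff_prod fun j _ =>
      ((Complex.conjCLE : ℂ →L[ℝ] ℂ).contDiff.comp (h1 j)).pow _)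
  have hkey : ∀ z ∈ V, f' z * conj (g' z) * (mono z * u z) = a z := by
    intro z hz
    rw [← h z hz.1 hz.2, hff z hz.1, hgg z hz.1, hmono]
    simp only [map_mul, map_prod, map_pow]
    ring
  -- The two expressions agree where both make sense, so `Θ` is the cleared function continued to
  -- the points of the hyperplanes where `f' g' ≠ 0`. It remains to cross the zeros of `f' g'`.
  set Θ : CSpace d → ℂ := fun z => if z ∈ V then mono z * u z else a z / (f' z * conj (g' z))
    with hΘ
  have hqs := contDiffOn_mul_conj hf' hg'
  have hlocus : IsOpen (smoothLocus ρ A f' g') :=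
    isOpen_smoothLocus hf'.continuousOn hg'.continuousOn
  have hne : ∀ z, f' z * g' z ≠ 0 → f' z * conj (g' z) ≠ 0 := by
    intro z hz
    simpa [mul_eq_zero, map_eq_zero] using hz
  have hquot : ∀ z ∈ Metric.ball (0 : CSpace d) ρ, f' z * g' z ≠ 0 →
      Θ z = a z / (f' z * conj (g' z)) := by
    intro z hz hz0
    by_cases hzV : z ∈ V
    · simp only [hΘ, if_pos hzV]
      rw [eq_div_iff (hne z hz0), mul_comm]
      exact hkey z hzV
    · simp only [hΘ, if_neg hzV]
  have hclass : IsQuotientClass ρ A f' g' Θ := by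
    refine ⟨fun z hz => ContDiffAt.contDiffWithinAt ?_, 1, a, ha, fun z hz => ?_⟩
    · by_cases hzV : z ∈ V
      · refine ((hmonos.contDiffOn.mul hu).contDiffAt (hVo.mem_nhds hzV)).congr_of_eventuallyEq ?_
        filter_upwards [hVo.mem_nhds hzV] with w hw
        simp only [hΘ, if_pos hw]
      · have hz0 : f' z * g' z ≠ 0 := hz.2.resolve_right fun h => hzV ⟨hz.1, h⟩
        have hzb : Metric.ball (0 : CSpace d) ρ ∈ 𝓝 z := Metric.isOpen_ball.mem_nhds hz.1
        refine ((ha.contDiffAt hzb).mul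
          ((hqs.contDiffAt hzb).inv (hne z hz0))).congr_of_eventuallyEq ?_
        have hc : ContinuousAt (fun w => f' w * g' w) z :=
          (hf'.continuousOn.continuousAt hzb).mul (hg'.continuousOn.continuousAt hzb)
        filter_upwards [hzb, hc.eventually_ne hz0] with w hw hw0
        rw [hquot w hw hw0]
        exact div_eq_mul_inv _ _
    · rw [pow_one, smul_eq_mul]
      by_cases hzV : z ∈ V
      · simp only [hΘ, if_pos hzV]
        exact hkey z hzV
      · have hz0 : f' z * g' z ≠ 0 := hz.2.resolve_right fun h => hzV ⟨hz.1, h⟩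
        rw [hquot z hz.1 hz0, mul_div_cancel₀ _ (hne z hz0)]
  have hd : DifferentiableOn ℂ (fun z => f' z * g' z) (Metric.ball 0 ρ) :=
    (hf'.differentiableOn (by simp)).mul (hg'.differentiableOn (by simp))
  obtain ⟨z₀, hz₀, hz₀'⟩ := exists_mul_ne_zero Metric.isOpen_ball (convex_ball _ _)
    (hf'.differentiableOn (by simp)) (hg'.differentiableOn (by simp)) hf0' hg0'
  have hdense : ∀ p ∈ Metric.ball (0 : CSpace d) ρ', ∃ᶠ z in 𝓝 p, f' z * g' z ≠ 0 := fun p hp =>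
    frequently_ne_zero Metric.isOpen_ball (convex_ball _ _) hd (hsub hp) hz₀ hz₀'
  refine ⟨extendFrom (Metric.ball 0 ρ' ∩ {z | f' z * g' z ≠ 0}) Θ, ?_, fun z hz hzA => ?_⟩
  · exact contDiffOn_infty.2 fun n => hP.contDiffOn_extendFrom Metric.isOpen_ball (convex_ball _ _)
      (hd.mono hsub) hdense n hclass
  · have hzV : z ∈ V := ⟨hsub hz, hzA⟩
    have hΘz : Θ z = mono z * u z := by simp only [hΘ, if_pos hzV]
    have hcont : ContinuousAt Θ z :=
      hclass.1.continuousOn.continuousAt (hlocus.mem_nhds ⟨hsub hz, Or.inr hzA⟩)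
    have := neBot_nhdsWithin_ne_zero Metric.isOpen_ball hdense hz
    rw [extendFrom_eq (mem_closure_iff_nhdsWithin_neBot.2 this)
      (hcont.tendsto.mono_left nhdsWithin_le_nhds), hΘz]

end Clearing

/-! ### Change of charts for differential forms -/

section Transition

variable {d n : ℕ} {X : Type*} [TopologicalSpace X] [ChartedSpace (CSpace d) X]

theorem alternatingMap_eq_sum {E : Type*} [AddCommGroup E] [Module ℝ E]
    {ι : Type*} [Fintype ι] (b : Module.Basis ι ℝ E) (Λ : E [⋀^Fin n]→ₗ[ℝ] ℂ) (v : Fin n → E) :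
    Λ v = ∑ f : Fin n → ι, (∏ i, b.repr (v i) (f i)) • Λ fun i => b (f i) := by
  classical
  conv_lhs => rw [show v = fun i => ∑ k, b.repr (v i) k • b k from
    funext fun i => (b.sum_repr (v i)).symm]
  rw [← AlternatingMap.coe_multilinearMap, MultilinearMap.map_sum]
  exact Finset.sum_congr rfl fun f _ =>
    Λ.toMultilinearMap.map_smul_univ (fun i => b.repr (v i) (f i)) (fun i => b (f i))

/-- A form with smooth coefficients evaluated at smooth vector fields is smooth. -/
theorem contDiffAt_alternatingMap {E G : Type*} [NormedAddCommGroup E] [NormedSpace ℝ E]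
    [FiniteDimensional ℝ E] [NormedAddCommGroup G] [NormedSpace ℝ G]
    {ι : Type*} [Fintype ι] (b : Module.Basis ι ℝ E) {Λ : G → E [⋀^Fin n]→ₗ[ℝ] ℂ}
    {Y : Fin n → G → E} {z : G} (hΛ : ∀ f : Fin n → ι, ContDiffAt ℝ ∞ (fun z => Λ z fun i => b (f i)) z)
    (hY : ∀ i, ContDiffAt ℝ ∞ (Y i) z) :
    ContDiffAt ℝ ∞ (fun z => Λ z fun i => Y i z) z := by
  have h : (fun z => Λ z fun i => Y i z) = fun z => ∑ f : Fin n → ι,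
      (∏ i, b.repr (Y i z) (f i)) • Λ z fun i => b (f i) :=
    funext fun z => alternatingMap_eq_sum b (Λ z) _
  rw [h]
  refine ContDiffAt.sum fun f _ => ContDiffAt.fun_smul ?_ (hΛ f)
  refine contDiffAt_prod fun i _ => ?_
  exact ((b.coord (f i)).toContinuousLinearMap.contDiff.contDiffAt).comp z (hY i)

/-- The coordinate changes of a complex manifold are holomorphic. -/
theorem contDiffOn_transition [IsManifold 𝓘(ℂ, CSpace d) ω X]
    {e e' : OpenPartialHomeomorph X (CSpace d)}
    (he : e ∈ IsManifold.maximalAtlas 𝓘(ℂ, CSpace d) ω X)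
    (he' : e' ∈ IsManifold.maximalAtlas 𝓘(ℂ, CSpace d) ω X) :
    ContDiffOn ℂ ω (e' ∘ e.symm) (e.target ∩ e.symm ⁻¹' e'.source) := by
  have h := StructureGroupoid.compatible_of_mem_maximalAtlas he he'
  rw [contDiffGroupoid, mem_groupoid_of_pregroupoid] at h
  have h1 := h.1
  simpa [contDiffPregroupoid] using h1

theorem contDiffAt_transition [IsManifold 𝓘(ℂ, CSpace d) ω X]
    {e e' : OpenPartialHomeomorph X (CSpace d)}
    (he : e ∈ IsManifold.maximalAtlas 𝓘(ℂ, CSpace d) ω X)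
    (he' : e' ∈ IsManifold.maximalAtlas 𝓘(ℂ, CSpace d) ω X) {z : CSpace d} (hz : z ∈ e.target)
    (hz' : e.symm z ∈ e'.source) : ContDiffAt ℂ ω (e' ∘ e.symm) z :=
  (contDiffOn_transition he he').contDiffAt
    ((e.isOpen_inter_preimage_symm e'.open_source).mem_nhds ⟨hz, hz'⟩)

theorem localRep_apply (η : DForm d n X) (x : X) (z : CSpace d) (v : Fin n → CSpace d) :
    localRep η x z v = η ((chartAt (CSpace d) x).symm z) fun i =>
      mfderiv 𝓘(ℝ, CSpace d) 𝓘(ℝ, CSpace d) (chartAt (CSpace d) x).symm z (v i) := rfl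

variable [IsManifold 𝓘(ℂ, CSpace d) ω X]

theorem mdifferentiableAt_chart_symm (x : X) {z : CSpace d}
    (hz : z ∈ (chartAt (CSpace d) x).target) :
    MDifferentiableAt 𝓘(ℝ, CSpace d) 𝓘(ℝ, CSpace d) (chartAt (CSpace d) x).symm z :=
  haveI := isManifold_real d X
  (mdifferentiable_chart (I := 𝓘(ℝ, CSpace d)) x).mdifferentiableAt_symm hz

theorem localRep_transition (η : DForm d n X) (x p : X) {z : CSpace d}
    (hz : z ∈ (chartAt (CSpace d) x).target)
    (hz' : (chartAt (CSpace d) x).symm z ∈ (chartAt (CSpace d) p).source)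
    (v : Fin n → CSpace d) :
    localRep η x z v = localRep η p ((chartAt (CSpace d) p ∘ (chartAt (CSpace d) x).symm) z)
      fun i => fderiv ℝ (chartAt (CSpace d) p ∘ (chartAt (CSpace d) x).symm) z (v i) := by
  set φ := chartAt (CSpace d) x with hφ
  set φ' := chartAt (CSpace d) p with hφ'
  have hτ : DifferentiableAt ℝ (φ' ∘ φ.symm) z :=
    (contDiffAt_transition (IsManifold.chart_mem_maximalAtlas x)
      (IsManifold.chart_mem_maximalAtlas p) hz hz').differentiableAt (by simp) |>.restrictScalars ℝ
  have hev : φ.symm =ᶠ[𝓝 z] φ'.symm ∘ (φ' ∘ φ.symm) := by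
    filter_upwards [(φ.isOpen_inter_preimage_symm φ'.open_source).mem_nhds ⟨hz, hz'⟩] with w hw
    exact (φ'.left_inv hw.2).symm
  have hd : mfderiv 𝓘(ℝ, CSpace d) 𝓘(ℝ, CSpace d) φ.symm z =
      (mfderiv 𝓘(ℝ, CSpace d) 𝓘(ℝ, CSpace d) φ'.symm ((φ' ∘ φ.symm) z)).comp
        (mfderiv 𝓘(ℝ, CSpace d) 𝓘(ℝ, CSpace d) (φ' ∘ φ.symm) z) := by
    rw [hev.mfderiv_eq]
    exact mfderiv_comp z (mdifferentiableAt_chart_symm p (φ'.map_source hz'))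
      hτ.mdifferentiableAt
  have hpt : φ.symm z = φ'.symm ((φ' ∘ φ.symm) z) := (φ'.left_inv hz').symm
  rw [localRep_apply, localRep_apply, ← hφ, ← hφ']
  have hv : ∀ i, mfderiv 𝓘(ℝ, CSpace d) 𝓘(ℝ, CSpace d) φ.symm z (v i) =
      mfderiv 𝓘(ℝ, CSpace d) 𝓘(ℝ, CSpace d) φ'.symm ((φ' ∘ φ.symm) z)
        (fderiv ℝ (φ' ∘ φ.symm) z (v i)) := by
    intro i
    rw [hd, mfderiv_eq_fderiv]
    rfl
  -- The type of `η y` depends on `y`, so the equality of base points is applied to values on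
  -- vectors of the model space.
  have hη : ∀ y y' : X, y = y' → ∀ w : Fin n → CSpace d, η y w = η y' w := by
    rintro y _ rfl w
    rfl
  rw [funext hv]
  exact hη _ _ hpt _

/-- Smoothness of a form near a point may be tested in any of the preferred charts. -/
theorem SmoothNear.eventually_contDiffAt {η : DForm d n X} {p : X} (hη : SmoothNear η p) {x : X}
    (hp : p ∈ (chartAt (CSpace d) x).source) :
    ∀ᶠ z in 𝓝 (chartAt (CSpace d) x p), ∀ v, ContDiffAt ℝ ∞ (fun z => localRep η x z v) z := by
  set φ := chartAt (CSpace d) x with hφ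
  set φ' := chartAt (CSpace d) p with hφ'
  let b := Module.finBasis ℝ (CSpace d)
  have h1 : ∀ᶠ z in 𝓝 (φ' p), ∀ f : Fin n → Fin (Module.finrank ℝ (CSpace d)),
      ContDiffAt ℝ ∞ (fun z => localRep η p z fun i => b (f i)) z :=
    eventually_all.2 fun f => hη fun i => b (f i)
  have hdom := (φ.isOpen_inter_preimage_symm φ'.open_source).mem_nhds
    (show φ p ∈ _ from ⟨φ.map_source hp, by
      rw [mem_preimage, φ.left_inv hp]; exact mem_chart_source _ p⟩)
  have hsm : ∀ z ∈ φ.target ∩ φ.symm ⁻¹' φ'.source, ContDiffAt ℝ ω (φ' ∘ φ.symm) z := fun z hz =>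
    (contDiffAt_transition (IsManifold.chart_mem_maximalAtlas x)
      (IsManifold.chart_mem_maximalAtlas p) hz.1 hz.2).restrict_scalars ℝ
  have htend : Tendsto (φ' ∘ φ.symm) (𝓝 (φ p)) (𝓝 (φ' p)) := by
    have := (hsm _ (mem_of_mem_nhds hdom)).continuousAt.tendsto
    simpa [φ.left_inv hp] using this
  filter_upwards [hdom, htend.eventually h1] with z hz hz1 v
  have hloc : (fun z => localRep η x z v) =ᶠ[𝓝 z] fun z => localRep η p ((φ' ∘ φ.symm) z)
      fun i => fderiv ℝ (φ' ∘ φ.symm) z (v i) := by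
    filter_upwards [(φ.isOpen_inter_preimage_symm φ'.open_source).mem_nhds hz] with w hw
    exact localRep_transition η x p hw.1 hw.2 v
  refine ContDiffAt.congr_of_eventuallyEq ?_ hloc
  refine contDiffAt_alternatingMap b (Λ := fun z => localRep η p ((φ' ∘ φ.symm) z)) (fun f => ?_)
    fun i => ?_
  · exact (hz1 f).comp z ((hsm z hz).of_le le_top)
  · exact ((hsm z hz).fderiv_right (m := ∞) le_top).clm_apply contDiffAt_const

end Transition

/-! ### Existence of the pole orders of a quasi-meromorphic form -/

section ClearingForms

open ComplexConjugate

variable {d n : ℕ} {X : Type*} [TopologicalSpace X] [ChartedSpace (CSpace d) X]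

theorem frequently_forall_ne_zero (w : CSpace d) : ∃ᶠ z in 𝓝 w, ∀ j, z j ≠ 0 := by
  have h := frequently_ne_zero (f := fun z : CSpace d => ∏ j, z j) isOpen_univ convex_univ
    (differentiableOn_prod Finset.univ fun j _ => by fun_prop) (mem_univ w)
    (mem_univ fun _ => (1 : ℂ)) (by simp)
  exact h.mono fun z hz j => (Finset.prod_ne_zero_iff.1 hz) j (Finset.mem_univ j)

/-- A continuous family of functions which are alternating off the coordinate hyperplanes consists
of alternating maps. -/
theorem exists_alternatingMap_of_continuousOn {E : Type*} [AddCommGroup E] [Module ℝ E]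
    {B : Set (CSpace d)} (hB : IsOpen B) {U : (Fin n → E) → CSpace d → ℂ}
    (hU : ∀ v, ContinuousOn (U v) B) {Λ : CSpace d → E [⋀^Fin n]→ₗ[ℝ] ℂ}
    (h : ∀ z ∈ B, (∀ j, z j ≠ 0) → ∀ v, U v z = Λ z v) {w : CSpace d} (hw : w ∈ B) :
    ∃ M : E [⋀^Fin n]→ₗ[ℝ] ℂ, ∀ v, M v = U v w := by
  have key : ∀ a b : CSpace d → ℂ, ContinuousOn a B → ContinuousOn b B →
      (∀ z ∈ B, (∀ j, z j ≠ 0) → a z = b z) → a w = b w := by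
    intro a b ha hb hab
    have hBw := hB.mem_nhds hw
    by_contra hne
    have hev := ((ha.continuousAt hBw).sub (hb.continuousAt hBw)).eventually_ne (sub_ne_zero.2 hne)
    obtain ⟨z, hz, hz1, hz2⟩ := ((frequently_forall_ne_zero w).and_eventually
      (hev.and hBw)).exists
    exact hz1 (sub_eq_zero.2 (hab z hz2 hz))
  refine ⟨{ toFun := fun v => U v w, map_update_add' := ?_, map_update_smul' := ?_,
            map_eq_zero_of_eq' := ?_ }, fun v => rfl⟩
  · intro _ v i x y
    refine key _ (fun z => U _ z + U _ z) (hU _) ((hU _).add (hU _)) fun z hz hz0 => ?_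
    rw [h z hz hz0, h z hz hz0, h z hz hz0]
    exact (Λ z).map_update_add v i x y
  · intro _ v i c x
    refine key _ (fun z => c • U _ z) (hU _) ((hU _).const_smul c) fun z hz hz0 => ?_
    rw [h z hz hz0, h z hz hz0]
    exact (Λ z).map_update_smul v i c x
  · intro v i j hij hne
    refine key _ (fun _ => 0) (hU _) continuousOn_const fun z hz hz0 => ?_
    rw [h z hz hz0]
    exact (Λ z).map_eq_zero_of_eq v hij hne

theorem HolomorphicNear.contDiffAt_comp_symm {f : X → ℂ} {e : OpenPartialHomeomorph X (CSpace d)}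
    (he : e ∈ IsManifold.maximalAtlas 𝓘(ℂ, CSpace d) ω X) {w : CSpace d} (hw : w ∈ e.target)
    (hf : HolomorphicNear d f (e.symm w)) : ContDiffAt ℂ ω (f ∘ e.symm) w := by
  have h1 : ContMDiffAt 𝓘(ℂ, CSpace d) 𝓘(ℂ, CSpace d) ω e.symm w :=
    (contMDiffOn_symm_of_mem_maximalAtlas he).contMDiffAt (e.open_target.mem_nhds hw)
  exact contMDiffAt_iff_contDiffAt.1 (ContMDiffAt.comp w hf h1)

variable [IsManifold 𝓘(ℂ, CSpace d) ω X]

theorem HolomorphicNear.eventually {f : X → ℂ} {x : X} (hf : HolomorphicNear d f x) :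
    ∀ᶠ y in 𝓝 x, HolomorphicNear d f y :=
  (contMDiffAt_iff_contMDiffAt_nhds (by simp)).1 hf

theorem IsAdaptedChart.exists_ball {D : Set X} {x : X} {e : OpenPartialHomeomorph X (CSpace d)}
    {A : Finset (Fin d)} (he : IsAdaptedChart D x e A) {P : X → Prop} (hP : ∀ᶠ y in 𝓝 x, P y) :
    ∃ ρ > 0, Metric.ball 0 ρ ⊆ e.target ∧ ∀ w ∈ Metric.ball 0 ρ, P (e.symm w) := by
  have h0 : (0 : CSpace d) ∈ e.target := he.2.2.1 ▸ e.map_source he.2.1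
  have hx : e.symm 0 = x := by rw [← he.2.2.1, e.left_inv he.2.1]
  have h1 : Tendsto e.symm (𝓝 0) (𝓝 x) := by
    have := (e.continuousAt_symm h0).tendsto
    rwa [hx] at this
  obtain ⟨ρ, hρ, h⟩ := Metric.eventually_nhds_iff_ball.1
    ((h1.eventually hP).and (e.open_target.mem_nhds h0))
  exact ⟨ρ, hρ, fun w hw => (h w hw).2, fun w hw => (h w hw).1⟩

theorem IsAdaptedChart.symm_mem_iff {D : Set X} {x : X} {e : OpenPartialHomeomorph X (CSpace d)}
    {A : Finset (Fin d)} (he : IsAdaptedChart D x e A) {w : CSpace d} (hw : w ∈ e.target) :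
    e.symm w ∉ D ↔ ∀ j ∈ A, w j ≠ 0 := by
  rw [he.2.2.2 _ (e.map_target hw), e.right_inv hw, ← ne_eq, Finset.prod_ne_zero_iff]

theorem IsAdaptedChart.eventually_mem_ball {D : Set X} {x : X}
    {e : OpenPartialHomeomorph X (CSpace d)} {A : Finset (Fin d)} (he : IsAdaptedChart D x e A)
    {ρ : ℝ} (hρ : 0 < ρ) : ∀ᶠ y in 𝓝 x, y ∈ e.source ∧ e y ∈ Metric.ball 0 ρ := by
  have h1 : Tendsto e (𝓝 x) (𝓝 0) := by
    have := (e.continuousAt he.2.1).tendsto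
    rwa [he.2.2.1] at this
  exact (show ∀ᶠ y in 𝓝 x, y ∈ e.source from e.open_source.mem_nhds he.2.1).and
    (h1.eventually (Metric.ball_mem_nhds 0 hρ))

theorem IsAdaptedChart.exists_ne_zero {D : Set X} {x : X}
    {e : OpenPartialHomeomorph X (CSpace d)} {A : Finset (Fin d)} (he : IsAdaptedChart D x e A)
    {ρ : ℝ} (hρ : 0 < ρ) {f : X → ℂ} (hf : ∃ᶠ y in 𝓝 x, f y ≠ 0) :
    ∃ w ∈ Metric.ball 0 ρ, (f ∘ e.symm) w ≠ 0 := by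
  obtain ⟨y, hy, hy1, hy2⟩ := (hf.and_eventually (he.eventually_mem_ball hρ)).exists
  exact ⟨e y, hy2, by simpa [e.left_inv hy1] using hy⟩

/-- This makes the pole orders exist: `exists_monomial_mul_contDiffOn` is applied to each
coefficient of `θ`, and the extended coefficients are reassembled into a form. -/
theorem clearingExponents_nonempty {D : Set X} {θ : DForm d n X} (hθ : IsQuasiMeromorphic D θ)
    {p : X} {e : OpenPartialHomeomorph X (CSpace d)} {A : Finset (Fin d)}
    (he : IsAdaptedChart D p e A) : (clearingExponents D θ p e A).Nonempty := by
  classical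
  obtain ⟨f, g, hf, hg, hf0, hg0, η₀, hη₀, hη₀θ⟩ := hθ.2 p
  set φ := chartAt (CSpace d) p with hφ
  have hφm : φ ∈ IsManifold.maximalAtlas 𝓘(ℂ, CSpace d) ω X := IsManifold.chart_mem_maximalAtlas p
  have hφp : p ∈ φ.source := mem_chart_source _ p
  have hsrc : ∀ᶠ y in 𝓝 p, y ∈ φ.source := φ.open_source.mem_nhds hφp
  have hη₀s : ∀ᶠ y in 𝓝 p, ∀ v, ContDiffAt ℝ ∞ (fun z => localRep η₀ p z v) (φ y) :=
    (φ.continuousAt hφp).tendsto.eventually (hη₀.eventually_contDiffAt hφp)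
  obtain ⟨ρ, hρ, hρt, hρP⟩ := he.exists_ball
    (hsrc.and (hf.eventually.and (hg.eventually.and (hη₀θ.and hη₀s))))
  have hσ : ∀ w ∈ Metric.ball (0 : CSpace d) ρ, ContDiffAt ℝ ∞ (φ ∘ e.symm) w := fun w hw =>
    ((contDiffAt_transition he.1 hφm (hρt hw) (hρP w hw).1).restrict_scalars ℝ).of_le le_top
  -- The radius and the exponents depend only on `f` and `g`, so one monomial clears all
  -- coefficients.
  obtain ⟨ρ', J, K, hρ', hρρ, hJK, hclear⟩ := exists_monomial_mul_contDiffOn hρ A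
    (f := f ∘ e.symm) (g := g ∘ e.symm)
    (fun w hw => ((hρP w hw).2.1.contDiffAt_comp_symm he.1
      (hρt hw)).of_le le_top |>.contDiffWithinAt)
    (fun w hw => ((hρP w hw).2.2.1.contDiffAt_comp_symm he.1
      (hρt hw)).of_le le_top |>.contDiffWithinAt)
    (he.exists_ne_zero hρ hf0) (he.exists_ne_zero hρ hg0)
  have hex : ∀ v : Fin n → CSpace d, ∃ U : CSpace d → ℂ, ContDiffOn ℝ ∞ U (Metric.ball 0 ρ') ∧
      ∀ w ∈ Metric.ball 0 ρ', (∀ j ∈ A, w j ≠ 0) →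
        U w = (∏ j, w j ^ J j) * (∏ j, conj (w j) ^ K j) * localRep θ p ((φ ∘ e.symm) w) v := by
    intro v
    refine hclear (fun w => localRep θ p ((φ ∘ e.symm) w) v)
      (fun w => localRep η₀ p ((φ ∘ e.symm) w) v) ?_ ?_ ?_
    · rintro w ⟨hw, hwA⟩
      have hwD : e.symm w ∉ D := (he.symm_mem_iff (hρt hw)).2 hwA
      have h1 := ((hθ.1 _ hwD).eventually_contDiffAt (x := p) (hρP w hw).1).self_of_nhds v
      exact (ContDiffAt.comp w h1 (hσ w hw)).contDiffWithinAt
    · intro w hw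
      exact (ContDiffAt.comp w ((hρP w hw).2.2.2.2 v) (hσ w hw)).contDiffWithinAt
    · intro w hw hwA
      have hwD : e.symm w ∉ D := (he.symm_mem_iff (hρt hw)).2 hwA
      have h1 := (hρP w hw).2.2.2.1 hwD
      have h2 : φ.symm ((φ ∘ e.symm) w) = e.symm w := φ.left_inv (hρP w hw).1
      rw [localRep_apply, localRep_apply, ← hφ, h2, h1]
      rfl
  choose U hUs hU using hex
  have hsubρ : Metric.ball (0 : CSpace d) ρ' ⊆ Metric.ball 0 ρ := Metric.ball_subset_ball hρρ
  -- The coefficients were extended one vector tuple at a time; multilinearity and alternation on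
  -- `D` follow by continuity from the dense complement of the hyperplanes.
  have hM : ∀ w ∈ Metric.ball (0 : CSpace d) ρ', ∃ M : CSpace d [⋀^Fin n]→ₗ[ℝ] ℂ,
      ∀ v, M v = U v w := fun w hw =>
    exists_alternatingMap_of_continuousOn Metric.isOpen_ball (fun v => (hUs v).continuousOn)
      (Λ := fun w => ((∏ j, w j ^ J j) * (∏ j, conj (w j) ^ K j)) • localRep θ p ((φ ∘ e.symm) w))
      (fun w hw hw0 v => hU v w hw fun j _ => hw0 j) hw
  choose! M hM using hM
  let mono : CSpace d → ℂ := fun w => (∏ j, w j ^ J j) * ∏ j, conj (w j) ^ K j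
  -- Off `D` the form must equal the cleared `θ` exactly; on `D` it is the extended coefficient
  -- form, carried back to the tangent space by the derivative of the chart.
  let η' : DForm d n X := fun y => if e y ∈ Metric.ball 0 ρ' ∧ y ∈ D then
    (M (e y)).compLinearMap (mfderiv 𝓘(ℝ, CSpace d) 𝓘(ℝ, CSpace d) φ y).toLinearMap
    else mono (e y) • θ y
  have hη' : ∀ y ∈ e.source, e y ∈ Metric.ball 0 ρ' → y ∈ φ.source → ∀ v,
      localRep η' p (φ y) v = U v (e y) := by
    intro y hy hyb hyφ v
    have hyy : e.symm (e y) = y := e.left_inv hy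
    rw [localRep_apply, ← hφ, φ.left_inv hyφ]
    by_cases hyD : y ∈ D
    · have h1 : η' y = (M (e y)).compLinearMap
          (mfderiv 𝓘(ℝ, CSpace d) 𝓘(ℝ, CSpace d) φ y).toLinearMap := if_pos ⟨hyb, hyD⟩
      rw [h1, ← hM _ hyb]
      have := isManifold_real d X
      have h2 := (mdifferentiable_chart (I := 𝓘(ℝ, CSpace d)) p).comp_symm_deriv
        (φ.map_source hyφ)
      rw [← hφ, φ.left_inv hyφ] at h2
      show M (e y) (fun i => mfderiv 𝓘(ℝ, CSpace d) 𝓘(ℝ, CSpace d) φ y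
        (mfderiv 𝓘(ℝ, CSpace d) 𝓘(ℝ, CSpace d) φ.symm (φ y) (v i))) = _
      congr 1
      funext i
      exact DFunLike.congr_fun h2 (v i)
    · have h1 : η' y = mono (e y) • θ y := if_neg fun h => hyD h.2
      have h2 : ∀ j ∈ A, e y j ≠ 0 := (he.symm_mem_iff (hρt (hsubρ hyb))).1 (by rwa [hyy])
      have h3 : (φ ∘ e.symm) (e y) = φ y := by rw [Function.comp_apply, hyy]
      have h4 : localRep θ p (φ y) v =
          θ y fun i => mfderiv 𝓘(ℝ, CSpace d) 𝓘(ℝ, CSpace d) φ.symm (φ y) (v i) := by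
        rw [localRep_apply, ← hφ, φ.left_inv hyφ]
      rw [h1, hU v _ hyb h2, h3, h4]
      rfl
  refine ⟨(J, K), hJK, η', fun v => ?_, ?_⟩
  · have hin : ∀ᶠ y in 𝓝 p, y ∈ φ.source ∧ y ∈ e.source ∧ e y ∈ Metric.ball 0 ρ' :=
      hsrc.and (he.eventually_mem_ball hρ')
    have hsym : Tendsto φ.symm (𝓝 (φ p)) (𝓝 p) := by
      have := (φ.continuousAt_symm (φ.map_source hφp)).tendsto
      rwa [φ.left_inv hφp] at this
    have hev : ∀ᶠ z in 𝓝 (φ p), z ∈ φ.target ∧ (φ.symm z ∈ φ.source ∧ φ.symm z ∈ e.source ∧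
        e (φ.symm z) ∈ Metric.ball 0 ρ') :=
      (show ∀ᶠ z in 𝓝 (φ p), z ∈ φ.target from φ.open_target.mem_nhds (φ.map_source hφp)).and
        (hsym.eventually hin)
    filter_upwards [hev.eventually_nhds] with z hz
    have hzz := hz.self_of_nhds
    have hloc : (fun z => localRep η' p z v) =ᶠ[𝓝 z] fun z => U v ((e ∘ φ.symm) z) := by
      filter_upwards [hz] with w hw
      have := hη' _ hw.2.2.1 hw.2.2.2 hw.2.1 v
      rwa [φ.right_inv hw.1] at this
    refine ContDiffAt.congr_of_eventuallyEq ?_ hloc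
    have h1 : ContDiffAt ℝ ∞ (e ∘ φ.symm) z :=
      ((contDiffAt_transition hφm he.1 hzz.1 hzz.2.2.1).restrict_scalars ℝ).of_le le_top
    exact ContDiffAt.comp z ((hUs v).contDiffAt (Metric.isOpen_ball.mem_nhds hzz.2.2.2)) h1
  · exact Eventually.of_forall fun y hy => if_neg fun h => hy h.2

theorem exists_isPoleOrder {D : Set X} {θ : DForm d n X} (hθ : IsQuasiMeromorphic D θ)
    {p : X} {e : OpenPartialHomeomorph X (CSpace d)} {A : Finset (Fin d)}
    (he : IsAdaptedChart D p e A) : ∃ J K, IsPoleOrder D θ p e A J K := by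
  obtain ⟨⟨J, K⟩, h⟩ := exists_minimal_of_wellFoundedLT (· ∈ clearingExponents D θ p e A)
    (clearingExponents_nonempty hθ he)
  exact ⟨J, K, h⟩

/-- Any adapted chart contributes to the supremum defining `kappaAt`, so independence of the chart
is not needed. The bound `d` is: an unbounded set of naturals has supremum `0`. -/
theorem card_mixedIndices_le_kappa {D : Set X} {θ : DForm d n X} {p : X}
    {e : OpenPartialHomeomorph X (CSpace d)} {A : Finset (Fin d)} (he : IsAdaptedChart D p e A)
    {J K : Fin d → ℕ} (h : IsPoleOrder D θ p e A J K) : (mixedIndices J K).card ≤ kappa D θ := by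
  have hle : ∀ J K : Fin d → ℕ, (mixedIndices J K).card ≤ d := fun J K =>
    (Finset.card_le_univ _).trans_eq (Fintype.card_fin d)
  have hb : ∀ x, ∀ k ∈ {k | ∃ (e : OpenPartialHomeomorph X (CSpace d)) (A : Finset (Fin d))
      (J K : Fin d → ℕ), IsAdaptedChart D x e A ∧ IsPoleOrder D θ x e A J K ∧
        k = (mixedIndices J K).card}, k ≤ d := by
    rintro x _ ⟨-, -, J, K, -, -, rfl⟩
    exact hle J K
  have h1 : (mixedIndices J K).card ≤ kappaAt D θ p :=
    le_csSup ⟨d, hb p⟩ ⟨e, A, J, K, he, h, rfl⟩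
  refine h1.trans (le_ciSup (f := fun x => kappaAt D θ x) ⟨d, ?_⟩ p)
  rintro _ ⟨x, rfl⟩
  rcases eq_empty_or_nonempty {k | ∃ (e : OpenPartialHomeomorph X (CSpace d)) (A : Finset (Fin d))
      (J K : Fin d → ℕ), IsAdaptedChart D x e A ∧ IsPoleOrder D θ x e A J K ∧
        k = (mixedIndices J K).card} with h0 | h0
  · simp only [kappaAt, h0]
    simp
  · exact csSup_le h0 (hb x)

end ClearingForms

/-! ### Coefficients of a wedge product -/

section Wedge

variable {d n m k : ℕ} {X : Type*} [TopologicalSpace X] [ChartedSpace (CSpace d) X]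

/-- The wedge product as a sum of products of values of the two forms. -/
theorem exists_wedge_eq_sum (h : n + m = k) : ∃ (ι : Type) (_ : Fintype ι) (ε : ι → ℂ)
    (α : ι → Fin n → Fin k) (β : ι → Fin m → Fin k), ∀ (η : DForm d n X) (ξ : DForm d m X) (x : X)
      (v : Fin k → TangentSpace 𝓘(ℝ, CSpace d) x),
      wedge h η ξ x v = ∑ i, ε i * (η x (v ∘ α i) * ξ x (v ∘ β i)) := by
  classical
  refine ⟨Equiv.Perm.ModSumCongr (Fin n) (Fin m), inferInstance,
    fun σ => ((Equiv.Perm.sign σ.out : ℤ) : ℂ),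
    fun σ i => finSumFinEquiv.trans (finCongr h) (σ.out (Sum.inl i)),
    fun σ i => finSumFinEquiv.trans (finCongr h) (σ.out (Sum.inr i)), fun η ξ x v => ?_⟩
  have h1 : wedge h η ξ x v = LinearMap.mul' ℝ ℂ
      ((∑ σ : Equiv.Perm.ModSumCongr (Fin n) (Fin m),
        AlternatingMap.domCoprod.summand (η x) (ξ x) σ)
          (v ∘ finSumFinEquiv.trans (finCongr h))) := rfl
  rw [h1, sum_apply, map_sum]
  refine Finset.sum_congr rfl fun σ _ => ?_
  conv_lhs => rw [← Quotient.out_eq' σ, AlternatingMap.domCoprod.summand_mk'']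
  rw [smul_apply, MultilinearMap.domDomCongr_apply, MultilinearMap.domCoprod_apply]
  rw [Units.smul_def, map_zsmul, LinearMap.mul'_apply, zsmul_eq_mul]
  rfl

theorem localRep_eq_sum {h : n + m = k} {ι : Type} [Fintype ι] {ε : ι → ℂ}
    {α : ι → Fin n → Fin k} {β : ι → Fin m → Fin k} {η : DForm d n X} {ξ : DForm d m X}
    (H : ∀ (x : X) (v : Fin k → TangentSpace 𝓘(ℝ, CSpace d) x),
      wedge h η ξ x v = ∑ i, ε i * (η x (v ∘ α i) * ξ x (v ∘ β i)))
    (x : X) (z : CSpace d) (v : Fin k → CSpace d) : localRep (wedge h η ξ) x z v =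
      ∑ i, ε i * (localRep η x z (v ∘ α i) * localRep ξ x z (v ∘ β i)) :=
  H _ _

end Wedge

/-! ### The norm of the section in adapted coordinates -/

section Section

variable {d : ℕ} {X : Type*} [TopologicalSpace X] [ChartedSpace (CSpace d) X]
  [IsManifold 𝓘(ℂ, CSpace d) ω X]

theorem contDiffAt_comp_symm_of_contMDiffAt {h : X → ℝ} {e : OpenPartialHomeomorph X (CSpace d)}
    (he : e ∈ IsManifold.maximalAtlas 𝓘(ℂ, CSpace d) ω X) {w : CSpace d} (hw : w ∈ e.target)
    (hh : ContMDiffAt 𝓘(ℝ, CSpace d) 𝓘(ℝ, ℝ) ∞ h (e.symm w)) :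
    ContDiffAt ℝ ∞ (h ∘ e.symm) w := by
  have := isManifold_real d X
  set y := e.symm w with hy
  set φ := chartAt (CSpace d) y with hφ
  have hyφ : y ∈ φ.source := mem_chart_source _ y
  have h1 : ContMDiffAt 𝓘(ℝ, CSpace d) 𝓘(ℝ, CSpace d) ∞ φ.symm (φ y) :=
    (contMDiffOn_chart_symm (I := 𝓘(ℝ, CSpace d))).contMDiffAt
      (φ.open_target.mem_nhds (φ.map_source hyφ))
  have h2 : ContDiffAt ℝ ∞ (h ∘ φ.symm) (φ y) := by
    refine contMDiffAt_iff_contDiffAt.1 (ContMDiffAt.comp (φ y) ?_ h1)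
    rwa [φ.left_inv hyφ]
  have h3 : ContDiffAt ℝ ∞ (φ ∘ e.symm) w :=
    ((contDiffAt_transition he (IsManifold.chart_mem_maximalAtlas y) hw hyφ).restrict_scalars
      ℝ).of_le le_top
  refine (ContDiffAt.comp w h2 h3).congr_of_eventuallyEq ?_
  filter_upwards [(e.isOpen_inter_preimage_symm φ.open_source).mem_nhds ⟨hw, hyφ⟩] with z hz
  simp only [Function.comp_apply]
  rw [φ.left_inv hz.2]

variable {L : X → Type*} [TopologicalSpace (Bundle.TotalSpace ℂ L)]
  [∀ x, AddCommGroup (L x)] [∀ x, Module ℂ (L x)] [∀ x, TopologicalSpace (L x)]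
  [FiberBundle ℂ L] [VectorBundle ℂ ℂ L]

/-- Near a point of a normal crossings divisor `{s = 0}`, the norm of `s` is the modulus of a
monomial times a positive smooth function. -/
theorem exists_norm_section_eq [ContMDiffVectorBundle ω ℂ L 𝓘(ℂ, CSpace d)] {s : ∀ x, L x}
    (hs : IsHolomorphicSection d s) (μ : LineMetric d L) {p : X}
    {e : OpenPartialHomeomorph X (CSpace d)} {A : Finset (Fin d)}
    (he : IsAdaptedChart (zeroLocus s) p e A) :
    ∃ (I : Fin d → ℕ) (ρ : ℝ) (W : CSpace d → ℝ), (∀ j, I j ≠ 0 ↔ j ∈ A) ∧ 0 < ρ ∧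
      Metric.ball 0 ρ ⊆ e.target ∧ ContDiffOn ℝ ∞ W (Metric.ball 0 ρ) ∧
      ∀ w ∈ Metric.ball 0 ρ, 0 < W w ∧
        μ.norm (e.symm w) (s (e.symm w)) = (∏ j, ‖w j‖ ^ I j) * W w := by
  classical
  set T := trivializationAt ℂ L p with hT
  set f : X → ℂ := fun y => (T ⟨y, s y⟩).2 with hf
  have hfp : HolomorphicNear d f p := (Bundle.contMDiffAt_section p).1 (hs p)
  have hbase : ∀ᶠ y in 𝓝 p, y ∈ T.baseSet :=
    T.open_baseSet.mem_nhds (FiberBundle.mem_baseSet_trivializationAt' p)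
  have hsy : ∀ y ∈ T.baseSet, s y = f y • T.symm y 1 := by
    intro y hy
    have h1 := T.symm_apply_apply_mk hy (s y)
    have h2 := (T.symmₗ ℂ y).map_smul (f y) 1
    rw [T.coe_symmₗ hy, smul_eq_mul, mul_one] at h2
    rw [← h2]
    exact h1.symm
  have hone : ∀ y ∈ T.baseSet, T.symm y (1 : ℂ) ≠ 0 := by
    intro y hy h0
    have h1 := T.apply_mk_symm hy (1 : ℂ)
    have h2 := (T.linearMapAt ℂ y).map_zero
    rw [T.coe_linearMapAt_of_mem hy] at h2
    rw [h0] at h1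
    simp only at h2
    rw [h1] at h2
    exact one_ne_zero h2
  have hzero : ∀ y ∈ T.baseSet, (y ∈ zeroLocus s ↔ f y = 0) := by
    intro y hy
    rw [zeroLocus, mem_ofPred_eq, hsy y hy, smul_eq_zero]
    simp [hone y hy]
  have hnorm : ∀ y ∈ T.baseSet, μ.norm y (s y) = ‖f y‖ * μ.norm y (T.symm y 1) := by
    intro y hy
    rw [hsy y hy, μ.norm_smul]
  obtain ⟨ρ, hρ, hρt, hρP⟩ := he.exists_ball (hbase.and hfp.eventually)
  have hF : ContDiffOn ℂ ∞ (f ∘ e.symm) (Metric.ball 0 ρ) := fun w hw =>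
    ((hρP w hw).2.contDiffAt_comp_symm he.1 (hρt hw)).of_le le_top |>.contDiffWithinAt
  have hF0 : ∀ w ∈ Metric.ball (0 : CSpace d) ρ, (f ∘ e.symm) w = 0 → ∃ j ∈ A, w j = 0 := by
    intro w hw h
    by_contra! hne
    exact (he.symm_mem_iff (hρt hw)).2 hne ((hzero _ (hρP w hw).1).2 h)
  have hF0' : ∀ w ∈ Metric.ball (0 : CSpace d) ρ, (∃ j ∈ A, w j = 0) → (f ∘ e.symm) w = 0 := by
    intro w hw h
    by_contra hne
    obtain ⟨j, hj, hj0⟩ := h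
    exact (he.symm_mem_iff (hρt hw)).1 (fun h => hne ((hzero _ (hρP w hw).1).1 h)) j hj hj0
  have hex : ∃ w ∈ Metric.ball (0 : CSpace d) ρ, (f ∘ e.symm) w ≠ 0 := by
    obtain ⟨w, hw, hwb⟩ := ((frequently_forall_ne_zero (0 : CSpace d)).and_eventually
      (Metric.ball_mem_nhds 0 hρ)).exists
    refine ⟨w, hwb, fun h => ?_⟩
    obtain ⟨j, -, hj⟩ := hF0 w hwb h
    exact hw j hj
  -- The zeros of the cofactor `f'` lie on the hyperplanes of `A`, and it vanishes identically on
  -- none of them, so it is a unit at the origin.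
  obtain ⟨I, f', hI, hf', hff, hfA⟩ := exists_eq_monomial_mul hρ A hF hex
  have hf'0 : f' 0 ≠ 0 := by
    refine ne_zero_of_zeros_on_coord hρ A hf' hfA ?_ fun z hz h => hF0 z hz ?_
    · obtain ⟨z, hz, h⟩ := hex
      exact ⟨z, hz, fun h0 => h (by rw [hff z hz, h0, mul_zero])⟩
    · rw [hff z hz, h, mul_zero]
  obtain ⟨ρ₁, hρ₁, hball⟩ := Metric.eventually_nhds_iff_ball.1
    (((hf'.continuousOn.continuousAt (Metric.ball_mem_nhds 0 hρ)).eventually_ne hf'0).and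
      (Metric.ball_mem_nhds (0 : CSpace d) hρ))
  have hsub : Metric.ball (0 : CSpace d) ρ₁ ⊆ Metric.ball 0 ρ := fun w hw => (hball w hw).2
  refine ⟨I, ρ₁, fun w => ‖f' w‖ * μ.norm (e.symm w) (T.symm (e.symm w) 1), fun j => ?_, hρ₁,
    hsub.trans hρt, ?_, fun w hw => ⟨?_, ?_⟩⟩
  · refine ⟨fun h => by_contra fun hj => h (hI j hj), fun hj h0 => ?_⟩
    -- A point of `D` on the `j`-th hyperplane and on no other: if `I j = 0`, the factorization
    -- would make the section nonzero there.
    set w : CSpace d := fun i => if i = j then 0 else ((ρ₁ / 2 : ℝ) : ℂ) with hw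
    have hwb : w ∈ Metric.ball (0 : CSpace d) ρ₁ := by
      rw [mem_ball_zero_iff, pi_norm_lt_iff hρ₁]
      intro i
      by_cases hij : i = j
      · simp [hw, hij, hρ₁]
      · simp only [hw, if_neg hij, Complex.norm_real, Real.norm_eq_abs, abs_of_pos (half_pos hρ₁)]
        linarith
    have h1 := hff w (hsub hwb)
    rw [hF0' w (hsub hwb) ⟨j, hj, by simp [hw]⟩] at h1
    refine (mul_ne_zero (Finset.prod_ne_zero_iff.2 fun i _ => ?_) (hball w hwb).1) h1.symm
    by_cases hij : i = j
    · simp [hij, h0]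
    · refine pow_ne_zero _ ?_
      simp [hw, hij, hρ₁.ne']
  · intro w hw
    refine ContDiffAt.contDiffWithinAt (ContDiffAt.mul ?_ ?_)
    · exact ((hf'.contDiffAt (Metric.isOpen_ball.mem_nhds (hsub hw))).restrict_scalars ℝ).norm ℝ
        (hball w hw).1
    · exact contDiffAt_comp_symm_of_contMDiffAt (h := fun y => μ.norm y (T.symm y 1)) he.1
        (hρt (hsub hw)) ((μ.smooth p).contMDiffAt (T.open_baseSet.mem_nhds (hρP w (hsub hw)).1))
  · exact mul_pos (norm_pos_iff.2 (hball w hw).1)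
      (μ.norm_pos _ _ (hone _ (hρP w (hsub hw)).1))
  · have h1 := hff w (hsub hw)
    rw [hnorm _ (hρP w (hsub hw)).1, show f (e.symm w) = (f ∘ e.symm) w from rfl, h1, norm_mul,
      norm_prod, mul_assoc]
    simp only [norm_pow]

theorem ofReal_pow_cpow {x : ℝ} (hx : 0 ≤ x) (n : ℕ) (c : ℂ) :
    ((x ^ n : ℝ) : ℂ) ^ c = (x : ℂ) ^ (n * c) := by
  rw [Complex.cpow_nat_mul]
  induction n with
  | zero => simp
  | succ n ih =>
    rw [pow_succ, Complex.ofReal_mul, Complex.mul_cpow_ofReal_nonneg (pow_nonneg hx n) hx, ih,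
      pow_succ]

theorem ofReal_prod_cpow {ι : Type*} (S : Finset ι) {x : ι → ℝ} (hx : ∀ i, 0 ≤ x i) (c : ℂ) :
    ((∏ i ∈ S, x i : ℝ) : ℂ) ^ c = ∏ i ∈ S, (x i : ℂ) ^ c := by
  classical
  induction S using Finset.induction_on with
  | empty => simp
  | insert i S hi ih =>
    rw [Finset.prod_insert hi, Finset.prod_insert hi, Complex.ofReal_mul,
      Complex.mul_cpow_ofReal_nonneg (hx i) (Finset.prod_nonneg fun i _ => hx i), ih]

/-- The positive factor satisfies `W^{2l} = e^{l · 2 log W}`; this is where the smooth exponent `ψ =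
2 log W` comes from. -/
theorem cpow_monomial (I : Fin d → ℕ) (w : CSpace d) {W : ℝ} (hW : 0 < W) (l : ℂ) :
    (((∏ j, ‖w j‖ ^ I j) * W : ℝ) : ℂ) ^ (2 * l) =
      absMonomial I 0 0 l w * Complex.exp (l * ((2 * Real.log W : ℝ) : ℂ)) := by
  rw [Complex.ofReal_mul, Complex.mul_cpow_ofReal_nonneg
    (Finset.prod_nonneg fun i _ => pow_nonneg (norm_nonneg _) _) hW.le,
    ofReal_prod_cpow _ (fun i => pow_nonneg (norm_nonneg _) _)]
  congr 1
  · refine Finset.prod_congr rfl fun j _ => ?_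
    rw [ofReal_pow_cpow (norm_nonneg _)]
    simp only [absPowMul, Pi.zero_apply, zpow_zero, mul_one]
    congr 1
    ring
  · rw [Complex.cpow_def_of_ne_zero (Complex.ofReal_ne_zero.2 hW.ne'), ← Complex.ofReal_log hW.le]
    congr 1
    push_cast
    ring

theorem absMonomial_eq_mul_prod (I : Fin d → ℕ) (J K : Fin d → ℕ) (l : ℂ) (w : CSpace d) :
    absMonomial I (fun j => -(J j : ℤ)) (fun j => -(K j : ℤ)) l w = absMonomial I 0 0 l w *
      ((∏ j, w j ^ J j) * ∏ j, (starRingEnd ℂ) (w j) ^ K j)⁻¹ := by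
  simp only [absMonomial, absPowMul, mul_inv, ← Finset.prod_inv_distrib, ← Finset.prod_mul_distrib]
  refine Finset.prod_congr rfl fun j _ => ?_
  simp only [Pi.zero_apply, zpow_zero, mul_one, zpow_neg, zpow_natCast, mul_assoc]

end Section

/-! ### Local form of the integrand -/

section LocalExpression

open ComplexConjugate

variable {d n m : ℕ} {X : Type*} [TopologicalSpace X] [ChartedSpace (CSpace d) X]
  {L : X → Type*} [TopologicalSpace (Bundle.TotalSpace ℂ L)]
  [∀ x, AddCommGroup (L x)] [∀ x, Module ℂ (L x)] [∀ x, TopologicalSpace (L x)]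
  [FiberBundle ℂ L] [VectorBundle ℂ ℂ L]

theorem density_regularizedForm (hnm : n + m = 2 * d) (s : ∀ x, L x) (μ : LineMetric d L)
    (θ : DForm d n X) (ξ : DForm d m X) (l : ℂ) (x : X) (z : CSpace d) :
    density (regularizedForm hnm s μ θ ξ l) x z =
      (μ.norm ((chartAt (CSpace d) x).symm z) (s ((chartAt (CSpace d) x).symm z)) : ℂ) ^ (2 * l) *
        density (wedge hnm θ ξ) x z :=
  rfl

variable [IsManifold 𝓘(ℂ, CSpace d) ω X]

theorem mixedCount_neg (J K : Fin d → ℕ) :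
    mixedCount (fun j => -(J j : ℤ)) (fun j => -(K j : ℤ)) = (mixedIndices J K).card := by
  simp only [mixedCount, mixedIndices]
  congr 1
  ext j
  simp [Nat.pos_iff_ne_zero]

/-- Near a point of a chart, the density of `θ ∧ ξ` is a monomial with integer exponents in the
adapted coordinates times a smooth function. -/
theorem exists_density_wedge_eq {D : Set X} {θ : DForm d n X} {ξ : DForm d m X}
    (hnm : n + m = 2 * d) {p x : X} (hp : p ∈ (chartAt (CSpace d) x).source) (hξ : SmoothNear ξ p)
    {e : OpenPartialHomeomorph X (CSpace d)} {A : Finset (Fin d)} (he : IsAdaptedChart D p e A)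
    {J K : Fin d → ℕ} (hJK : (J, K) ∈ clearingExponents D θ p e A) :
    ∃ (ρ : ℝ) (c : CSpace d → ℂ), 0 < ρ ∧ Metric.ball 0 ρ ⊆ e.target ∧
      (∀ w ∈ Metric.ball 0 ρ, e.symm w ∈ (chartAt (CSpace d) x).source) ∧
      ContDiffOn ℝ ∞ c (Metric.ball 0 ρ) ∧
      ∀ w ∈ Metric.ball 0 ρ, (∀ j ∈ A, w j ≠ 0) →
        density (wedge hnm θ ξ) x (chartAt (CSpace d) x (e.symm w)) =
          ((∏ j, w j ^ J j) * ∏ j, conj (w j) ^ K j)⁻¹ * c w := by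
  obtain ⟨hJKA, η', hη', hη'θ⟩ := hJK
  set φ := chartAt (CSpace d) x with hφ
  obtain ⟨ι, hι, ε, α, β, H⟩ := exists_wedge_eq_sum (d := d) (X := X) hnm
  have htend := (φ.continuousAt hp).tendsto
  have hsrc : ∀ᶠ y in 𝓝 p, y ∈ φ.source := φ.open_source.mem_nhds hp
  obtain ⟨ρ, hρ, hρt, hρP⟩ := he.exists_ball (hsrc.and (hη'θ.and
    ((htend.eventually (hη'.eventually_contDiffAt hp)).and
      (htend.eventually (hξ.eventually_contDiffAt hp)))))
  refine ⟨ρ, fun w => density (wedge hnm η' ξ) x ((φ ∘ e.symm) w), hρ, hρt,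
    fun w hw => (hρP w hw).1, fun w hw => ContDiffAt.contDiffWithinAt ?_, fun w hw hwA => ?_⟩
  · have hσ : ContDiffAt ℝ ∞ (φ ∘ e.symm) w := ((contDiffAt_transition he.1
      (IsManifold.chart_mem_maximalAtlas x) (hρt hw) (hρP w hw).1).restrict_scalars ℝ).of_le le_top
    have hsum : (fun z => density (wedge hnm η' ξ) x z) = fun z => ∑ i, ε i *
        (localRep η' x z (stdFrame d ∘ α i) * localRep ξ x z (stdFrame d ∘ β i)) :=
      funext fun z => localRep_eq_sum (H η' ξ) x z (stdFrame d)
    have hdens : ContDiffAt ℝ ∞ (fun z => density (wedge hnm η' ξ) x z) (φ (e.symm w)) := by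
      rw [hsum]
      exact ContDiffAt.sum fun i _ => contDiffAt_const.mul
        (((hρP w hw).2.2.1 _).mul ((hρP w hw).2.2.2 _))
    exact ContDiffAt.comp (g := fun z => density (wedge hnm η' ξ) x z) w hdens hσ
  · have hyD : e.symm w ∉ D := (he.symm_mem_iff (hρt hw)).2 hwA
    have hmono : (∏ j, w j ^ J j) * ∏ j, conj (w j) ^ K j ≠ 0 := by
      have h0 : ∀ j, w j = 0 → J j = 0 ∧ K j = 0 := fun j hj => hJKA j fun hA => hwA j hA hj
      refine mul_ne_zero (Finset.prod_ne_zero_iff.2 fun j _ => ?_)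
        (Finset.prod_ne_zero_iff.2 fun j _ => ?_)
      · by_cases hj : w j = 0
        · simp [(h0 j hj).1]
        · exact pow_ne_zero _ hj
      · by_cases hj : w j = 0
        · simp [(h0 j hj).2]
        · exact pow_ne_zero _ (by simpa using hj)
    have h1 := (hρP w hw).2.1 hyD
    simp only [e.right_inv (hρt hw)] at h1
    have h2 : ∀ v, localRep η' x (φ (e.symm w)) v =
        ((∏ j, w j ^ J j) * ∏ j, conj (w j) ^ K j) * localRep θ x (φ (e.symm w)) v := by
      intro v
      rw [localRep_apply, localRep_apply, ← hφ, φ.left_inv (hρP w hw).1, h1]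
      rfl
    rw [eq_inv_mul_iff_mul_eq₀ hmono]
    simp only [density, Function.comp_apply]
    rw [localRep_eq_sum (H θ ξ), localRep_eq_sum (H η' ξ), Finset.mul_sum]
    refine Finset.sum_congr rfl fun i _ => ?_
    rw [h2]
    ring

variable [T2Space X] [SigmaCompactSpace X]

/-- In adapted coordinates, the density of `|s|^{2l} θ ∧ ξ` is `|z^I|^{2l} z^a z̄^b e^{l ψ} c` with
`ψ` and `c` smooth. -/
theorem exists_localDensity_eq [ContMDiffVectorBundle ω ℂ L 𝓘(ℂ, CSpace d)] {s : ∀ x, L x}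
    (hs : IsHolomorphicSection d s) (μ : LineMetric d L)
    (hD : HasNormalCrossings d (zeroLocus s)) (hnm : n + m = 2 * d) {θ : DForm d n X}
    (hθ : IsQuasiMeromorphic (zeroLocus s) θ) {ξ : DForm d m X} {p x : X}
    (hp : p ∈ (chartAt (CSpace d) x).source) (hξ : SmoothNear ξ p) :
    ∃ (e : OpenPartialHomeomorph X (CSpace d)) (ρ : ℝ) (I : Fin d → ℕ) (a b : Fin d → ℤ)
      (ψ : CSpace d → ℝ) (c : CSpace d → ℂ),
      e ∈ IsManifold.maximalAtlas 𝓘(ℂ, CSpace d) ω X ∧ p ∈ e.source ∧ e p = 0 ∧ 0 < ρ ∧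
      Metric.ball 0 ρ ⊆ e.target ∧
      (∀ w ∈ Metric.ball 0 ρ, e.symm w ∈ (chartAt (CSpace d) x).source) ∧
      (∀ k, I k = 0 → 0 ≤ a k ∧ 0 ≤ b k) ∧ mixedCount a b ≤ kappa (zeroLocus s) θ ∧
      ContDiffOn ℝ ∞ ψ (Metric.ball 0 ρ) ∧ ContDiffOn ℝ ∞ c (Metric.ball 0 ρ) ∧
      ∀ l : ℂ, 0 < l.re → ∀ w ∈ Metric.ball 0 ρ,
        localDensity (regularizedForm hnm s μ θ ξ l) x (chartAt (CSpace d) x (e.symm w)) =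
          absMonomial I a b l w * (Complex.exp (l * ψ w) * c w) := by
  obtain ⟨e, A, he⟩ := hD p
  obtain ⟨J, K, hJK⟩ := exists_isPoleOrder hθ he
  obtain ⟨I, ρ₁, W, hI, hρ₁, hρ₁t, hW, hWs⟩ := exists_norm_section_eq hs μ he
  obtain ⟨ρ₂, c, hρ₂, hρ₂t, hρ₂φ, hc, hcd⟩ := exists_density_wedge_eq hnm hp hξ he hJK.1
  have hsub1 : Metric.ball (0 : CSpace d) (min ρ₁ ρ₂) ⊆ Metric.ball 0 ρ₁ :=
    Metric.ball_subset_ball (min_le_left _ _)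
  have hsub2 : Metric.ball (0 : CSpace d) (min ρ₁ ρ₂) ⊆ Metric.ball 0 ρ₂ :=
    Metric.ball_subset_ball (min_le_right _ _)
  have hr : ContDiffOn ℝ ∞ (chartPartition d X x ∘ e.symm) (Metric.ball 0 (min ρ₁ ρ₂)) := by
    intro w hw
    exact (contDiffAt_comp_symm_of_contMDiffAt he.1 (hρ₁t (hsub1 hw))
      ((chartPartition d X x).contMDiff.contMDiffAt)).contDiffWithinAt
  refine ⟨e, min ρ₁ ρ₂, I, fun j => -(J j : ℤ), fun j => -(K j : ℤ),
    fun w => 2 * Real.log (W w), fun w => (chartPartition d X x (e.symm w) : ℂ) * c w, he.1,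
    he.2.1, he.2.2.1, lt_min hρ₁ hρ₂, hsub1.trans hρ₁t, fun w hw => hρ₂φ w (hsub2 hw), ?_,
    ?_, ?_, ?_, ?_⟩
  · intro k hk
    have hkA : k ∉ A := fun h => (hI k).2 h hk
    have := hJK.1.1 k hkA
    simp only at this
    simp [this.1, this.2]
  · rw [mixedCount_neg]
    exact card_mixedIndices_le_kappa he hJK
  · exact contDiffOn_const.mul ((hW.mono hsub1).log fun w hw => (hWs w (hsub1 hw)).1.ne')
  · exact (Complex.ofRealCLM.contDiff.comp_contDiffOn hr).mul (hc.mono hsub2)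
  · intro l hl w hw
    set φ := chartAt (CSpace d) x with hφ
    have hy : φ.symm (φ (e.symm w)) = e.symm w := φ.left_inv (hρ₂φ w (hsub2 hw))
    obtain ⟨hWpos, hnorm⟩ := hWs w (hsub1 hw)
    have hl0 : l ≠ 0 := by
      rintro rfl
      simp at hl
    rw [localDensity, density_regularizedForm, ← hφ, hy, hnorm, cpow_monomial I w hWpos]
    by_cases hwA : ∀ j ∈ A, w j ≠ 0
    · rw [hcd w (hsub2 hw) hwA, absMonomial_eq_mul_prod]
      ring
    -- On `D` both sides are `0`, since `re l > 0` makes the modulus factor of the `j`-th coordinate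
    -- vanish; the arbitrary values of `θ` there play no role.
    · push Not at hwA
      obtain ⟨j, hj, hj0⟩ := hwA
      have hne : (I j * l : ℂ) ≠ 0 := mul_ne_zero (Nat.cast_ne_zero.2 ((hI j).2 hj)) hl0
      have h0 : ∀ a b : Fin d → ℤ, absMonomial I a b l w = 0 := fun a b =>
        Finset.prod_eq_zero (Finset.mem_univ j) (by rw [hj0, absPowMul_zero hne])
      rw [h0, h0]
      ring

end LocalExpression

/-! ### From an arbitrary chart to adapted coordinates -/

section ChangeOfVariables

theorem contDiff_indicator {E F : Type*} [NormedAddCommGroup E] [NormedSpace ℝ E]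
    [NormedAddCommGroup F] [NormedSpace ℝ F] {U K : Set E} (hU : IsOpen U) (hK : IsClosed K)
    (hKU : K ⊆ U) {f : E → F} (hf : ContDiffOn ℝ ∞ f U) (h0 : ∀ z ∈ U, z ∉ K → f z = 0) :
    ContDiff ℝ ∞ (U.indicator f) := by
  refine contDiff_iff_contDiffAt.2 fun z => ?_
  by_cases hz : z ∈ U
  · refine (hf.contDiffAt (hU.mem_nhds hz)).congr_of_eventuallyEq ?_
    filter_upwards [hU.mem_nhds hz] with w hw
    exact indicator_of_mem hw f
  · refine (contDiffAt_const (c := 0)).congr_of_eventuallyEq ?_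
    filter_upwards [hK.isOpen_compl.mem_nhds fun h => hz (hKU h)] with w hw
    by_cases hwU : w ∈ U
    · rw [indicator_of_mem hwU]
      exact h0 w hwU hw
    · exact indicator_of_notMem hwU f

theorem contDiff_det {E : Type*} [NormedAddCommGroup E] [NormedSpace ℝ E] [FiniteDimensional ℝ E] :
    ContDiff ℝ ∞ fun A : E →L[ℝ] E => A.det := by
  classical
  let b := Module.finBasis ℝ E
  have h : (fun A : E →L[ℝ] E => A.det) = fun A => ∑ σ : Equiv.Perm (Fin (Module.finrank ℝ E)),
      ((Equiv.Perm.sign σ : ℤ) : ℝ) * ∏ i, b.repr (A (b i)) (σ i) := by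
    funext A
    rw [ContinuousLinearMap.det, ← LinearMap.det_toMatrix b, Matrix.det_apply']
    simp [LinearMap.toMatrix_apply]
  rw [h]
  refine ContDiff.sum fun σ _ => contDiff_const.mul (contDiff_prod fun i _ => ?_)
  exact (b.coord (σ i)).toContinuousLinearMap.contDiff.comp
    (contDiff_id.clm_apply contDiff_const)

variable {d : ℕ}

/-- The integral of a function which becomes `|z^I|^{2l} z^a z̄^b e^{l ψ} c` in suitable coordinates,
multiplied by a cut-off function, has a rational continuation. -/
theorem hasRationalContinuation_of_coordinates {ρ : ℝ} (hρ : 0 < ρ)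
    {S T : CSpace d → CSpace d} (hS : ContDiffOn ℝ ∞ S (Metric.ball 0 ρ))
    (hT : ∀ w ∈ Metric.ball 0 ρ, ContDiffAt ℝ ∞ T (S w))
    (hTS : ∀ w ∈ Metric.ball 0 ρ, T (S w) = w) {I : Fin d → ℕ} {a b : Fin d → ℤ}
    (hI : ∀ k, I k = 0 → 0 ≤ a k ∧ 0 ≤ b k) {ψ : CSpace d → ℝ} {c : CSpace d → ℂ}
    (hψ : ContDiffOn ℝ ∞ ψ (Metric.ball 0 ρ)) (hc : ContDiffOn ℝ ∞ c (Metric.ball 0 ρ))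
    {F : ℂ → CSpace d → ℂ} (hF : ∀ l : ℂ, 0 < l.re → ∀ w ∈ Metric.ball 0 ρ,
      F l (S w) = absMonomial I a b l w * (Complex.exp (l * ψ w) * c w))
    {χ : CSpace d → ℝ} (hχ : ContDiff ℝ ∞ χ) (hχs : tsupport χ ⊆ S '' Metric.ball 0 (ρ / 2)) :
    ∃ R, 0 ≤ R ∧ (∀ l : ℂ, R < l.re → Integrable fun z => (χ z : ℂ) * F l z) ∧
      DifferentiableOn ℂ (fun l => ∫ z, (χ z : ℂ) * F l z) {l | R < l.re} ∧
      HasRationalContinuation (mixedCount a b) fun l => ∫ z, (χ z : ℂ) * F l z := by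
  have hB : IsOpen (Metric.ball (0 : CSpace d) ρ) := Metric.isOpen_ball
  have hB' : IsOpen (Metric.ball (0 : CSpace d) (ρ / 2)) := Metric.isOpen_ball
  have hsub : Metric.closedBall (0 : CSpace d) (ρ / 2) ⊆ Metric.ball 0 ρ :=
    Metric.closedBall_subset_ball (by linarith)
  have hsub' : Metric.ball (0 : CSpace d) (ρ / 2) ⊆ Metric.ball 0 ρ :=
    Metric.ball_subset_closedBall.trans hsub
  have hd : ∀ w ∈ Metric.ball (0 : CSpace d) ρ, HasFDerivAt S (fderiv ℝ S w) w := fun w hw =>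
    ((hS.contDiffAt (hB.mem_nhds hw)).differentiableAt (by simp)).hasFDerivAt
  -- A nowhere vanishing Jacobian is needed for `|det|` to be smooth, so that it can be absorbed in
  -- the amplitude.
  have hdet : ∀ w ∈ Metric.ball (0 : CSpace d) ρ, (fderiv ℝ S w).det ≠ 0 := by
    intro w hw h0
    have h1 : HasFDerivAt (T ∘ S) ((fderiv ℝ T (S w)).comp (fderiv ℝ S w)) w :=
      (((hT w hw).differentiableAt (by simp)).hasFDerivAt).comp w (hd w hw)
    have h2 : HasFDerivAt (T ∘ S) (ContinuousLinearMap.id ℝ (CSpace d)) w :=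
      (hasFDerivAt_id w).congr_of_eventuallyEq (by
        filter_upwards [hB.mem_nhds hw] with z hz using hTS z hz)
    have h3 := congrArg ContinuousLinearMap.det (h1.unique h2)
    rw [ContinuousLinearMap.det, ContinuousLinearMap.det, ContinuousLinearMap.toLinearMap_comp,
      LinearMap.det_comp] at h3
    rw [ContinuousLinearMap.det] at h0
    rw [h0] at h3
    simp at h3
  have hinj : InjOn S (Metric.ball 0 (ρ / 2)) := fun x hx y hy h => by
    rw [← hTS x (hsub' hx), ← hTS y (hsub' hy), h]
  have hcomp : IsCompact (tsupport χ) :=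
    ((isCompact_closedBall (0 : CSpace d) (ρ / 2)).image_of_continuousOn
      (hS.continuousOn.mono hsub)).of_isClosed_subset (isClosed_tsupport χ)
      (hχs.trans (image_mono Metric.ball_subset_closedBall))
  have hK : IsCompact (T '' tsupport χ) := by
    refine hcomp.image_of_continuousOn fun z hz => ?_
    obtain ⟨w, hw, rfl⟩ := hχs hz
    exact (hT w (hsub' hw)).continuousAt.continuousWithinAt
  have hKB : T '' tsupport χ ⊆ Metric.ball 0 (ρ / 2) := by
    rintro _ ⟨z, hz, rfl⟩
    obtain ⟨w, hw, rfl⟩ := hχs hz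
    rwa [hTS w (hsub' hw)]
  have hKS : ∀ w ∈ Metric.ball (0 : CSpace d) (ρ / 2), w ∉ T '' tsupport χ → χ (S w) = 0 := by
    intro w hw hwK
    by_contra h
    exact hwK ⟨S w, subset_tsupport χ h, hTS w (hsub' hw)⟩
  set Δ : CSpace d → ℝ := fun w => |(fderiv ℝ S w).det| with hΔ
  have hΔs : ContDiffOn ℝ ∞ Δ (Metric.ball 0 ρ) := by
    intro w hw
    have h1 : ContDiffAt ℝ ∞ (fun w => (fderiv ℝ S w).det) w :=
      contDiff_det.contDiffAt.comp w
        ((hS.contDiffAt (hB.mem_nhds hw)).fderiv_right (m := ∞) (by simp))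
    exact (h1.abs (hdet w hw)).contDiffWithinAt
  -- The amplitude in the new coordinates, made of cut-off, Jacobian and `c`. Extension by zero is
  -- smooth because the support of the cut-off has compact image in the half-radius ball.
  let κ : CSpace d → ℂ := (Metric.ball 0 (ρ / 2)).indicator fun w => ((χ (S w) * Δ w : ℝ) : ℂ) * c w
  have hκ : ContDiff ℝ ∞ κ := by
    refine contDiff_indicator hB' hK.isClosed hKB ?_ fun w hw hwK => ?_
    · refine (Complex.ofRealCLM.contDiff.comp_contDiffOn (ContDiffOn.mul ?_ (hΔs.mono hsub'))).mul
        (hc.mono hsub')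
      exact hχ.comp_contDiffOn (hS.mono hsub')
    · rw [hKS w hw hwK]
      simp
  have hκc : HasCompactSupport κ := by
    refine HasCompactSupport.intro hK fun w hw => ?_
    by_cases hwB : w ∈ Metric.ball (0 : CSpace d) (ρ / 2)
    · simp only [κ, indicator_of_mem hwB]
      rw [hKS w hwB hw]
      simp
    · exact indicator_of_notMem hwB _
  -- The theory of `monomialIntegral` needs a globally smooth exponent; only the values of `ψ` on
  -- the half-radius ball, which contains the support of `κ`, matter.
  obtain ⟨g, hg1, hg2⟩ : ∃ g : CSpace d → ℝ, ContDiff ℝ ∞ g ∧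
      ∀ w ∈ Metric.ball 0 (ρ / 2), g w = ψ w := by
    let f : ContDiffBump (0 : CSpace d) := ⟨ρ / 2, 3 * ρ / 4, by linarith, by linarith⟩
    refine ⟨(Metric.ball 0 ρ).indicator fun w => f w * ψ w, contDiff_indicator hB
      (Metric.isClosed_closedBall (x := (0 : CSpace d)) (ε := 3 * ρ / 4))
      (Metric.closedBall_subset_ball (by linarith)) (f.contDiff.contDiffOn.mul hψ) ?_, ?_⟩
    · intro w _ hw
      rw [f.zero_of_le_dist (by
        rw [Metric.mem_closedBall, not_le] at hw
        exact hw.le), zero_mul]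
    · intro w hw
      rw [indicator_of_mem (hsub' hw), f.one_of_mem_closedBall (Metric.ball_subset_closedBall hw),
        one_mul]
  obtain ⟨R, hR⟩ := exists_boundedRight (I := I) (a := a) (b := b) fun k hk =>
    add_nonneg (hI k hk).1 (hI k hk).2
  have hR' := hR (max R 0) (le_max_left _ _)
  have hsupp : ∀ l, Function.support (fun z => (χ z : ℂ) * F l z) ⊆ S '' Metric.ball 0 (ρ / 2) := by
    intro l z hz
    refine hχs (subset_tsupport χ fun h0 => hz ?_)
    simp [h0]
  have hpt : ∀ l : ℂ, 0 < l.re → ∀ w ∈ Metric.ball (0 : CSpace d) (ρ / 2),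
      |(fderiv ℝ S w).det| • ((χ (S w) : ℂ) * F l (S w)) =
        absMonomial I a b l w * (Complex.exp (l * g w) * κ w) := by
    intro l hl w hw
    rw [hF l hl w (hsub' hw), hg2 w hw]
    simp only [κ, indicator_of_mem hw, Complex.real_smul, hΔ]
    push_cast
    ring
  have hsupp' : ∀ l, Function.support (fun w => absMonomial I a b l w *
      (Complex.exp (l * g w) * κ w)) ⊆ Metric.ball 0 (ρ / 2) := by
    intro l w hw
    by_contra h
    refine hw ?_
    simp only [κ, indicator_of_notMem h, mul_zero]
  have hint : ∀ l : ℂ, 0 < l.re → ∫ z, (χ z : ℂ) * F l z = monomialIntegral I a b g κ l := by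
    intro l hl
    rw [← setIntegral_eq_integral_of_forall_compl_eq_zero (s := S '' Metric.ball 0 (ρ / 2))
      (fun z hz => Function.notMem_support.1 fun h => hz (hsupp l h)),
      integral_image_eq_integral_abs_det_fderiv_smul volume hB'.measurableSet
        (fun w hw => (hd w (hsub' hw)).hasFDerivWithinAt) hinj,
      setIntegral_congr_fun hB'.measurableSet (hpt l hl),
      setIntegral_eq_integral_of_forall_compl_eq_zero
        (fun w hw => Function.notMem_support.1 fun h => hw (hsupp' l h))]
    rfl
  refine ⟨max R 0, le_max_right _ _, fun l hl => ?_, ?_, ?_⟩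
  · have hl0 : 0 < l.re := (le_max_right _ _).trans_lt hl
    rw [← integrableOn_iff_integrable_of_support_subset (hsupp l),
      integrableOn_image_iff_integrableOn_abs_det_fderiv_smul volume hB'.measurableSet
        (fun w hw => (hd w (hsub' hw)).hasFDerivWithinAt) hinj,
      integrableOn_congr_fun (hpt l hl0) hB'.measurableSet]
    exact (integrable_monomialIntegrand hR' hg1.continuous hκ.continuous hκc hl).integrableOn
  · refine (differentiableOn_monomialIntegral hR' hg1.continuous hκ.continuous hκc).congr
      fun l hl => hint l ((le_max_right _ _).trans_lt hl)
  · exact (hasRationalContinuation_monomialIntegral hg1 hI hκ hκc).congr (R := 0) hint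

end ChangeOfVariables

/-! ### Summing the local contributions -/

section Globalization

variable {d n m : ℕ} {X : Type*} [TopologicalSpace X] [ChartedSpace (CSpace d) X]
  [IsManifold 𝓘(ℂ, CSpace d) ω X] [T2Space X] [SigmaCompactSpace X]
  {L : X → Type*} [TopologicalSpace (Bundle.TotalSpace ℂ L)]
  [∀ x, AddCommGroup (L x)] [∀ x, Module ℂ (L x)] [∀ x, TopologicalSpace (L x)]
  [FiberBundle ℂ L] [VectorBundle ℂ ℂ L]

theorem localDensity_eq_zero_of_form {hnm : n + m = 2 * d} {s : ∀ x, L x} {μ : LineMetric d L}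
    {θ : DForm d n X} {ξ : DForm d m X} {l : ℂ} {x : X} {z : CSpace d}
    (h : ξ ((chartAt (CSpace d) x).symm z) = 0) :
    localDensity (regularizedForm hnm s μ θ ξ l) x z = 0 := by
  obtain ⟨ι, hι, ε, α, β, H⟩ := exists_wedge_eq_sum (d := d) (X := X) hnm
  have h1 : ∀ v, localRep ξ x z v = 0 := fun v => by
    rw [localRep_apply, h]
    rfl
  rw [localDensity, density_regularizedForm, density, localRep_eq_sum (H θ ξ)]
  simp [h1]

theorem localDensity_eq_zero_of_partition {η : DForm d (2 * d) X} {x : X} {z : CSpace d}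
    (h : chartPartition d X x ((chartAt (CSpace d) x).symm z) = 0) : localDensity η x z = 0 := by
  rw [localDensity, h]
  simp

variable [ContMDiffVectorBundle ω ℂ L 𝓘(ℂ, CSpace d)]

/-- The rational continuation of the integrals of `|s|^{2l} θ ∧ ξ` cut off near a point. -/
theorem exists_nhds_hasRationalContinuation {s : ∀ x, L x}
    (hs : IsHolomorphicSection d s) (μ : LineMetric d L)
    (hD : HasNormalCrossings d (zeroLocus s)) (hnm : n + m = 2 * d) {θ : DForm d n X}
    (hθ : IsQuasiMeromorphic (zeroLocus s) θ) {ξ : DForm d m X} {p x : X}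
    (hp : p ∈ (chartAt (CSpace d) x).source) (hξ : SmoothNear ξ p) :
    ∃ V : Set (CSpace d), IsOpen V ∧ chartAt (CSpace d) x p ∈ V ∧ V ⊆ (chartAt (CSpace d) x).target ∧
      ∀ χ : CSpace d → ℝ, ContDiff ℝ ∞ χ → tsupport χ ⊆ V → ∃ R, 0 ≤ R ∧
        (∀ l : ℂ, R < l.re → Integrable fun z =>
          (χ z : ℂ) * localDensity (regularizedForm hnm s μ θ ξ l) x z) ∧
        DifferentiableOn ℂ (fun l => ∫ z, (χ z : ℂ) *
          localDensity (regularizedForm hnm s μ θ ξ l) x z) {l | R < l.re} ∧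
        HasRationalContinuation (kappa (zeroLocus s) θ) fun l => ∫ z, (χ z : ℂ) *
          localDensity (regularizedForm hnm s μ θ ξ l) x z := by
  obtain ⟨e, ρ, I, a, b, ψ, c, he, hpe, hep, hρ, hρt, hρφ, hI, hmix, hψ, hc, hF⟩ :=
    exists_localDensity_eq hs μ hD hnm hθ hp hξ
  set φ := chartAt (CSpace d) x with hφ
  have hφm : φ ∈ IsManifold.maximalAtlas 𝓘(ℂ, CSpace d) ω X := IsManifold.chart_mem_maximalAtlas x
  have hsub : Metric.ball (0 : CSpace d) (ρ / 2) ⊆ Metric.ball 0 ρ :=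
    Metric.ball_subset_ball (by linarith)
  have hinv : ∀ w ∈ Metric.ball (0 : CSpace d) ρ, φ.symm (φ (e.symm w)) = e.symm w := fun w hw =>
    φ.left_inv (hρφ w hw)
  refine ⟨(φ ∘ e.symm) '' Metric.ball 0 (ρ / 2), ?_, ⟨0, Metric.mem_ball_self (by linarith), ?_⟩,
    ?_, fun χ hχ hχs => ?_⟩
  · have h := (e.symm.trans φ).isOpen_image_of_subset_source (s := Metric.ball 0 (ρ / 2))
      Metric.isOpen_ball fun w hw => by
        rw [OpenPartialHomeomorph.trans_source]
        exact ⟨hρt (hsub hw), hρφ w (hsub hw)⟩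
    exact h
  · rw [Function.comp_apply, ← hep, e.left_inv hpe]
  · rintro _ ⟨w, hw, rfl⟩
    exact φ.map_source (hρφ w (hsub hw))
  · obtain ⟨R, hR, h1, h2, h3⟩ := hasRationalContinuation_of_coordinates hρ (S := φ ∘ e.symm)
      (T := e ∘ φ.symm) (F := fun l => localDensity (regularizedForm hnm s μ θ ξ l) x)
      (fun w hw => (((contDiffAt_transition he hφm (hρt hw) (hρφ w hw)).restrict_scalars
        ℝ).of_le le_top).contDiffWithinAt)
      (fun w hw => ((contDiffAt_transition hφm he (φ.map_source (hρφ w hw)) (by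
        rw [hinv w hw]
        exact e.map_target (hρt hw))).restrict_scalars ℝ).of_le le_top)
      (fun w hw => by
        simp only [Function.comp_apply]
        rw [hinv w hw, e.right_inv (hρt hw)])
      hI hψ hc hF hχ hχs
    exact ⟨R, hR, h1, h2, h3.mono hmix⟩

/-- The rational continuation of the contribution of a chart to the integral of
`|s|^{2l} θ ∧ ξ`. -/
theorem exists_chart_hasRationalContinuation {s : ∀ x, L x}
    (hs : IsHolomorphicSection d s) (μ : LineMetric d L)
    (hD : HasNormalCrossings d (zeroLocus s)) (hnm : n + m = 2 * d) {θ : DForm d n X}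
    (hθ : IsQuasiMeromorphic (zeroLocus s) θ) {ξ : DForm d m X} (hξ : IsTestForm ξ) (x : X) :
    ∃ R, 0 ≤ R ∧
      (∀ l : ℂ, R < l.re → IntegrableOn (localDensity (regularizedForm hnm s μ θ ξ l) x)
        (chartAt (CSpace d) x).target) ∧
      DifferentiableOn ℂ (fun l => ∫ z in (chartAt (CSpace d) x).target,
        localDensity (regularizedForm hnm s μ θ ξ l) x z) {l | R < l.re} ∧
      HasRationalContinuation (kappa (zeroLocus s) θ) fun l => ∫ z in (chartAt (CSpace d) x).target,
        localDensity (regularizedForm hnm s μ θ ξ l) x z := by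
  obtain ⟨hξs, K, hK, hξK⟩ := hξ
  set φ := chartAt (CSpace d) x with hφ
  have htsup : tsupport (chartPartition d X x) ⊆ φ.source := chartPartition_isSubordinate d X x
  -- Off this compact set either `ξ` or the partition function of the chart vanishes, so finitely
  -- many adapted neighbourhoods suffice.
  have hKc : IsCompact (φ '' (K ∩ tsupport (chartPartition d X x))) :=
    (hK.inter_right (isClosed_tsupport _)).image_of_continuousOn
      (φ.continuousOn.mono (inter_subset_right.trans htsup))
  have hloc : ∀ q ∈ φ '' (K ∩ tsupport (chartPartition d X x)), ∃ V : Set (CSpace d), IsOpen V ∧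
      q ∈ V ∧ V ⊆ φ.target ∧
      ∀ χ : CSpace d → ℝ, ContDiff ℝ ∞ χ → tsupport χ ⊆ V → ∃ R, 0 ≤ R ∧
        (∀ l : ℂ, R < l.re → Integrable fun z =>
          (χ z : ℂ) * localDensity (regularizedForm hnm s μ θ ξ l) x z) ∧
        DifferentiableOn ℂ (fun l => ∫ z, (χ z : ℂ) *
          localDensity (regularizedForm hnm s μ θ ξ l) x z) {l | R < l.re} ∧
        HasRationalContinuation (kappa (zeroLocus s) θ) fun l => ∫ z, (χ z : ℂ) *
          localDensity (regularizedForm hnm s μ θ ξ l) x z := by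
    rintro _ ⟨p, hp, rfl⟩
    exact exists_nhds_hasRationalContinuation hs μ hD hnm hθ (htsup hp.2) (hξs p)
  choose! V hVo hqV hVt hV using hloc
  obtain ⟨t, htK, htc⟩ := hKc.elim_nhds_subcover V fun q hq => (hVo q hq).mem_nhds (hqV q hq)
  -- This second partition of unity sums to one only on the compact set, which is enough, since the
  -- density vanishes on the rest of the chart.
  obtain ⟨f, hf⟩ := SmoothPartitionOfUnity.exists_isSubordinate 𝓘(ℝ, CSpace d) hKc.isClosed
    (fun q : t => V q) (fun q => hVo q (htK q q.2)) fun z hz => by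
      obtain ⟨q, hq, hz⟩ := mem_iUnion₂.1 (htc hz)
      exact mem_iUnion.2 ⟨⟨q, hq⟩, hz⟩
  have hex : ∀ q : t, _ := fun q => hV q (htK q q.2) (f q) (f q).contMDiff.contDiff (hf q)
  choose R hR hint hdiff hcont using hex
  have hsum : ∀ l : ℂ, φ.target.indicator (localDensity (regularizedForm hnm s μ θ ξ l) x) =
      fun z => ∑ q : t, (f q z : ℂ) * localDensity (regularizedForm hnm s μ θ ξ l) x z := by
    intro l
    funext z
    by_cases hz : z ∈ φ.target
    · rw [indicator_of_mem hz]
      by_cases hzK : z ∈ φ '' (K ∩ tsupport (chartPartition d X x))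
      · have h1 := f.sum_eq_one hzK
        rw [finsum_eq_sum_of_fintype] at h1
        rw [← Finset.sum_mul, ← Complex.ofReal_sum, h1, Complex.ofReal_one, one_mul]
      · have h0 : localDensity (regularizedForm hnm s μ θ ξ l) x z = 0 := by
          by_cases hzk : φ.symm z ∈ K
          · refine localDensity_eq_zero_of_partition (image_eq_zero_of_notMem_tsupport fun h => ?_)
            exact hzK ⟨φ.symm z, ⟨hzk, h⟩, φ.right_inv hz⟩
          · exact localDensity_eq_zero_of_form (hξK _ hzk)
        simp [h0]
    · rw [indicator_of_notMem hz]
      refine (Finset.sum_eq_zero fun q _ => ?_).symm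
      have h0 : f q z = 0 :=
        image_eq_zero_of_notMem_tsupport fun h => hz (hVt q (htK q q.2) (hf q h))
      rw [h0]
      simp
  have hRle : ∀ q, R q ≤ ∑ q, R q := fun q =>
    Finset.single_le_sum (f := R) (fun q _ => hR q) (Finset.mem_univ q)
  have heq : ∀ l : ℂ, ∑ q, R q < l.re →
      ∫ z in φ.target, localDensity (regularizedForm hnm s μ θ ξ l) x z =
        ∑ q : t, ∫ z, (f q z : ℂ) * localDensity (regularizedForm hnm s μ θ ξ l) x z := by
    intro l hl
    rw [← integral_indicator φ.open_target.measurableSet, hsum,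
      integral_finsetSum _ fun q _ => hint q l ((hRle q).trans_lt hl)]
  refine ⟨∑ q, R q, Finset.sum_nonneg fun q _ => hR q, fun l hl => ?_, ?_, ?_⟩
  · rw [← integrable_indicator_iff φ.open_target.measurableSet, hsum]
    exact integrable_finsetSum _ fun q _ => hint q l ((hRle q).trans_lt hl)
  · exact (DifferentiableOn.fun_sum fun q _ =>
      (hdiff q).mono (halfPlane_subset (hRle q))).congr heq
  · exact (HasRationalContinuation.sum Finset.univ fun q _ => hcont q).congr heq

end Globalization

end QuasiMero

/-! ### The main theorem -/

theorem theorem2p3 {d : ℕ} {X : Type*} [TopologicalSpace X] [T2Space X] [SigmaCompactSpace X]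
    [ChartedSpace (QuasiMero.CSpace d) X] [IsManifold 𝓘(ℂ, QuasiMero.CSpace d) ω X]
    {L : X → Type*} [TopologicalSpace (Bundle.TotalSpace ℂ L)]
    [∀ x, AddCommGroup (L x)] [∀ x, Module ℂ (L x)] [∀ x, TopologicalSpace (L x)]
    [FiberBundle ℂ L] [VectorBundle ℂ ℂ L]
    [ContMDiffVectorBundle ω ℂ L 𝓘(ℂ, QuasiMero.CSpace d)]
    (s : ∀ x, L x) (hs : QuasiMero.IsHolomorphicSection d s)
    (μ : QuasiMero.LineMetric d L)
    (hD : QuasiMero.HasNormalCrossings d (QuasiMero.zeroLocus s))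
    {n m : ℕ} (hnm : n + m = 2 * d)
    (θ : QuasiMero.DForm d n X)
    (hθ : QuasiMero.IsQuasiMeromorphic (QuasiMero.zeroLocus s) θ)
    (hmax : BddAbove (Set.range fun x => QuasiMero.poleWeightAt s θ x))
    (ξ : QuasiMero.DForm d m X) (hξ : QuasiMero.IsTestForm ξ) :
    ∃ R : ℝ,
      (∀ l : ℂ, R < l.re →
        QuasiMero.FormIntegrable (QuasiMero.regularizedForm hnm s μ θ ξ l)) ∧
      DifferentiableOn ℂ (QuasiMero.zetaFunction hnm s μ θ ξ) {l : ℂ | R < l.re} ∧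
      ∃ G : ℂ → ℂ,
        MeromorphicOn G Set.univ ∧
        (∀ l : ℂ, R < l.re → G l = QuasiMero.zetaFunction hnm s μ θ ξ l) ∧
        (∀ l : ℂ, meromorphicOrderAt G l < 0 → ∃ q : ℚ, l = (q : ℂ)) ∧
        ((-(QuasiMero.kappa (QuasiMero.zeroLocus s) θ : ℤ) : ℤ) : WithTop ℤ)
          ≤ meromorphicOrderAt G 0 := by
  obtain ⟨K, hK, hξK⟩ := hξ.2
  set φ : X → OpenPartialHomeomorph X (QuasiMero.CSpace d) := fun x => chartAt (QuasiMero.CSpace d) x with hφ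
  -- The partition is locally finite and `ξ` has compact support, so only finitely many charts
  -- contribute and the `finsum` in `formIntegral` is a finite sum.
  have hfin : {x | (Function.support (QuasiMero.chartPartition d X x) ∩ K).Nonempty}.Finite :=
    (QuasiMero.chartPartition d X).locallyFinite.finite_nonempty_inter_compact hK
  have hzero : ∀ x ∉ hfin.toFinset, ∀ l z,
      QuasiMero.localDensity (QuasiMero.regularizedForm hnm s μ θ ξ l) x z = 0 := by
    intro x hx l z
    rw [Set.Finite.mem_toFinset, mem_ofPred_eq, not_nonempty_iff_eq_empty] at hx
    by_cases hz : (φ x).symm z ∈ K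
    · refine QuasiMero.localDensity_eq_zero_of_partition (by_contra fun h => ?_)
      exact (hx.subset ⟨h, hz⟩ : _ ∈ (∅ : Set X))
    · exact QuasiMero.localDensity_eq_zero_of_form (hξK _ hz)
  choose R hR hint hdiff hcont using
    QuasiMero.exists_chart_hasRationalContinuation hs μ hD hnm hθ hξ
  have hRle : ∀ x ∈ hfin.toFinset, R x ≤ ∑ x ∈ hfin.toFinset, R x := fun x hx =>
    Finset.single_le_sum (f := R) (fun x _ => hR x) hx
  -- The weight in front does not depend on `l`, so as a constant factor it preserves the
  -- continuation and the bound at `0`.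
  have heq : QuasiMero.zetaFunction hnm s μ θ ξ = fun l => (QuasiMero.poleWeight s θ : ℂ) * ∑ x ∈ hfin.toFinset,
      ∫ z in (φ x).target, QuasiMero.localDensity (QuasiMero.regularizedForm hnm s μ θ ξ l) x z := by
    funext l
    rw [QuasiMero.zetaFunction, QuasiMero.formIntegral]
    congr 1
    refine finsum_eq_sum_of_support_subset _ fun x hx => ?_
    by_contra h
    refine hx ?_
    simp only [hzero x h l, integral_zero]
  have hd : DifferentiableOn ℂ (QuasiMero.zetaFunction hnm s μ θ ξ)
      {l : ℂ | ∑ x ∈ hfin.toFinset, R x < l.re} := by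
    rw [heq]
    exact (DifferentiableOn.fun_sum fun x hx =>
      (hdiff x).mono (QuasiMero.halfPlane_subset (hRle x hx))).const_mul _
  refine ⟨∑ x ∈ hfin.toFinset, R x, fun l hl x => ?_, hd, ?_⟩
  · by_cases hx : x ∈ hfin.toFinset
    · exact hint x l ((hRle x hx).trans_lt hl)
    · rw [show QuasiMero.localDensity (QuasiMero.regularizedForm hnm s μ θ ξ l) x = fun _ => 0 from
        funext (hzero x hx l)]
      exact integrableOn_zero
  · refine QuasiMero.HasRationalContinuation.exists_meromorphicOn ?_ (Finset.sum_nonneg fun x _ => hR x) hd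
    rw [heq]
    exact (QuasiMero.HasRationalContinuation.sum _ fun x _ => hcont x).const_mul _
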